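/- **Setting.** Let $G:[0,1]\to\mathbb R$ be continuous, convex, and differentiable on $(0,1)$. For $x,y\in[0,1]$ let $D_G(y\,\|\,x)=G(y)-G(x)-(y-x)G'(x)$ be the Bregman divergence (one-sided derivatives at $0,1$; $D_G(x\,\|\,x)=0$) and let $$\mathrm{JB}_G(a,b)=\tfrac12\Big(D_G\big(a\,\big\|\,\tfrac{a+b}2\big)+D_G\big(b\,\big\|\,\tfrac{a+b}2\big)\Big)=\tfrac{G(a)+G(b)}2-G\big(\tfrac{a+b}2\big)$$ be the Jensen–Bregman divergence. Let $c>0$ be such that $\mathrm{JB}_G(a,x)+\mathrm{JB}_G(x,b)\ge c\,\mathrm{JB}_G(a,b)$ for all $a,b,x\in[0,1]$. (This forces $c<1$ unless $G$ is affine; for affine $G$ all divergences vanish and an exponent $1/0$ below may be read as $0$.) Let $(\Omega,\mathbb P)$ be a probability space, $\sigma:\Omega\to\mathcal S$ and $\tau:\Omega\to\mathcal T$ (measurable) signals of Alice and Bob, and $Y:\Omega\to[0,1]$ a random variable. For measurable $S\subseteq\mathcal S$, $T\subseteq\mathcal T$ write $\mu_{\sigma\tau}=\mathbb E[Y\mid\sigma,\tau]$,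 $\mu_{\sigma T}=\mathbb E[Y\mid\sigma,\ \tau\in T]$, $\mu_{S\tau}=\mathbb E[Y\mid\sigma\in S,\ \tau]$, $\mu_{ST}=\mathbb E[Y\mid\sigma\in S,\tau\in T]$. Assume rectangle substitutes with respect to $G$: for all measurable $S,T$ with $\mathbb P(\sigma\in S,\tau\in T)>0$, $$\mathbb E[D_G(Y\|\mu_{S\tau})\mid S,T]-\mathbb E[D_G(Y\|\mu_{\sigma\tau})\mid S,T]\le \mathbb E[D_G(Y\|\mu_{ST})\mid S,T]-\mathbb E[D_G(Y\|\mu_{\sigma T})\mid S,T],$$ where "$\mid S,T$" means conditioning on $\sigma\in S,\tau\in T$. Consider a deterministic communication protocol in which each message is a (measurable) function of the sender's signal and the previous messages, and which terminates almost surely at a time determined by the messages sent so far. Let $a$ and $b$ be Alice's and Bob's expectations at the end, i.e. the conditional expectations of $Y$ given the final transcript and, respectively, $\sigma$ or $\tau$. Suppose that the protocol causes Alice and Bob to $\varepsilon$-agree, i.e. $\mathbb E[\mathrm{JB}_G(a,b)]\le\varepsilon$. For $x\ge0$ let $\tilde G(x)=\max\{G(s)-G(t): s,t\in[0,1],\ |s-t|\le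 x\}$, for $0\le x\le1$ let $$\tilde G^*(x)=\max\{w\tilde G(s)+(1-w)\tilde G(t): 0\le s,t,w\le1,\ ws+(1-w)t=x\}$$ be its concave envelope, and let $\tilde G^*(x)=\tilde G^*(1)$ for $x>1$. **Theorem.** For every $\beta>0$, both Alice and Bob are $\delta$-accurate after the protocol terminates, where $$\delta=\frac{8}{c^2}\,\beta+16\,\tilde G^*\!\left(\Big(\frac{\varepsilon}{\beta}\Big)^{1/(1-\log_2 c)}\right),$$ that is, $\mathbb E[D_G(\mu_{\sigma\tau}\,\|\,a)]\le\delta$ and $\mathbb E[D_G(\mu_{\sigma\tau}\,\|\,b)]\le\delta$. -/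

import Mathlib

open MeasureTheory ProbabilityTheory Set

noncomputable section

namespace AgreementAccuracy

universe u v w x

/-! ## Bregman generators and divergences -/

/-- A Bregman generator on `[0, 1]`: a continuous convex function on `[0, 1]` that is
differentiable on the interior (the slope may become infinite at `0` and `1`, as it does for the
negative Shannon entropy).  Only the values of `G` on `[0, 1]` are ever relevant. -/
structure IsBregmanGenerator (G : ℝ → ℝ) : Prop where
  convexOn : ConvexOn ℝ (Icc 0 1) G
  continuousOn : ContinuousOn G (Icc 0 1)
  differentiableOn : DifferentiableOn ℝ G (Ioo 0 1)

/-- The Bregman divergence `D_G(y ‖ x) = G y - G x - (y - x) G' x`, for `x, y ∈ [0, 1]`.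
At the endpoints `x = 0, 1` the derivative is the one-sided one.  If that one-sided derivative is
infinite, the value for `y ≠ x` is immaterial: below, the second argument is always a conditional
expectation of the first one, both with values in `[0, 1]`, so that they agree almost surely where
the second one is `0` or `1`, and `D_G(x ‖ x) = 0`. -/
def bregman (G : ℝ → ℝ) (y x : ℝ) : ℝ :=
  G y - G x - (y - x) * derivWithin G (Icc 0 1) x

/-- The Jensen–Bregman divergence. -/
def jensenBregman (G : ℝ → ℝ) (a b : ℝ) : ℝ :=
  (bregman G a ((a + b) / 2) + bregman G b ((a + b) / 2)) / 2

theorem jensenBregman_eq (G : ℝ → ℝ) (a b : ℝ) :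
    jensenBregman G a b = (G a + G b) / 2 - G ((a + b) / 2) := by
  unfold jensenBregman bregman
  ring

/-- The `c`-approximate triangle inequality for the Jensen–Bregman divergence. -/
def ApproxTriangle (G : ℝ → ℝ) (c : ℝ) : Prop :=
  ∀ a ∈ Icc (0 : ℝ) 1, ∀ b ∈ Icc (0 : ℝ) 1, ∀ x ∈ Icc (0 : ℝ) 1,
    c * jensenBregman G a b ≤ jensenBregman G a x + jensenBregman G x b

/-- The modulus `G̃ x`, the largest value of `G a - G b` over `a, b ∈ [0, 1]`, `|a - b| ≤ x`. -/
def modulus (G : ℝ → ℝ) (x : ℝ) : ℝ :=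
  sSup {d : ℝ | ∃ a ∈ Icc (0 : ℝ) 1, ∃ b ∈ Icc (0 : ℝ) 1, |a - b| ≤ x ∧ d = G a - G b}

/-- The concave envelope `G̃*` of the modulus on `[0, 1]`, extended by the constant value
`G̃* 1 = G̃ 1` to arguments larger than `1` (the modulus itself is constant there). -/
def modulusEnvelope (G : ℝ → ℝ) (x : ℝ) : ℝ :=
  sSup {v : ℝ | ∃ a ∈ Icc (0 : ℝ) 1, ∃ b ∈ Icc (0 : ℝ) 1, ∃ w ∈ Icc (0 : ℝ) 1,
    w * a + (1 - w) * b = min x 1 ∧ v = w * modulus G a + (1 - w) * modulus G b}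

/-! ## Information structures -/

/-- An information structure: a probability space, a signal `sigA` of Alice, a signal `sigB` of
Bob, and a random variable `Y` with values in `[0, 1]`. -/
structure InfoStructure (Ω : Type u) (S : Type v) (T : Type w)
    [MeasurableSpace Ω] [MeasurableSpace S] [MeasurableSpace T] where
  P : Measure Ω
  isProb : IsProbabilityMeasure P
  sigA : Ω → S
  measurable_sigA : Measurable sigA
  sigB : Ω → T
  measurable_sigB : Measurable sigB
  Y : Ω → ℝ
  measurable_Y : Measurable Y
  Y_mem : ∀ ω, Y ω ∈ Icc (0 : ℝ) 1

section Info

variable {Ω : Type u} {S : Type v} {T : Type w}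
  [mΩ : MeasurableSpace Ω] [mS : MeasurableSpace S] [mT : MeasurableSpace T]

namespace InfoStructure

variable (I : InfoStructure Ω S T)

/-- The sigma-algebra on `Ω` generated by Alice's signal. -/
abbrev algA : MeasurableSpace Ω := MeasurableSpace.comap I.sigA mS

/-- The sigma-algebra on `Ω` generated by Bob's signal. -/
abbrev algB : MeasurableSpace Ω := MeasurableSpace.comap I.sigB mT

/-- The event that Alice's signal lies in `A` and Bob's signal lies in `B`. -/
def rect (A : Set S) (B : Set T) : Set Ω := I.sigA ⁻¹' A ∩ I.sigB ⁻¹' B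

/-- `μ_{στ}`: the expectation of `Y` given both signals. -/
def muBoth : Ω → ℝ := I.P[I.Y | I.algA ⊔ I.algB]

/-- `μ_{σB}`: the expectation of `Y` given Alice's signal and the event that Bob's signal is
in `B`. -/
def muSigA (B : Set T) : Ω → ℝ := (I.P[|I.sigB ⁻¹' B])[I.Y | I.algA]

/-- `μ_{Aτ}`: the expectation of `Y` given Bob's signal and the event that Alice's signal is
in `A`. -/
def muSigB (A : Set S) : Ω → ℝ := (I.P[|I.sigA ⁻¹' A])[I.Y | I.algB]

/-- `μ_{AB}`: the expectation of `Y` given that the signal pair is in `A × B`. -/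
def muRect (A : Set S) (B : Set T) : ℝ := ∫ ω, I.Y ω ∂(I.P[|I.rect A B])

/-- Rectangle substitutes with respect to `G`: on every rectangle `A × B` (of positive
probability), learning Alice's signal reduces the expected divergence from `Y` at most as much for
an observer who knows Bob's signal as for an observer who does not.  (For a Bregman generator all
four integrands are almost surely nonnegative and integrable.) -/
def RectangleSubstitutes (G : ℝ → ℝ) : Prop :=
  ∀ A : Set S, MeasurableSet A → ∀ B : Set T, MeasurableSet B → I.P (I.rect A B) ≠ 0 →
    (∫ ω, bregman G (I.Y ω) (I.muSigB A ω) ∂(I.P[|I.rect A B]))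
        - (∫ ω, bregman G (I.Y ω) (I.muBoth ω) ∂(I.P[|I.rect A B]))
      ≤ (∫ ω, bregman G (I.Y ω) (I.muRect A B) ∂(I.P[|I.rect A B]))
        - (∫ ω, bregman G (I.Y ω) (I.muSigA B ω) ∂(I.P[|I.rect A B]))

/-- An estimate `a` (a random variable) is `δ`-accurate with respect to `G` if the expected
Bregman divergence from `μ_{στ}` to `a` is at most `δ`; in particular this expectation exists. -/
def Accurate (G : ℝ → ℝ) (a : Ω → ℝ) (δ : ℝ) : Prop :=
  Integrable (fun ω => bregman G (I.muBoth ω) (a ω)) I.P ∧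
    ∫ ω, bregman G (I.muBoth ω) (a ω) ∂I.P ≤ δ

end InfoStructure

/-! ## Communication protocols -/

/-- A deterministic communication protocol with messages in a measurable space `M`.  Message
number `n` (counted from `0`) is sent by Alice if `aliceTurn n` holds and by Bob otherwise (in
particular the two may alternate, with either of them starting).  It is a function of the sender's
signal and of the messages sent before.  The protocol ends as soon as the sequence of messages
sent so far belongs to `halt`, so the time of termination is known to both parties but need not be
fixed in advance. -/
structure Protocol (S : Type v) (T : Type w) (M : Type x)
    [MeasurableSpace S] [MeasurableSpace T] [MeasurableSpace M] where
  aliceTurn : ℕ → Bool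
  aliceMsg : (n : ℕ) → (Fin n → M) → S → M
  bobMsg : (n : ℕ) → (Fin n → M) → T → M
  halt : (n : ℕ) → Set (Fin n → M)
  measurable_aliceMsg : ∀ n, Measurable fun p : (Fin n → M) × S => aliceMsg n p.1 p.2
  measurable_bobMsg : ∀ n, Measurable fun p : (Fin n → M) × T => bobMsg n p.1 p.2
  measurableSet_halt : ∀ n, MeasurableSet (halt n)

namespace Protocol

variable {M : Type x} [mM : MeasurableSpace M] (π : Protocol S T M)

/-- The first `n` messages on the signal pair `(s, t)`, disregarding the stopping rule. -/
def transcript (s : S) (t : T) : (n : ℕ) → (Fin n → M)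
  | 0 => Fin.elim0
  | n + 1 => Fin.snoc (α := fun _ => M) (transcript s t n)
      (if π.aliceTurn n then π.aliceMsg n (transcript s t n) s
        else π.bobMsg n (transcript s t n) t)

/-- The protocol terminates on the signal pair `(s, t)`. -/
def TerminatesOn (s : S) (t : T) : Prop := ∃ n, π.transcript s t n ∈ π.halt n

/-- The number of messages sent before the protocol terminates on the signal pair `(s, t)`. -/
def endTime (s : S) (t : T) : ℕ := sInf {n | π.transcript s t n ∈ π.halt n}

/-- The final transcript on the signal pair `(s, t)`: its length together with the messages. -/
def finalTranscript (s : S) (t : T) : Σ n : ℕ, (Fin n → M) :=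
  ⟨π.endTime s t, π.transcript s t (π.endTime s t)⟩

/-- The sigma-algebra on `Ω` generated by the final transcript. -/
abbrev algTranscript (I : InfoStructure Ω S T) : MeasurableSpace Ω :=
  MeasurableSpace.comap (fun ω => π.finalTranscript (I.sigA ω) (I.sigB ω)) inferInstance

/-- Alice's expectation at the end: the expectation of `Y` given her signal and the transcript.
Where the transcript restricts the signal pair to a rectangle `A × B` of positive probability, it
is `μ_{σB}`; conditioning on the transcript also makes sense if single transcripts have
probability zero, as may happen when the messages are real numbers. -/
def aliceExpectation (I : InfoStructure Ω S T) : Ω → ℝ :=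
  I.P[I.Y | I.algA ⊔ π.algTranscript I]

/-- Bob's expectation at the end: the expectation of `Y` given his signal and the transcript. -/
def bobExpectation (I : InfoStructure Ω S T) : Ω → ℝ :=
  I.P[I.Y | I.algB ⊔ π.algTranscript I]

/-- The protocol (terminates almost surely and) causes Alice and Bob to `ε`-agree with respect to
`G`: at its end, the expected Jensen–Bregman divergence between their expectations is at most
`ε`.  (For a Bregman generator the integrand is almost surely bounded.) -/
def CausesAgreement (I : InfoStructure Ω S T) (G : ℝ → ℝ) (ε : ℝ) : Prop :=
  (∀ᵐ ω ∂I.P, π.TerminatesOn (I.sigA ω) (I.sigB ω)) ∧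
    ∫ ω, jensenBregman G (π.aliceExpectation I ω) (π.bobExpectation I ω) ∂I.P ≤ ε

end Protocol

end Info

end AgreementAccuracy

end

/-!
Write `V m = E G(E[Y | m])` for the potential of a `σ`-algebra `m`.  The expected divergence of a
random variable from its conditional expectation is a difference of potentials
(`integrable_bregman_condExp`, `integrable_bregman_condExp_condExp`; integrability is part of the
claim, since the slope of `G` may be infinite at `0` and `1`).  Let `A`, `B` and `T` be the
information of Alice, of Bob and of the transcript.  Bob's inaccuracy is then
`V (A ⊔ B) - V (B ⊔ T)`, and rectangle substitutes say that, on each rectangle, Alice's signal adds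
at most as much potential for Bob as for an observer without a signal.

*From rectangles to `σ`-algebras.* Messages may be continuous, so `T` need not come from a countable
partition into rectangles.  It is, however, approximated by finite rectangle partitions
(`RectangleApproximable`).  This property passes from `F` to every `σ`-algebra between `F` and
`A ⊔ F` or `B ⊔ F` (`RectangleApproximable.of_le_sup_left`), hence to the messages one by one, and
through almost sure termination to `T` (`rectangleApproximable_algTranscript`).  The substitutes
inequality `V (A ⊔ B) + V T' ≤ V (A ⊔ T') + V (B ⊔ T')` follows for all approximable `T'`
(`potential_add_le_of_rectangleApproximable`), in particular for `T ≤ T' ≤ A ⊔ T`.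

*A coordinate for the divergence.* With `p = 1 / (1 - log₂ c)`, the power `JB ^ p` of the
Jensen–Bregman divergence satisfies `d x z ≤ 2 * max (d x y) (d y z)`.  By Frink's lemma
(`exists_metric_of_quasi_triangle`) it is comparable to a metric; cutting `[0, 1]` into consecutive
cells of a given size in this metric yields a function `F` on `[0, 1]` whose increments below `1`
are bounded by a multiple of `JB ^ p`, while sets of `F`-diameter below `1` have small `JB`-diameter
(`exists_jensenBregman_coordinate`).

*Rounding.* Let `a` and `b` be the final expectations.  Jensen's inequality bounds the mean of
`min 1 |F a - F b|` by a multiple of `(ε / β) ^ p`, so for a suitable shift `t` the labels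
`⌊F a + t⌋` and `⌊F b + t⌋` differ only with such a probability
(`exists_shift_measure_floor_ne_le`).  Let `T'` be `T` together with Alice's label `⌊F a + t⌋`.
Then `A ⊔ T' = A ⊔ T`, and Bob's inaccuracy is at most
`(V (A ⊔ T) - V T') + (V (B ⊔ T') - V (B ⊔ T))`.  The first difference is at most `8 β / c ²`: given
the label, `a` lies in an interval of small divergence, on which `G` is close to a chord
(`potential_sub_le_of_label`).  The second one is bounded by the modulus of `G`: Bob predicts the
label correctly but for an event of small probability, so hearing it changes his expectation little
in mean (`potential_sup_comap_sub_le`).  The two bounds are combined in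
`potential_sub_le_of_agreement`, which applies to Alice with the roles exchanged.
-/

noncomputable section

namespace AgreementAccuracy

universe u v w x

/-! ### Chain metrics and cuts of the line -/

/-- If `d` satisfies `d x z ≤ 2 * max (d x y) (d y z)`, then along a chain with at least two links
the distance of the ends is at most four times the sum of the links, the two end links being counted
only twice.  The chain is split at the last vertex from which the far end is still at distance at
least half of the total. -/
theorem chain_bound_of_quasi_triangle {X : Type*} (d : X → X → ℝ) (hnn : ∀ x y, 0 ≤ d x y)
    (htri : ∀ x y z, d x z ≤ 2 * max (d x y) (d y z)) (u : ℕ → X) (n : ℕ) : ∀ a : ℕ,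
    d (u a) (u (a + n + 2)) + 2 * d (u a) (u (a + 1)) + 2 * d (u (a + n + 1)) (u (a + n + 2))
      ≤ 4 * ∑ i ∈ Finset.range (n + 2), d (u (a + i)) (u (a + i + 1)) := by
  induction n using Nat.strong_induction_on with
  | _ n ih =>
    intro a
    have hsum : d (u a) (u (a + 1)) + d (u (a + n + 1)) (u (a + n + 2))
        ≤ ∑ i ∈ Finset.range (n + 2), d (u (a + i)) (u (a + i + 1)) := by
      rw [Finset.sum_range_succ, Finset.sum_range_succ']
      have : 0 ≤ ∑ i ∈ Finset.range n, d (u (a + (i + 1))) (u (a + (i + 1) + 1)) :=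
        Finset.sum_nonneg fun i _ => hnn _ _
      simp only [add_zero, ← add_assoc] at this ⊢
      linarith
    have hex : ∃ k, k ≤ n + 1 ∧ d (u a) (u (a + n + 2)) ≤ 2 * d (u (a + k)) (u (a + n + 2)) :=
      ⟨0, by omega, by simpa using by linarith [hnn (u a) (u (a + n + 2))]⟩
    classical
    obtain ⟨k, ⟨hk1, hk2⟩, hmax⟩ : ∃ k, (k ≤ n + 1 ∧
        d (u a) (u (a + n + 2)) ≤ 2 * d (u (a + k)) (u (a + n + 2))) ∧
        ∀ j, k < j → j ≤ n + 1 →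
          2 * d (u (a + j)) (u (a + n + 2)) < d (u a) (u (a + n + 2)) := by
      obtain ⟨k0, hk0⟩ := hex
      refine ⟨Nat.findGreatest (fun k => d (u a) (u (a + n + 2)) ≤
        2 * d (u (a + k)) (u (a + n + 2))) (n + 1), ⟨Nat.findGreatest_le _, ?_⟩, ?_⟩
      · exact Nat.findGreatest_spec
          (P := fun k => d (u a) (u (a + n + 2)) ≤ 2 * d (u (a + k)) (u (a + n + 2))) hk0.1 hk0.2
      · intro j hj hjn
        exact not_le.1 (Nat.findGreatest_is_greatest hj hjn)
    rcases Nat.lt_or_ge k (n + 1) with hkn | hkn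
    swap
    · obtain rfl : k = n + 1 := by omega
      have h1 := hnn (u a) (u (a + 1))
      have h2 : a + (n + 1) = a + n + 1 := by ring
      rw [h2] at hk2
      linarith
    have hfirst : d (u a) (u (a + n + 2)) ≤ 2 * d (u a) (u (a + (k + 1))) := by
      have h1 := hmax (k + 1) (by omega) (by omega)
      have h2 := htri (u a) (u (a + (k + 1))) (u (a + n + 2))
      rcases le_total (d (u a) (u (a + (k + 1)))) (d (u (a + (k + 1))) (u (a + n + 2))) with h | h
      · rw [max_eq_right h] at h2; linarith
      · rw [max_eq_left h] at h2; linarith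
    rcases Nat.eq_zero_or_pos k with rfl | hk0
    · have h1 := hnn (u (a + n + 1)) (u (a + n + 2))
      simp only [zero_add] at hfirst
      linarith
    obtain ⟨m, rfl⟩ : ∃ m, k = m + 1 := ⟨k - 1, by omega⟩
    obtain ⟨q, hq⟩ : ∃ q, n = m + 1 + q := ⟨n - (m + 1), by omega⟩
    have ih1 := ih m (by omega) a
    have ih2 := ih q (by omega) (a + (m + 1))
    have e1 : a + (m + 1) + q + 2 = a + n + 2 := by omega
    have e2 : a + (m + 1) + q + 1 = a + n + 1 := by omega
    rw [e1, e2] at ih2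
    have hsplit : ∑ i ∈ Finset.range (n + 2), d (u (a + i)) (u (a + i + 1))
        = ∑ i ∈ Finset.range (m + 1), d (u (a + i)) (u (a + i + 1))
          + ∑ i ∈ Finset.range (q + 2), d (u (a + (m + 1) + i)) (u (a + (m + 1) + i + 1)) := by
      have : n + 2 = (m + 1) + (q + 2) := by omega
      rw [this, Finset.sum_range_add]
      simp only [← add_assoc]
    have hsucc : ∑ i ∈ Finset.range (m + 2), d (u (a + i)) (u (a + i + 1))
        = ∑ i ∈ Finset.range (m + 1), d (u (a + i)) (u (a + i + 1))
          + d (u (a + (m + 1))) (u (a + (m + 1) + 1)) := by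
      rw [Finset.sum_range_succ]
    have e3 : a + m + 2 = a + (m + 1 + 1) := by omega
    have e4 : a + m + 1 = a + (m + 1) := by omega
    have e5 : a + (m + 1) + 1 = a + (m + 1 + 1) := by omega
    rw [e3, e4] at ih1
    rw [e5] at ih2 hsucc
    rw [hsplit]
    rw [hsucc] at ih1
    linarith

/-- A quasi-metric with `d x z ≤ 2 * max (d x y) (d y z)` is equivalent, up to the factor `4`, to
the largest pseudometric below it (Frink's metrization lemma). -/
theorem exists_metric_of_quasi_triangle {X : Type*} (d : X → X → ℝ) (hnn : ∀ x y, 0 ≤ d x y)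
    (hself : ∀ x, d x x = 0) (hcomm : ∀ x y, d x y = d y x)
    (htri : ∀ x y z, d x z ≤ 2 * max (d x y) (d y z)) :
    ∃ ρ : X → X → ℝ, (∀ x, ρ x x = 0) ∧ (∀ x y, ρ x y = ρ y x) ∧
      (∀ x y z, ρ x z ≤ ρ x y + ρ y z) ∧ (∀ x y, 0 ≤ ρ x y) ∧ (∀ x y, ρ x y ≤ d x y) ∧
      (∀ x y, d x y ≤ 4 * ρ x y) := by
  let e : X → X → NNReal := fun x y => ⟨d x y, hnn x y⟩
  have he1 : ∀ x, e x x = 0 := fun x => NNReal.eq (hself x)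
  have he2 : ∀ x y, e x y = e y x := fun x y => NNReal.eq (hcomm x y)
  let _ : PseudoMetricSpace X := PseudoMetricSpace.ofPreNNDist e he1 he2
  refine ⟨fun x y => dist x y, dist_self, dist_comm, dist_triangle, fun _ _ => dist_nonneg,
    fun x y => PseudoMetricSpace.dist_ofPreNNDist_le e he1 he2 x y, ?_⟩
  intro x y
  have hchain : ∀ (l : List X) (x y : X), ∃ (u : ℕ → X) (n : ℕ), u 0 = x ∧ u (n + 1) = y ∧
      ((((x :: l).zipWith e (l ++ [y])).sum : NNReal) : ℝ)
        = ∑ i ∈ Finset.range (n + 1), d (u i) (u (i + 1)) := by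
    intro l
    induction l with
    | nil =>
      intro x y
      refine ⟨fun i => if i = 0 then x else y, 0, by simp, by simp, ?_⟩
      change ((e x y + 0 : NNReal) : ℝ) = _
      rw [add_zero]
      simp [e]
      rfl
    | cons z l ih =>
      intro x y
      obtain ⟨u, n, h0, hn, hs⟩ := ih z y
      refine ⟨fun i => Nat.casesOn i x u, n + 1, rfl, hn, ?_⟩
      rw [Finset.sum_range_succ']
      simp only [List.cons_append, List.zipWith_cons_cons, List.sum_cons, NNReal.coe_add]
      rw [hs, add_comm, h0]
      rfl
  have hle : e x y ≤ 4 * ⨅ l : List X, ((x :: l).zipWith e (l ++ [y])).sum := by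
    rw [NNReal.mul_iInf]
    refine le_ciInf fun l => ?_
    rw [← NNReal.coe_le_coe, NNReal.coe_mul]
    obtain ⟨u, n, h0, hn, hs⟩ := hchain l x y
    rw [hs]
    change d x y ≤ 4 * _
    subst h0 hn
    rcases n with _ | n
    · simp only [zero_add, Finset.sum_range_one]
      linarith [hnn (u 0) (u 1)]
    · have h := chain_bound_of_quasi_triangle d hnn htri u n 0
      simp only [zero_add] at h
      have h1 := hnn (u 0) (u 1)
      have h2 := hnn (u (n + 1)) (u (n + 2))
      linarith
  exact NNReal.coe_le_coe.2 hle

/-- A coordinate on `[s, 1]` that measures a quasi-metric `d` at the scale `r`: it is Lipschitz for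
`d / r` as long as distances below `1` are concerned, and points whose coordinates differ by less
than `1` are `8 r`-close.  It is built from right to left, one cell of `ρ`-diameter `r` at a time,
where `ρ` is the chain metric of `d`; the last two properties concern the left end `s` and drive the
induction. -/
theorem exists_scale_coordinate_aux (d ρ : ℝ → ℝ → ℝ) (hnn : ∀ x y, 0 ≤ d x y)
    (htri : ∀ x y z, d x z ≤ 2 * max (d x y) (d y z))
    (hmono : ∀ x y z, x ≤ y → y ≤ z → d x y ≤ d x z ∧ d y z ≤ d x z)
    (hunif : ∀ r > 0, ∃ η > 0, ∀ x y, |x - y| ≤ η → d x y < r)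
    (hρself : ∀ x, ρ x x = 0) (hρcomm : ∀ x y, ρ x y = ρ y x)
    (hρtri : ∀ x y z, ρ x z ≤ ρ x y + ρ y z)
    (hρnn : ∀ x y, 0 ≤ ρ x y) (hρle : ∀ x y, ρ x y ≤ d x y) (hρge : ∀ x y, d x y ≤ 4 * ρ x y)
    {r : ℝ} (hr : 0 < r) {η : ℝ} (hηr : ∀ x y, |x - y| ≤ η → d x y < r) (n : ℕ) :
    ∀ s : ℝ, s ≤ 1 → 1 - s ≤ n * η → ∃ F : ℝ → ℝ, Measurable F ∧
      (∀ x ∈ Icc s 1, 0 ≤ F x) ∧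
      (∀ a b, s ≤ a → a ≤ b → b ≤ 1 → min 1 |F a - F b| ≤ 2 * d a b / r) ∧
      (∀ a b, s ≤ a → a ≤ b → b ≤ 1 → |F a - F b| < 1 → d a b ≤ 8 * r) ∧
      (∀ b, s ≤ b → b ≤ 1 → min 1 (F b) ≤ d s b / r) ∧
      (∀ b, s ≤ b → b ≤ 1 → F b < 1 → d s b ≤ 4 * r) := by
  have hρabs : ∀ s a b, |ρ s a - ρ s b| ≤ ρ a b := by
    intro s a b
    rw [abs_le]
    constructor
    · linarith [hρtri s a b]
    · linarith [hρtri s b a, hρcomm a b]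
  have hcont : ∀ s, Continuous (ρ s) := by
    intro s
    rw [Metric.continuous_iff]
    intro b e he
    obtain ⟨t, ht, hte⟩ := hunif e he
    refine ⟨t, ht, fun a ha => ?_⟩
    rw [Real.dist_eq] at ha ⊢
    exact ((hρabs s a b).trans (hρle a b)).trans_lt (hte a b ha.le)
  -- The case in which the remaining interval is a single cell.
  have hsingle : ∀ s : ℝ, (∀ x ∈ Icc s 1, ρ s x ≤ r) →
      ∃ F : ℝ → ℝ, Measurable F ∧
      (∀ x ∈ Icc s 1, 0 ≤ F x) ∧
      (∀ a b, s ≤ a → a ≤ b → b ≤ 1 → min 1 |F a - F b| ≤ 2 * d a b / r) ∧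
      (∀ a b, s ≤ a → a ≤ b → b ≤ 1 → |F a - F b| < 1 → d a b ≤ 8 * r) ∧
      (∀ b, s ≤ b → b ≤ 1 → min 1 (F b) ≤ d s b / r) ∧
      (∀ b, s ≤ b → b ≤ 1 → F b < 1 → d s b ≤ 4 * r) := by
    intro s hs
    refine ⟨fun x => ρ s x / r, (hcont s).measurable.div_const r, ?_, ?_, ?_, ?_, ?_⟩
    · exact fun x _ => div_nonneg (hρnn _ _) hr.le
    · intro a b _ _ _
      refine (min_le_right _ _).trans ?_
      rw [← sub_div, abs_div, abs_of_pos hr]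
      gcongr
      linarith [hρabs s a b, hρle a b, hnn a b]
    · intro a b hsa hab hb _
      have h1 := (hmono s a b hsa hab).2
      have h2 := hρge s b
      have h3 := hs b ⟨hsa.trans hab, hb⟩
      linarith
    · intro b _ _
      refine (min_le_right _ _).trans (div_le_div_of_nonneg_right ?_ hr.le)
      exact hρle s b
    · intro b hsb hb _
      have h2 := hρge s b
      have h3 := hs b ⟨hsb, hb⟩
      linarith
  induction n with
  | zero =>
    intro s hs1 hs2
    refine hsingle s fun x hx => ?_
    have h1 : x = s := le_antisymm (by norm_num at hs2; linarith [hx.2]) hx.1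
    rw [h1, hρself]
    exact hr.le
  | succ n ih =>
    intro s hs1 hs2
    by_cases hall : ∀ x ∈ Icc s 1, ρ s x ≤ r
    · exact hsingle s hall
    push Not at hall
    obtain ⟨x1, hx1, hx1r⟩ := hall
    -- The next cut is the first point at `ρ`-distance `r` from `s`.
    have hK : IsCompact {x ∈ Icc s 1 | ρ s x = r} := by
      refine isCompact_Icc.of_isClosed_subset ?_ (fun x hx => hx.1)
      exact isClosed_Icc.inter (isClosed_eq (hcont s) continuous_const)
    have hKne : {x ∈ Icc s 1 | ρ s x = r}.Nonempty := by
      have := intermediate_value_Icc hx1.1 (hcont s).continuousOn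
      obtain ⟨y, hy, hyr⟩ := this ⟨by rw [hρself]; exact hr.le, hx1r.le⟩
      exact ⟨y, ⟨hy.1, hy.2.trans hx1.2⟩, hyr⟩
    obtain ⟨t, ⟨ht, htr⟩, hmin⟩ := hK.exists_isLeast hKne
    have hst : ∀ x, s ≤ x → x ≤ t → ρ s x ≤ r := by
      intro x hsx hxt
      by_contra! hlt
      obtain ⟨y, hy, hyr⟩ := intermediate_value_Icc hsx (hcont s).continuousOn
        ⟨by rw [hρself]; exact hr.le, hlt.le⟩
      have := hmin ⟨⟨hy.1, hy.2.trans (hxt.trans ht.2)⟩, hyr⟩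
      have hyx : y = x := le_antisymm hy.2 (hxt.trans this)
      rw [hyx] at hyr
      linarith
    have htη : s + η ≤ t := by
      by_contra! hlt
      have h1 := hηr s t (by rw [abs_sub_comm, abs_of_nonneg] <;> linarith [ht.1])
      have h2 := hρle s t
      linarith
    obtain ⟨F, hFm, hF0, hF1, hF2, hF3, hF4⟩ := ih t ht.2 (by push_cast at hs2; linarith)
    have hdt : ∀ b, t ≤ b → 1 ≤ d s b / r := by
      intro b hb
      rw [le_div_iff₀ hr, one_mul]
      have h1 := (hmono s t b ht.1 hb).1
      have h2 := hρle s t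
      linarith
    refine ⟨fun x => if x ≤ t then ρ s x / r else 1 + F x,
      Measurable.ite measurableSet_Iic ((hcont s).measurable.div_const r)
        (measurable_const.add hFm), ?_, ?_, ?_, ?_, ?_⟩
    · intro x hx
      by_cases hxt : x ≤ t
      · simp only [hxt, if_true]
        exact div_nonneg (hρnn _ _) hr.le
      · simp only [hxt, if_false]
        exact add_nonneg zero_le_one (hF0 x ⟨(not_le.1 hxt).le, hx.2⟩)
    · intro a b hsa hab hb
      by_cases hbt : b ≤ t
      · simp only [hbt, hab.trans hbt, if_true]
        refine (min_le_right _ _).trans ?_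
        rw [← sub_div, abs_div, abs_of_pos hr]
        gcongr
        linarith [hρabs s a b, hρle a b, hnn a b]
      · by_cases hat : a ≤ t
        · simp only [hbt, hat, if_true, if_false]
          have htb : t ≤ b := (not_le.1 hbt).le
          have h1 := hF3 b htb hb
          have h2 := hF0 b ⟨htb, hb⟩
          have h3 : ρ s a / r ≤ 1 := (div_le_one hr).2 (hst a hsa hat)
          have h4 : 1 - ρ s a / r ≤ d a b / r := by
            rw [← sub_nonneg] at *
            have : d a b / r - (1 - ρ s a / r) = (d a b - (r - ρ s a)) / r := by
              field_simp
            rw [this]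
            refine div_nonneg ?_ hr.le
            have h5 := hρtri s a t
            have h6 := hρle a t
            have h7 := (hmono a t b (by linarith) (by linarith)).1
            linarith
          have h5 : d t b / r ≤ d a b / r := by
            gcongr
            exact (hmono a t b hat htb).2
          have h6 : |ρ s a / r - (1 + F b)| = (1 - ρ s a / r) + F b := by
            rw [abs_of_nonpos] <;> linarith
          rw [h6]
          have h7 : min 1 (1 - ρ s a / r + F b) ≤ (1 - ρ s a / r) + min 1 (F b) := by
            rcases le_total 1 (F b) with h | h
            · rw [min_eq_left h]; exact (min_le_left _ _).trans (by linarith)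
            · rw [min_eq_right h]; exact min_le_right _ _
          have h8 : 2 * d a b / r = d a b / r + d a b / r := by ring
          rw [h8]
          linarith
        · simp only [hbt, hat, if_false]
          rw [add_sub_add_left_eq_sub]
          exact hF1 a b (not_le.1 hat).le hab hb
    · intro a b hsa hab hb
      by_cases hbt : b ≤ t
      · intro _
        have h1 := (hmono s a b hsa hab).2
        have h2 := hρge s b
        have h3 := hst b (hsa.trans hab) hbt
        linarith
      · by_cases hat : a ≤ t
        · simp only [hbt, hat, if_true, if_false]
          intro hlt
          have htb : t ≤ b := (not_le.1 hbt).le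
          have h1 := (abs_lt.1 hlt).1
          have h3 : ρ s a / r ≤ 1 := (div_le_one hr).2 (hst a hsa hat)
          have h4 := hF4 b htb hb (by linarith)
          have h5 := (hmono s a b hsa hab).2
          have h6 := htri s t b
          have h7 : max (d s t) (d t b) ≤ 4 * r := max_le (by linarith [hρge s t]) h4
          linarith
        · simp only [hbt, hat, if_false]
          rw [add_sub_add_left_eq_sub]
          exact hF2 a b (not_le.1 hat).le hab hb
    · intro b hsb hb
      by_cases hbt : b ≤ t
      · simp only [hbt, if_true]
        refine (min_le_right _ _).trans ?_
        gcongr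
        exact hρle s b
      · exact (min_le_left _ _).trans (hdt b (not_le.1 hbt).le)
    · intro b hsb hb
      by_cases hbt : b ≤ t
      · intro _
        have h2 := hρge s b
        have h3 := hst b hsb hbt
        linarith
      · simp only [hbt, if_false]
        intro hlt
        have := hF0 b ⟨(not_le.1 hbt).le, hb⟩
        linarith

/-- A quasi-metric on the line that grows with intervals and is uniformly small on short intervals
has, for each scale `r`, a coordinate on `[0, 1]` that is `2 / r`-Lipschitz below distance
`1` and whose unit intervals pull back to sets of diameter at most `8 r`. -/
theorem exists_scale_coordinate (d : ℝ → ℝ → ℝ) (hnn : ∀ x y, 0 ≤ d x y)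
    (hself : ∀ x, d x x = 0) (hcomm : ∀ x y, d x y = d y x)
    (htri : ∀ x y z, d x z ≤ 2 * max (d x y) (d y z))
    (hmono : ∀ x y z, x ≤ y → y ≤ z → d x y ≤ d x z ∧ d y z ≤ d x z)
    (hunif : ∀ r > 0, ∃ η > 0, ∀ x y, |x - y| ≤ η → d x y < r) {r : ℝ} (hr : 0 < r) :
    ∃ F : ℝ → ℝ, Measurable F ∧
      (∀ a ∈ Icc (0 : ℝ) 1, ∀ b ∈ Icc (0 : ℝ) 1, min 1 |F a - F b| ≤ 2 * d a b / r) ∧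
      (∀ a ∈ Icc (0 : ℝ) 1, ∀ b ∈ Icc (0 : ℝ) 1, |F a - F b| < 1 → d a b ≤ 8 * r) := by
  obtain ⟨ρ, h1, h2, h3, h4, h5, h6⟩ := exists_metric_of_quasi_triangle d hnn hself hcomm htri
  obtain ⟨η, hη, hηr⟩ := hunif r hr
  obtain ⟨n, hn⟩ := exists_nat_ge (1 / η)
  obtain ⟨F, hFm, -, hF1, hF2, -, -⟩ := exists_scale_coordinate_aux d ρ hnn htri hmono hunif
    h1 h2 h3 h4 h5 h6 hr hηr n 0 zero_le_one (by
      rw [sub_zero]; exact (div_le_iff₀ hη).1 hn)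
  refine ⟨F, hFm, ?_, ?_⟩
  · intro a ha b hb
    rcases le_total a b with h | h
    · exact hF1 a b ha.1 h hb.2
    · rw [abs_sub_comm, hcomm]
      exact hF1 b a hb.1 h ha.2
  · intro a ha b hb
    rcases le_total a b with h | h
    · exact hF2 a b ha.1 h hb.2
    · rw [abs_sub_comm, hcomm]
      exact hF2 b a hb.1 h ha.2

/-! ### The Jensen–Bregman divergence as a quasi-metric -/

theorem add_div_two_mem_Icc {a b : ℝ} (ha : a ∈ Icc (0 : ℝ) 1) (hb : b ∈ Icc (0 : ℝ) 1) :
    (a + b) / 2 ∈ Icc (0 : ℝ) 1 :=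
  ⟨by linarith [ha.1, hb.1], by linarith [ha.2, hb.2]⟩

theorem convexOn_le_mul_add_mul {G : ℝ → ℝ} (hG : ConvexOn ℝ (Icc 0 1) G) {x y s t : ℝ}
    (hx : x ∈ Icc (0 : ℝ) 1) (hy : y ∈ Icc (0 : ℝ) 1) (hs : 0 ≤ s) (ht : 0 ≤ t) (hst : s + t = 1) :
    G (s * x + t * y) ≤ s * G x + t * G y := by
  simpa only [smul_eq_mul] using hG.2 hx hy hs ht hst

theorem jensenBregman_self (G : ℝ → ℝ) (a : ℝ) : jensenBregman G a a = 0 := by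
  rw [jensenBregman_eq, add_self_div_two, add_self_div_two, sub_self]

theorem jensenBregman_comm (G : ℝ → ℝ) (a b : ℝ) : jensenBregman G a b = jensenBregman G b a := by
  rw [jensenBregman_eq, jensenBregman_eq, add_comm (G a), add_comm a]

theorem jensenBregman_nonneg {G : ℝ → ℝ} (hG : ConvexOn ℝ (Icc 0 1) G) {a b : ℝ}
    (ha : a ∈ Icc (0 : ℝ) 1) (hb : b ∈ Icc (0 : ℝ) 1) : 0 ≤ jensenBregman G a b := by
  rw [jensenBregman_eq]
  have h := convexOn_le_mul_add_mul hG ha hb (s := 1 / 2) (t := 1 / 2)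
    (by norm_num) (by norm_num) (by norm_num)
  have e : 1 / 2 * a + 1 / 2 * b = (a + b) / 2 := by ring
  rw [e] at h
  linarith

theorem jensenBregman_le_right {G : ℝ → ℝ} (hG : ConvexOn ℝ (Icc 0 1) G) {a x b : ℝ}
    (ha : a ∈ Icc (0 : ℝ) 1) (hb : b ∈ Icc (0 : ℝ) 1) (hax : a ≤ x) (hxb : x ≤ b) :
    jensenBregman G a x ≤ jensenBregman G a b := by
  rcases eq_or_lt_of_le hxb with rfl | hlt
  · exact le_rfl
  have hx : x ∈ Icc (0 : ℝ) 1 := ⟨ha.1.trans hax, hxb.trans hb.2⟩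
  have hL : 0 < b - (a + x) / 2 := by linarith
  have key : ∀ y, (a + x) / 2 ≤ y → y ≤ b →
      (b - (a + x) / 2) * G y ≤ (b - y) * G ((a + x) / 2) + (y - (a + x) / 2) * G b := by
    intro y h1 h2
    have h := convexOn_le_mul_add_mul hG (add_div_two_mem_Icc ha hx) hb
      (s := (b - y) / (b - (a + x) / 2)) (t := (y - (a + x) / 2) / (b - (a + x) / 2))
      (div_nonneg (by linarith) hL.le) (div_nonneg (by linarith) hL.le) (by
        rw [← add_div, div_eq_one_iff_eq hL.ne']; ring)
    have e : (b - y) / (b - (a + x) / 2) * ((a + x) / 2)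
        + (y - (a + x) / 2) / (b - (a + x) / 2) * b = y := by
      rw [div_mul_eq_mul_div, div_mul_eq_mul_div, ← add_div, div_eq_iff hL.ne']; ring
    rw [e, div_mul_eq_mul_div, div_mul_eq_mul_div, ← add_div, le_div_iff₀ hL] at h
    linarith
  have h1 := key x (by linarith) hxb
  have h2 := key ((a + b) / 2) (by linarith) (by linarith)
  rw [jensenBregman_eq, jensenBregman_eq]
  have h3 : (b - (a + x) / 2) * (G x / 2 + G ((a + b) / 2))
      ≤ (b - (a + x) / 2) * (G ((a + x) / 2) + G b / 2) := by
    nlinarith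
  have h4 := le_of_mul_le_mul_left h3 hL
  linarith

theorem jensenBregman_le_left {G : ℝ → ℝ} (hG : ConvexOn ℝ (Icc 0 1) G) {a x b : ℝ}
    (ha : a ∈ Icc (0 : ℝ) 1) (hb : b ∈ Icc (0 : ℝ) 1) (hax : a ≤ x) (hxb : x ≤ b) :
    jensenBregman G x b ≤ jensenBregman G a b := by
  rcases eq_or_lt_of_le hax with rfl | hlt
  · exact le_rfl
  have hx : x ∈ Icc (0 : ℝ) 1 := ⟨ha.1.trans hax, hxb.trans hb.2⟩
  have hL : 0 < (x + b) / 2 - a := by linarith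
  have key : ∀ y, a ≤ y → y ≤ (x + b) / 2 →
      ((x + b) / 2 - a) * G y ≤ ((x + b) / 2 - y) * G a + (y - a) * G ((x + b) / 2) := by
    intro y h1 h2
    have h := convexOn_le_mul_add_mul hG ha (add_div_two_mem_Icc hx hb)
      (s := ((x + b) / 2 - y) / ((x + b) / 2 - a)) (t := (y - a) / ((x + b) / 2 - a))
      (div_nonneg (by linarith) hL.le) (div_nonneg (by linarith) hL.le) (by
        rw [← add_div, div_eq_one_iff_eq hL.ne']; ring)
    have e : ((x + b) / 2 - y) / ((x + b) / 2 - a) * a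
        + (y - a) / ((x + b) / 2 - a) * ((x + b) / 2) = y := by
      rw [div_mul_eq_mul_div, div_mul_eq_mul_div, ← add_div, div_eq_iff hL.ne']; ring
    rw [e, div_mul_eq_mul_div, div_mul_eq_mul_div, ← add_div, le_div_iff₀ hL] at h
    linarith
  have h1 := key x hax (by linarith)
  have h2 := key ((a + b) / 2) (by linarith) (by linarith)
  rw [jensenBregman_eq, jensenBregman_eq]
  have h3 : ((x + b) / 2 - a) * (G x / 2 + G ((a + b) / 2))
      ≤ ((x + b) / 2 - a) * (G ((x + b) / 2) + G a / 2) := by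
    nlinarith
  have h4 := le_of_mul_le_mul_left h3 hL
  linarith

theorem continuousOn_jensenBregman {G : ℝ → ℝ} (hG : ContinuousOn G (Icc 0 1)) :
    ContinuousOn (fun q : ℝ × ℝ => jensenBregman G q.1 q.2) (Icc 0 1 ×ˢ Icc 0 1) := by
  simp only [jensenBregman_eq]
  refine ContinuousOn.sub (ContinuousOn.div_const (ContinuousOn.add ?_ ?_) 2) ?_
  · exact hG.comp continuousOn_fst fun q hq => hq.1
  · exact hG.comp continuousOn_snd fun q hq => hq.2
  · exact hG.comp (by fun_prop) fun q hq => add_div_two_mem_Icc hq.1 hq.2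

/-- The value at `x` of the chord of `G` over `[l, r]`.  For `l = r` it is the constant `G l`. -/
def chord (G : ℝ → ℝ) (l r x : ℝ) : ℝ := G l + (G r - G l) / (r - l) * (x - l)

theorem le_chord {G : ℝ → ℝ} (hG : ConvexOn ℝ (Icc 0 1) G) {l r x : ℝ}
    (hl : l ∈ Icc (0 : ℝ) 1) (hr : r ∈ Icc (0 : ℝ) 1) (hx : x ∈ Icc l r) :
    G x ≤ chord G l r x := by
  rcases eq_or_lt_of_le (hx.1.trans hx.2) with rfl | hlt
  · obtain rfl : x = l := le_antisymm hx.2 hx.1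
    simp [chord]
  have hL : 0 < r - l := sub_pos.2 hlt
  have h := convexOn_le_mul_add_mul hG hl hr (s := (r - x) / (r - l)) (t := (x - l) / (r - l))
    (div_nonneg (by linarith [hx.2]) hL.le) (div_nonneg (by linarith [hx.1]) hL.le) (by
      rw [← add_div, div_eq_one_iff_eq hL.ne']; ring)
  have e : (r - x) / (r - l) * l + (x - l) / (r - l) * r = x := by
    rw [div_mul_eq_mul_div, div_mul_eq_mul_div, ← add_div, div_eq_iff hL.ne']; ring
  rw [e] at h
  refine h.trans (le_of_eq ?_)
  unfold chord
  field_simp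
  ring

/-- The gap between a convex function and its chord is at most twice the gap at the midpoint. -/
theorem chord_sub_le {G : ℝ → ℝ} (hG : ConvexOn ℝ (Icc 0 1) G) {l r x : ℝ}
    (hl : l ∈ Icc (0 : ℝ) 1) (hr : r ∈ Icc (0 : ℝ) 1) (hx : x ∈ Icc l r) :
    chord G l r x - G x ≤ 2 * jensenBregman G l r := by
  rcases eq_or_lt_of_le (hx.1.trans hx.2) with rfl | hlt
  · obtain rfl : x = l := le_antisymm hx.2 hx.1
    simp [chord, jensenBregman_self]
  have hL : 0 < r - l := sub_pos.2 hlt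
  have hx' : x ∈ Icc (0 : ℝ) 1 := ⟨hl.1.trans hx.1, hx.2.trans hr.2⟩
  have hgap : 0 ≤ chord G l r x - G x := sub_nonneg.2 (le_chord hG hl hr hx)
  have hmid : chord G l r ((l + r) / 2) = (G l + G r) / 2 := by
    unfold chord
    field_simp
    ring
  have hend : chord G l r r = G r := by
    unfold chord
    field_simp
    ring
  have hend' : chord G l r l = G l := by simp [chord]
  -- The midpoint lies between `x` and an end of the interval, and `x` has weight at least `1 / 2`.
  have main : ∀ y w : ℝ, y ∈ Icc (0 : ℝ) 1 → 1 / 2 ≤ w → w ≤ 1 → chord G l r y = G y →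
      w * x + (1 - w) * y = (l + r) / 2 → chord G l r x - G x ≤ 2 * jensenBregman G l r := by
    intro y w hy hw1 hw2 hcy he
    have h := convexOn_le_mul_add_mul hG hx' hy (s := w) (t := 1 - w)
      (by linarith) (by linarith) (by ring)
    rw [he] at h
    have h2 : w * chord G l r x + (1 - w) * chord G l r y = chord G l r ((l + r) / 2) := by
      rw [← he]; unfold chord; ring
    rw [hmid, hcy] at h2
    rw [jensenBregman_eq]
    nlinarith
  rcases le_total x ((l + r) / 2) with h | h
  · have hrx : 0 < r - x := by linarith
    refine main r ((r - (l + r) / 2) / (r - x)) hr ?_ ?_ hend ?_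
    · rw [le_div_iff₀ hrx]; linarith [hx.1]
    · rw [div_le_one hrx]; linarith
    · field_simp
      ring
  · have hrx : 0 < x - l := by linarith
    refine main l (((l + r) / 2 - l) / (x - l)) hl ?_ ?_ hend' ?_
    · rw [le_div_iff₀ hrx]; linarith [hx.2]
    · rw [div_le_one hrx]; linarith
    · field_simp
      ring

/-- Retraction of the line onto `[0, 1]`. -/
def clamp (x : ℝ) : ℝ := max 0 (min 1 x)

theorem clamp_mem (x : ℝ) : clamp x ∈ Icc (0 : ℝ) 1 :=
  ⟨le_max_left _ _, max_le zero_le_one (min_le_left _ _)⟩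

theorem clamp_of_mem {x : ℝ} (hx : x ∈ Icc (0 : ℝ) 1) : clamp x = x := by
  rw [clamp, min_eq_right hx.2, max_eq_right hx.1]

theorem continuous_clamp : Continuous clamp := by
  unfold clamp
  fun_prop

theorem clamp_mono {x y : ℝ} (h : x ≤ y) : clamp x ≤ clamp y := by
  unfold clamp
  gcongr

theorem abs_clamp_sub_le (x y : ℝ) : |clamp x - clamp y| ≤ |x - y| := by
  unfold clamp
  refine (abs_max_sub_max_le_max _ _ _ _).trans ?_
  refine max_le (by simp) ((abs_min_sub_min_le_max _ _ _ _).trans ?_)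
  simp

theorem two_div_rpow {c : ℝ} (hc : 0 < c) (hc1 : c ≤ 1) :
    (2 / c) ^ (1 / (1 - Real.logb 2 c)) = 2 := by
  have hlog : Real.logb 2 c ≤ 0 := Real.logb_nonpos (by norm_num) hc.le hc1
  have h2c' : 2 / c = (2 : ℝ) ^ (1 - Real.logb 2 c) := by
    rw [Real.rpow_sub (by norm_num), Real.rpow_one, Real.rpow_logb (by norm_num) (by norm_num) hc]
  rw [h2c', ← Real.rpow_mul (by norm_num), mul_one_div_cancel (by linarith), Real.rpow_one]

/-- The power `p = 1 / (1 - log₂ c)` of the Jensen–Bregman divergence turns the `c`-approximate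
triangle inequality into the quasi-triangle inequality with constant `2`, so that `[0, 1]` has a
coordinate adapted to it. -/
theorem exists_jensenBregman_coordinate {G : ℝ → ℝ} (hG : IsBregmanGenerator G) {c : ℝ}
    (hc : 0 < c) (hc1 : c ≤ 1) (hGc : ApproxTriangle G c) {r : ℝ} (hr : 0 < r) :
    ∃ F : ℝ → ℝ, Measurable F ∧
      (∀ a ∈ Icc (0 : ℝ) 1, ∀ b ∈ Icc (0 : ℝ) 1, min 1 |F a - F b|
        ≤ 2 * jensenBregman G a b ^ (1 / (1 - Real.logb 2 c)) / r) ∧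
      (∀ a ∈ Icc (0 : ℝ) 1, ∀ b ∈ Icc (0 : ℝ) 1, |F a - F b| < 1 →
        jensenBregman G a b ^ (1 / (1 - Real.logb 2 c)) ≤ 8 * r) := by
  set p := 1 / (1 - Real.logb 2 c) with hp
  have hlog : Real.logb 2 c ≤ 0 := Real.logb_nonpos (by norm_num) hc.le hc1
  have hp0 : 0 < p := by rw [hp]; apply one_div_pos.2; linarith
  have h2c : (2 / c) ^ p = 2 := two_div_rpow hc hc1
  have hJ := fun x y => jensenBregman_nonneg hG.convexOn (clamp_mem x) (clamp_mem y)
  have htri : ∀ x y z, jensenBregman G (clamp x) (clamp z) ^ p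
      ≤ 2 * max (jensenBregman G (clamp x) (clamp y) ^ p)
        (jensenBregman G (clamp y) (clamp z) ^ p) := by
    intro x y z
    have h := hGc _ (clamp_mem x) _ (clamp_mem z) _ (clamp_mem y)
    have h5 : jensenBregman G (clamp x) (clamp z) ≤ 2 / c *
        max (jensenBregman G (clamp x) (clamp y)) (jensenBregman G (clamp y) (clamp z)) := by
      rw [div_mul_eq_mul_div, le_div_iff₀ hc]
      linarith [le_max_left (jensenBregman G (clamp x) (clamp y))
        (jensenBregman G (clamp y) (clamp z)), le_max_right (jensenBregman G (clamp x) (clamp y))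
        (jensenBregman G (clamp y) (clamp z))]
    have h6 := Real.rpow_le_rpow (hJ x z) h5 hp0.le
    rw [Real.mul_rpow (by positivity) ((hJ x y).trans (le_max_left _ _)), h2c] at h6
    refine h6.trans (le_of_eq ?_)
    congr 1
    rcases le_total (jensenBregman G (clamp x) (clamp y)) (jensenBregman G (clamp y) (clamp z))
      with h | h
    · rw [max_eq_right h, max_eq_right (Real.rpow_le_rpow (hJ x y) h hp0.le)]
    · rw [max_eq_left h, max_eq_left (Real.rpow_le_rpow (hJ y z) h hp0.le)]
  have hmono : ∀ x y z, x ≤ y → y ≤ z →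
      jensenBregman G (clamp x) (clamp y) ^ p ≤ jensenBregman G (clamp x) (clamp z) ^ p ∧
      jensenBregman G (clamp y) (clamp z) ^ p ≤ jensenBregman G (clamp x) (clamp z) ^ p := by
    intro x y z hxy hyz
    exact ⟨Real.rpow_le_rpow (hJ _ _) (jensenBregman_le_right hG.convexOn (clamp_mem x)
      (clamp_mem z) (clamp_mono hxy) (clamp_mono hyz)) hp0.le,
      Real.rpow_le_rpow (hJ _ _) (jensenBregman_le_left hG.convexOn (clamp_mem x)
      (clamp_mem z) (clamp_mono hxy) (clamp_mono hyz)) hp0.le⟩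
  have hunif : ∀ r > 0, ∃ η > 0, ∀ x y : ℝ, |x - y| ≤ η →
      jensenBregman G (clamp x) (clamp y) ^ p < r := by
    intro s hs
    have hcont : ContinuousOn (fun q : ℝ × ℝ => jensenBregman G q.1 q.2 ^ p)
        (Icc 0 1 ×ˢ Icc 0 1) :=
      (continuousOn_jensenBregman hG.continuousOn).rpow_const fun _ _ => Or.inr hp0.le
    have huc := (isCompact_Icc.prod isCompact_Icc).uniformContinuousOn_of_continuous hcont
    rw [Metric.uniformContinuousOn_iff] at huc
    obtain ⟨η, hη, h⟩ := huc s hs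
    refine ⟨η / 2, half_pos hη, fun x y hxy => ?_⟩
    have h5 := h (clamp x, clamp y) ⟨clamp_mem x, clamp_mem y⟩ (clamp y, clamp y)
      ⟨clamp_mem y, clamp_mem y⟩ (by
        rw [Prod.dist_eq, dist_self, max_eq_left dist_nonneg, Real.dist_eq]
        linarith [abs_clamp_sub_le x y])
    simp only [jensenBregman_self, Real.zero_rpow hp0.ne', Real.dist_eq, sub_zero] at h5
    exact (le_abs_self _).trans_lt h5
  obtain ⟨F, h1, h3, h4⟩ := exists_scale_coordinate
    (fun x y => jensenBregman G (clamp x) (clamp y) ^ p)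
    (fun x y => Real.rpow_nonneg (hJ x y) p)
    (fun x => by rw [jensenBregman_self, Real.zero_rpow hp0.ne'])
    (fun x y => by rw [jensenBregman_comm]) htri hmono hunif hr
  refine ⟨F, h1, ?_, ?_⟩
  · intro a ha b hb
    simpa only [clamp_of_mem ha, clamp_of_mem hb] using h3 a ha b hb
  · intro a ha b hb
    simpa only [clamp_of_mem ha, clamp_of_mem hb] using h4 a ha b hb

/-! ### The modulus of the generator -/

theorem bddAbove_modulus {G : ℝ → ℝ} (hG : ContinuousOn G (Icc 0 1)) (x : ℝ) :
    BddAbove {d : ℝ | ∃ a ∈ Icc (0 : ℝ) 1, ∃ b ∈ Icc (0 : ℝ) 1, |a - b| ≤ x ∧ d = G a - G b} := by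
  obtain ⟨C, hC⟩ := isCompact_Icc.exists_bound_of_continuousOn hG
  refine ⟨2 * C, ?_⟩
  rintro _ ⟨a, ha, b, hb, -, rfl⟩
  have h1 := abs_le.1 (hC a ha)
  have h2 := abs_le.1 (hC b hb)
  linarith

theorem sub_le_modulus {G : ℝ → ℝ} (hG : ContinuousOn G (Icc 0 1)) {a b x : ℝ}
    (ha : a ∈ Icc (0 : ℝ) 1) (hb : b ∈ Icc (0 : ℝ) 1) (h : |a - b| ≤ x) :
    G a - G b ≤ modulus G x :=
  le_csSup (bddAbove_modulus hG x) ⟨a, ha, b, hb, h, rfl⟩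

theorem modulus_nonneg {G : ℝ → ℝ} (hG : ContinuousOn G (Icc 0 1)) {x : ℝ} (hx : 0 ≤ x) :
    0 ≤ modulus G x := by
  have h0 : (0 : ℝ) ∈ Icc (0 : ℝ) 1 := ⟨le_rfl, zero_le_one⟩
  simpa using sub_le_modulus hG h0 h0 (by simpa using hx)

theorem modulus_le_of_bound {G : ℝ → ℝ} {C : ℝ} (hC : ∀ x ∈ Icc (0 : ℝ) 1, ‖G x‖ ≤ C) {x : ℝ}
    (hx : 0 ≤ x) : modulus G x ≤ 2 * C := by
  have h0 : (0 : ℝ) ∈ Icc (0 : ℝ) 1 := ⟨le_rfl, zero_le_one⟩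
  refine csSup_le ⟨_, 0, h0, 0, h0, by simpa using hx, rfl⟩ ?_
  rintro _ ⟨a, ha, b, hb, -, rfl⟩
  have h1 := abs_le.1 (hC a ha)
  have h2 := abs_le.1 (hC b hb)
  linarith

/-- The modulus controls increments over distances longer than its argument linearly, since a
segment can be divided into short pieces. -/
theorem sub_le_mul_modulus {G : ℝ → ℝ} (hG : ContinuousOn G (Icc 0 1)) {u v z : ℝ}
    (hu : u ∈ Icc (0 : ℝ) 1) (hv : v ∈ Icc (0 : ℝ) 1) (hz : 0 < z) :
    G u - G v ≤ (1 + |u - v| / z) * modulus G z := by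
  rcases eq_or_ne u v with rfl | huv
  · simpa using modulus_nonneg hG hz.le
  have hpos : 0 < |u - v| / z := div_pos (abs_pos.2 (sub_ne_zero.2 huv)) hz
  set n := ⌈|u - v| / z⌉₊ with hn
  have hn0 : 0 < n := Nat.ceil_pos.2 hpos
  have hnR : (0 : ℝ) < n := Nat.cast_pos.2 hn0
  have hle : |u - v| / z ≤ n := Nat.le_ceil _
  have hlt : (n : ℝ) < |u - v| / z + 1 := Nat.ceil_lt_add_one hpos.le
  let x : ℕ → ℝ := fun i => v + i / n * (u - v)
  have hx : ∀ i ≤ n, x i ∈ Icc (0 : ℝ) 1 := by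
    intro i hi
    have h1 : (i : ℝ) / n ≤ 1 := (div_le_one hnR).2 (Nat.cast_le.2 hi)
    have h2 : 0 ≤ (i : ℝ) / n := by positivity
    have e : x i = (1 - i / n) * v + i / n * u := by simp only [x]; ring
    rw [e]
    exact convex_Icc (0 : ℝ) 1 hv hu (by linarith) h2 (by ring)
  have hstep : ∀ i ∈ Finset.range n, G (x (i + 1)) - G (x i) ≤ modulus G z := by
    intro i hi
    rw [Finset.mem_range] at hi
    refine sub_le_modulus hG (hx _ hi) (hx _ hi.le) ?_
    have e : x (i + 1) - x i = (u - v) / n := by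
      simp only [x]; push_cast; field_simp; ring
    rw [e, abs_div, abs_of_pos hnR, div_le_iff₀ hnR]
    rwa [div_le_iff₀ hz, mul_comm] at hle
  have htel := Finset.sum_range_sub (fun i => G (x i)) n
  have hx0 : x 0 = v := by simp [x]
  have hxn : x n = u := by simp [x, div_self hnR.ne']
  rw [hx0, hxn] at htel
  rw [← htel]
  refine (Finset.sum_le_card_nsmul _ _ _ hstep).trans ?_
  rw [Finset.card_range, nsmul_eq_mul]
  exact mul_le_mul_of_nonneg_right (by linarith) (modulus_nonneg hG hz.le)

theorem bddAbove_modulusEnvelope {G : ℝ → ℝ} (hG : ContinuousOn G (Icc 0 1)) (x : ℝ) :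
    BddAbove {v : ℝ | ∃ a ∈ Icc (0 : ℝ) 1, ∃ b ∈ Icc (0 : ℝ) 1, ∃ w ∈ Icc (0 : ℝ) 1,
      w * a + (1 - w) * b = min x 1 ∧ v = w * modulus G a + (1 - w) * modulus G b} := by
  obtain ⟨C, hC⟩ := isCompact_Icc.exists_bound_of_continuousOn hG
  refine ⟨2 * C, ?_⟩
  rintro _ ⟨a, ha, b, hb, w, hw, -, rfl⟩
  nlinarith [modulus_le_of_bound hC ha.1, modulus_le_of_bound hC hb.1, hw.1, hw.2]

theorem modulus_le_modulusEnvelope {G : ℝ → ℝ} (hG : ContinuousOn G (Icc 0 1)) {x : ℝ}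
    (hx : 0 ≤ x) : modulus G (min x 1) ≤ modulusEnvelope G x := by
  have hm : min x 1 ∈ Icc (0 : ℝ) 1 := ⟨le_min hx zero_le_one, min_le_right _ _⟩
  exact le_csSup (bddAbove_modulusEnvelope hG x)
    ⟨_, hm, _, hm, 1, ⟨zero_le_one, le_rfl⟩, by ring, by ring⟩

theorem modulusEnvelope_nonneg {G : ℝ → ℝ} (hG : ContinuousOn G (Icc 0 1)) (x : ℝ) :
    0 ≤ modulusEnvelope G x := by
  refine Real.sSup_nonneg ?_
  rintro _ ⟨a, ha, b, hb, w, hw, -, rfl⟩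
  have h1 := modulus_nonneg hG ha.1
  have h2 := modulus_nonneg hG hb.1
  exact add_nonneg (mul_nonneg hw.1 h1) (mul_nonneg (sub_nonneg.2 hw.2) h2)

/-! ### Expected potentials of conditional expectations -/

/-- A function measurable with respect to `m` and a label `k` is a function of the point, as seen
by `m`, and of the label. -/
theorem exists_eq_of_measurable_sup_comap {Ω κ : Type*} [m : MeasurableSpace Ω]
    [mκ : MeasurableSpace κ] {k : Ω → κ} {Z : Ω → ℝ} (hZ : Measurable[m ⊔ mκ.comap k] Z) :
    ∃ g : Ω × κ → ℝ, (∀ k' : Ω → κ, Measurable k' → Measurable fun ω => g (ω, k' ω)) ∧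
      ∀ ω, Z ω = g (ω, k ω) := by
  have hcomap : m ⊔ mκ.comap k
      = MeasurableSpace.comap (fun ω => (ω, k ω)) Prod.instMeasurableSpace := by
    rw [Prod.instMeasurableSpace, MeasurableSpace.prod, MeasurableSpace.comap_sup,
      MeasurableSpace.comap_comp, MeasurableSpace.comap_comp]
    congr 1
    exact MeasurableSpace.comap_id.symm
  rw [hcomap] at hZ
  obtain ⟨g, hg, hgZ⟩ := hZ.exists_eq_measurable_comp
  exact ⟨g, fun k' hk' => hg.comp (measurable_id.prodMk hk'), fun ω => congrFun hgZ ω⟩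

section Potential

variable {Ω : Type*} {m m' mΩ : MeasurableSpace Ω} {μ : Measure Ω}

/-- `E G(E[Y | m])`.  The expected divergence of `Y` from its conditional expectation given `m` is
`E G(Y)` minus this number. -/
def potential (G : ℝ → ℝ) (μ : Measure Ω) (Y : Ω → ℝ) (m : MeasurableSpace Ω) : ℝ :=
  ∫ ω, G ((μ[Y | m]) ω) ∂μ

theorem continuous_comp_clamp {G : ℝ → ℝ} (hG : ContinuousOn G (Icc 0 1)) :
    Continuous fun x => G (clamp x) :=
  hG.comp_continuous continuous_clamp clamp_mem

theorem aestronglyMeasurable_comp {G : ℝ → ℝ} (hG : ContinuousOn G (Icc 0 1)) {X : Ω → ℝ}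
    (hX : AEStronglyMeasurable X μ) (h01 : ∀ᵐ ω ∂μ, X ω ∈ Icc (0 : ℝ) 1) :
    AEStronglyMeasurable (fun ω => G (X ω)) μ := by
  refine ((continuous_comp_clamp hG).comp_aestronglyMeasurable hX).congr ?_
  filter_upwards [h01] with ω hω
  rw [clamp_of_mem hω]

theorem potential_congr {G : ℝ → ℝ} {Y : Ω → ℝ}
    (h : μ[Y | m] =ᵐ[μ] μ[Y | m']) : potential G μ Y m = potential G μ Y m' := by
  refine integral_congr_ae ?_
  filter_upwards [h] with ω hω
  rw [hω]

variable [IsProbabilityMeasure μ]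

theorem integrable_of_ae_mem_Icc {X : Ω → ℝ} (hX : AEStronglyMeasurable X μ)
    (h01 : ∀ᵐ ω ∂μ, X ω ∈ Icc (0 : ℝ) 1) : Integrable X μ := by
  refine Integrable.of_bound hX 1 ?_
  filter_upwards [h01] with ω hω
  rw [Real.norm_eq_abs, abs_le]
  exact ⟨by linarith [hω.1], hω.2⟩

theorem ae_condExp_mem_Icc {Y : Ω → ℝ} (hY : Integrable Y μ)
    (h01 : ∀ᵐ ω ∂μ, Y ω ∈ Icc (0 : ℝ) 1) (hm : m ≤ mΩ) :
    ∀ᵐ ω ∂μ, (μ[Y | m]) ω ∈ Icc (0 : ℝ) 1 := by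
  have h0 : 0 ≤ᵐ[μ] μ[Y | m] := condExp_nonneg (h01.mono fun ω hω => hω.1)
  have h1 : μ[Y | m] ≤ᵐ[μ] μ[fun _ => (1 : ℝ) | m] :=
    condExp_mono hY (integrable_const _) (h01.mono fun ω hω => hω.2)
  rw [condExp_const hm] at h1
  filter_upwards [h0, h1] with ω a b using ⟨a, b⟩

theorem integrable_comp {G : ℝ → ℝ} (hG : ContinuousOn G (Icc 0 1)) {X : Ω → ℝ}
    (hX : AEStronglyMeasurable X μ) (h01 : ∀ᵐ ω ∂μ, X ω ∈ Icc (0 : ℝ) 1) :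
    Integrable (fun ω => G (X ω)) μ := by
  obtain ⟨C, hC⟩ := isCompact_Icc.exists_bound_of_continuousOn hG
  refine Integrable.of_bound (aestronglyMeasurable_comp hG hX h01) C ?_
  filter_upwards [h01] with ω hω using hC _ hω

theorem integrable_comp_condExp {G : ℝ → ℝ} (hG : ContinuousOn G (Icc 0 1)) {Y : Ω → ℝ}
    (hY : Integrable Y μ) (h01 : ∀ᵐ ω ∂μ, Y ω ∈ Icc (0 : ℝ) 1)
    (hm : m ≤ mΩ) : Integrable (fun ω => G ((μ[Y | m]) ω)) μ :=
  integrable_comp hG integrable_condExp.aestronglyMeasurable (ae_condExp_mem_Icc hY h01 hm)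

theorem bregman_nonneg {G : ℝ → ℝ} (hG : IsBregmanGenerator G) {x y : ℝ}
    (hx : x ∈ Ioo (0 : ℝ) 1) (hy : y ∈ Icc (0 : ℝ) 1) : 0 ≤ bregman G y x := by
  have hd : DifferentiableAt ℝ G x :=
    (hG.differentiableOn x hx).differentiableAt (Ioo_mem_nhds hx.1 hx.2)
  have hdw : derivWithin G (Icc 0 1) x = deriv G x :=
    derivWithin_of_mem_nhds (Icc_mem_nhds hx.1 hx.2)
  have hx' : x ∈ Icc (0 : ℝ) 1 := Ioo_subset_Icc_self hx
  unfold bregman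
  rw [hdw]
  rcases lt_trichotomy x y with h | h | h
  · have h1 := hG.convexOn.le_slope_of_hasDerivAt hx' hy h hd.hasDerivAt
    rw [slope_def_field, le_div_iff₀ (by linarith)] at h1
    linarith
  · subst h; simp
  · have h1 := hG.convexOn.slope_le_of_hasDerivAt hy hx' h hd.hasDerivAt
    rw [slope_def_field, div_le_iff₀ (by linarith)] at h1
    linarith

theorem exists_bound_derivWithin {G : ℝ → ℝ} (hG : IsBregmanGenerator G) {s t : ℝ} (hs : 0 < s)
    (ht : t < 1) : ∃ C, ∀ x ∈ Icc s t, |derivWithin G (Icc 0 1) x| ≤ C := by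
  rcases lt_or_ge t s with h | hst
  · exact ⟨0, fun x hx => absurd (hx.1.trans hx.2) (not_le.2 h)⟩
  have hmono : MonotoneOn (deriv G) (Ioo 0 1) :=
    (hG.convexOn.subset Ioo_subset_Icc_self (convex_Ioo 0 1)).monotoneOn_deriv fun x hx =>
      (hG.differentiableOn x hx).differentiableAt (Ioo_mem_nhds hx.1 hx.2)
  refine ⟨max |deriv G s| |deriv G t|, fun x hx => ?_⟩
  have hx' : x ∈ Ioo (0 : ℝ) 1 := ⟨hs.trans_le hx.1, hx.2.trans_lt ht⟩
  rw [derivWithin_of_mem_nhds (Icc_mem_nhds hx'.1 hx'.2)]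
  have h1 := hmono ⟨hs, hst.trans_lt ht⟩ hx' hx.1
  have h2 := hmono hx' ⟨hs.trans_le hst, ht⟩ hx.2
  exact abs_le_max_abs_abs h1 h2

theorem measurable_derivWithin_Icc (G : ℝ → ℝ) : Measurable (derivWithin G (Icc 0 1)) := by
  have h : derivWithin G (Icc 0 1) = fun x => if x ∈ Ioo (0 : ℝ) 1 then deriv G x else
      if x = 0 then derivWithin G (Icc 0 1) 0 else
      if x = 1 then derivWithin G (Icc 0 1) 1 else 0 := by
    funext x
    by_cases hx : x ∈ Ioo (0 : ℝ) 1
    · rw [if_pos hx, derivWithin_of_mem_nhds (Icc_mem_nhds hx.1 hx.2)]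
    rw [if_neg hx]
    by_cases h0 : x = 0
    · rw [if_pos h0, h0]
    rw [if_neg h0]
    by_cases h1 : x = 1
    · rw [if_pos h1, h1]
    rw [if_neg h1]
    refine derivWithin_zero_of_notMem_closure ?_
    rw [closure_Icc]
    exact fun hc => hx ⟨lt_of_le_of_ne hc.1 (Ne.symm h0), lt_of_le_of_ne hc.2 h1⟩
  rw [h]
  refine Measurable.ite measurableSet_Ioo (measurable_deriv G) ?_
  refine Measurable.ite (measurableSet_eq) measurable_const ?_
  exact Measurable.ite (measurableSet_eq) measurable_const measurable_const

/-- The expected divergence of `Y` from its conditional expectation `X` is finite and equals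
`E G(Y) - E G(X)`.  The slope of `G` at `X` need not be bounded; the identity holds on the
events `1 / (n + 2) ≤ X ≤ 1 - 1 / (n + 2)`, and passes to the limit since divergences are
nonnegative.  On the events `X = 0` and `X = 1`, almost surely `Y = X`. -/
theorem integrable_bregman_condExp {G : ℝ → ℝ} (hG : IsBregmanGenerator G) {Y : Ω → ℝ}
    (hY : Integrable Y μ) (h01 : ∀ᵐ ω ∂μ, Y ω ∈ Icc (0 : ℝ) 1)
    (hm : m ≤ mΩ) :
    Integrable (fun ω => bregman G (Y ω) ((μ[Y | m]) ω)) μ ∧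
      ∫ ω, bregman G (Y ω) ((μ[Y | m]) ω) ∂μ = (∫ ω, G (Y ω) ∂μ) - potential G μ Y m := by
  set X := μ[Y | m] with hXdef
  have hXm : StronglyMeasurable[m] X := stronglyMeasurable_condExp
  have hXI : Integrable X μ := integrable_condExp
  have hX01 : ∀ᵐ ω ∂μ, X ω ∈ Icc (0 : ℝ) 1 := ae_condExp_mem_Icc hY h01 hm
  have hXmeas : Measurable X := (hXm.mono hm).measurable
  have hset : ∀ B : Set ℝ, MeasurableSet B → MeasurableSet[m] (X ⁻¹' B) := fun B hB =>
    hXm.measurable hB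
  have hGY : Integrable (fun ω => G (Y ω)) μ :=
    integrable_comp hG.continuousOn hY.aestronglyMeasurable h01
  have hGX : Integrable (fun ω => G (X ω)) μ := integrable_comp_condExp hG.continuousOn hY h01 hm
  -- Where `X` is an end point of `[0, 1]`, so is `Y`.
  have hend0 : ∀ᵐ ω ∂μ, X ω = 0 → Y ω = 0 := by
    have h1 : ∫ ω in X ⁻¹' {0}, Y ω ∂μ = 0 := by
      rw [← setIntegral_condExp hm hY (hset _ (measurableSet_singleton 0))]
      refine setIntegral_eq_zero_of_forall_eq_zero ?_
      intro ω hω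
      exact hω
    rw [setIntegral_eq_zero_iff_of_nonneg_ae
      (ae_restrict_of_ae (h01.mono fun ω hω => hω.1)) hY.integrableOn] at h1
    rw [Filter.EventuallyEq, ae_restrict_iff' (hm _ (hset _ (measurableSet_singleton 0)))] at h1
    exact h1
  have hend1 : ∀ᵐ ω ∂μ, X ω = 1 → Y ω = 1 := by
    have hI : Integrable (fun ω => 1 - Y ω) μ := (integrable_const 1).sub hY
    have h1 : ∫ ω in X ⁻¹' {1}, (1 - Y ω) ∂μ = 0 := by
      rw [integral_sub (integrable_const 1).integrableOn hY.integrableOn,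
        ← setIntegral_condExp hm hY (hset _ (measurableSet_singleton 1)),
        ← integral_sub (integrable_const 1).integrableOn hXI.integrableOn]
      refine setIntegral_eq_zero_of_forall_eq_zero ?_
      intro ω hω
      have h : X ω = 1 := hω
      rw [h, sub_self]
    rw [setIntegral_eq_zero_iff_of_nonneg_ae
      (ae_restrict_of_ae (h01.mono fun ω hω => sub_nonneg.2 hω.2)) hI.integrableOn] at h1
    rw [Filter.EventuallyEq, ae_restrict_iff' (hm _ (hset _ (measurableSet_singleton 1)))] at h1
    filter_upwards [h1] with ω hω h
    have := hω h
    simp only [Pi.zero_apply] at this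
    linarith
  have hends : ∀ᵐ ω ∂μ, X ω ∉ Ioo (0 : ℝ) 1 → Y ω = X ω := by
    filter_upwards [hX01, hend0, hend1] with ω h h0 h1 hn
    rcases eq_or_lt_of_le h.1 with he | hl
    · rw [h0 he.symm, ← he]
    · have : X ω = 1 := le_antisymm h.2 (not_lt.1 fun h' => hn ⟨hl, h'⟩)
      rw [h1 this, this]
  have hnn : ∀ᵐ ω ∂μ, 0 ≤ bregman G (Y ω) (X ω) := by
    filter_upwards [hends, h01] with ω h hy
    by_cases hx : X ω ∈ Ioo (0 : ℝ) 1
    · exact bregman_nonneg hG hx hy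
    · rw [h hx]; simp [bregman]
  let K : ℕ → Set ℝ := fun n => Icc (1 / ((n : ℝ) + 2)) (1 - 1 / ((n : ℝ) + 2)) ∪ (Ioo 0 1)ᶜ
  have hK : ∀ n, MeasurableSet (K n) := fun n => measurableSet_Icc.union measurableSet_Ioo.compl
  have hcover : AECover μ Filter.atTop fun n => X ⁻¹' K n := by
    refine ⟨Filter.Eventually.of_forall fun ω => ?_, fun n => hXmeas (hK n)⟩
    by_cases hx : X ω ∈ Ioo (0 : ℝ) 1
    · have h1 : Filter.Tendsto (fun n : ℕ => 1 / ((n : ℝ) + 2)) Filter.atTop (nhds 0) := by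
        have h := (tendsto_one_div_add_atTop_nhds_zero_nat (𝕜 := ℝ)).comp
          (Filter.tendsto_add_atTop_nat 1)
        refine h.congr fun n => ?_
        simp only [Function.comp_apply]
        push_cast
        ring
      filter_upwards [h1.eventually (gt_mem_nhds hx.1),
        h1.eventually (gt_mem_nhds (sub_pos.2 hx.2))] with n hn1 hn2
      exact Or.inl ⟨hn1.le, by linarith⟩
    · exact Filter.Eventually.of_forall fun n => Or.inr hx
  -- On each of the exhausting events the slope is bounded and the linear term integrates to `0`.
  have hloc : ∀ n, IntegrableOn (fun ω => bregman G (Y ω) (X ω)) (X ⁻¹' K n) μ ∧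
      ∫ ω in X ⁻¹' K n, bregman G (Y ω) (X ω) ∂μ = ∫ ω in X ⁻¹' K n, (G (Y ω) - G (X ω)) ∂μ := by
    intro n
    have hn0 : (0 : ℝ) < 1 / ((n : ℝ) + 2) := by positivity
    obtain ⟨C, hC⟩ := exists_bound_derivWithin hG hn0 (sub_lt_self 1 hn0)
    let J : Set ℝ := Icc (1 / ((n : ℝ) + 2)) (1 - 1 / ((n : ℝ) + 2))
    let g : ℝ → ℝ := J.indicator (derivWithin G (Icc 0 1))
    have hg : Measurable g := (measurable_derivWithin_Icc G).indicator measurableSet_Icc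
    have hgX : StronglyMeasurable[m] fun ω => g (X ω) :=
      (hg.comp hXm.measurable).stronglyMeasurable
    have hgb : ∀ x, |g x| ≤ max C 0 := by
      intro x
      by_cases hx : x ∈ J
      · simp only [g, indicator_of_mem hx]
        exact (hC x hx).trans (le_max_left _ _)
      · simp only [g, indicator_of_notMem hx, abs_zero]
        exact le_max_right _ _
    have hgbd : ∀ Z : Ω → ℝ, Integrable Z μ → Integrable (fun ω => g (X ω) * Z ω) μ :=
      fun Z hZ => hZ.bdd_mul (c := max C 0) (hgX.mono hm).aestronglyMeasurable
        (Filter.Eventually.of_forall fun ω => hgb (X ω))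
    have hlin : ∫ ω, g (X ω) * (Y ω - X ω) ∂μ = 0 := by
      have h1 : ∫ ω, g (X ω) * Y ω ∂μ = ∫ ω, g (X ω) * X ω ∂μ := by
        have h2 : μ[(fun ω => g (X ω)) * Y | m] =ᵐ[μ] (fun ω => g (X ω)) * X :=
          condExp_mul_of_stronglyMeasurable_left hgX (hgbd Y hY) hY
        have h3 := integral_congr_ae h2
        rw [integral_condExp hm] at h3
        exact h3
      simp only [mul_sub]
      rw [integral_sub (hgbd Y hY) (hgbd X hXI), h1, sub_self]
    have hrest : ∫ ω in X ⁻¹' K n, g (X ω) * (Y ω - X ω) ∂μ = 0 := by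
      rw [setIntegral_eq_integral_of_forall_compl_eq_zero, hlin]
      intro ω hω
      have : X ω ∉ J := fun h => hω (Or.inl h)
      simp only [g, indicator_of_notMem this, zero_mul]
    have hcongr : (fun ω => bregman G (Y ω) (X ω)) =ᵐ[μ.restrict (X ⁻¹' K n)]
        fun ω => (G (Y ω) - G (X ω)) - g (X ω) * (Y ω - X ω) := by
      rw [Filter.EventuallyEq, ae_restrict_iff' (hXmeas (hK n))]
      filter_upwards [hends] with ω h hω
      by_cases hx : X ω ∈ J
      · simp only [g, indicator_of_mem hx, bregman]
        ring
      · have hx' : X ω ∉ Ioo (0 : ℝ) 1 := hω.resolve_left hx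
        rw [h hx']
        simp [bregman]
    have hi1 : Integrable (fun ω => G (Y ω) - G (X ω)) μ := hGY.sub hGX
    have hi2 : Integrable (fun ω => g (X ω) * (Y ω - X ω)) μ := hgbd _ (hY.sub hXI)
    refine ⟨(hi1.sub hi2).integrableOn.congr hcongr.symm, ?_⟩
    rw [integral_congr_ae hcongr, integral_sub hi1.integrableOn hi2.integrableOn, hrest, sub_zero]
  have hlim : Filter.Tendsto (fun n => ∫ ω in X ⁻¹' K n, bregman G (Y ω) (X ω) ∂μ) Filter.atTop
      (nhds (∫ ω, (G (Y ω) - G (X ω)) ∂μ)) := by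
    simp only [fun n => (hloc n).2]
    exact hcover.integral_tendsto_of_countably_generated (hGY.sub hGX)
  refine ⟨hcover.integrable_of_integral_tendsto_of_nonneg_ae _ (fun n => (hloc n).1) hnn hlim, ?_⟩
  rw [hcover.integral_eq_of_tendsto_of_nonneg_ae _ hnn (fun n => (hloc n).1) hlim,
    integral_sub hGY hGX]
  rfl

theorem integrable_bregman_condExp_condExp {G : ℝ → ℝ} (hG : IsBregmanGenerator G) {Y : Ω → ℝ}
    (hY : Integrable Y μ) (h01 : ∀ᵐ ω ∂μ, Y ω ∈ Icc (0 : ℝ) 1)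
    (hmm' : m ≤ m') (hm' : m' ≤ mΩ) :
    Integrable (fun ω => bregman G ((μ[Y | m']) ω) ((μ[Y | m]) ω)) μ ∧
      ∫ ω, bregman G ((μ[Y | m']) ω) ((μ[Y | m]) ω) ∂μ
        = potential G μ Y m' - potential G μ Y m := by
  have htower : μ[μ[Y | m'] | m] =ᵐ[μ] μ[Y | m] := condExp_condExp_of_le hmm' hm'
  have h := integrable_bregman_condExp (m := m) hG (integrable_condExp (m := m') (f := Y) (μ := μ))
    (ae_condExp_mem_Icc hY h01 hm') (hmm'.trans hm')
  have hc : (fun ω => bregman G ((μ[Y | m']) ω) ((μ[μ[Y | m'] | m]) ω)) =ᵐ[μ]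
      fun ω => bregman G ((μ[Y | m']) ω) ((μ[Y | m]) ω) := by
    filter_upwards [htower] with ω hω
    rw [hω]
  refine ⟨h.1.congr hc, ?_⟩
  rw [← integral_congr_ae hc, h.2]
  congr 1
  refine integral_congr_ae ?_
  filter_upwards [htower] with ω hω
  rw [hω]

/-- The conditional expectation is, up to the factor `2`, the best approximation in mean. -/
theorem integral_abs_sub_condExp_le {Z X : Ω → ℝ} (hZ : Integrable Z μ) (hX : Integrable X μ)
    (hm : m ≤ mΩ) (hXm : StronglyMeasurable[m] X) :
    ∫ ω, |Z ω - (μ[Z | m]) ω| ∂μ ≤ 2 * ∫ ω, |Z ω - X ω| ∂μ := by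
  have h1 : μ[Z - X | m] =ᵐ[μ] μ[Z | m] - X := by
    have := condExp_sub hZ hX m
    rwa [condExp_of_stronglyMeasurable hm hXm hX] at this
  have h2 : ∫ ω, |(μ[Z - X | m]) ω| ∂μ ≤ ∫ ω, |(Z - X) ω| ∂μ := integral_abs_condExp_le _
  have h3 : ∫ ω, |(μ[Z - X | m]) ω| ∂μ = ∫ ω, |(μ[Z | m]) ω - X ω| ∂μ := by
    refine integral_congr_ae ?_
    filter_upwards [h1] with ω hω
    rw [hω, Pi.sub_apply]
  rw [h3] at h2
  have hI1 : Integrable (fun ω => |Z ω - X ω|) μ := (hZ.sub hX).abs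
  have hI2 : Integrable (fun ω => |(μ[Z | m]) ω - X ω|) μ := (integrable_condExp.sub hX).abs
  calc ∫ ω, |Z ω - (μ[Z | m]) ω| ∂μ
      ≤ ∫ ω, (|Z ω - X ω| + |(μ[Z | m]) ω - X ω|) ∂μ := by
        refine integral_mono (hZ.sub integrable_condExp).abs (hI1.add hI2) fun ω => ?_
        exact (abs_sub_le (Z ω) (X ω) _).trans_eq (by rw [abs_sub_comm (X ω)])
    _ ≤ 2 * ∫ ω, |Z ω - X ω| ∂μ := by
        rw [integral_add hI1 hI2]
        simp only [Pi.sub_apply] at h2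
        linarith

/-- Learning a label `k` that is predicted by a known label `k'` up to a small probability changes
the conditional expectation little: replacing `k` by `k'` in the finer conditional expectation
gives a function of what is known already. -/
theorem integral_abs_condExp_sub_condExp_sup_comap_le {κ : Type*} [mκ : MeasurableSpace κ]
    [DiscreteMeasurableSpace κ] {Y : Ω → ℝ} (hY : Integrable Y μ)
    (h01 : ∀ᵐ ω ∂μ, Y ω ∈ Icc (0 : ℝ) 1) (hm : m ≤ mΩ) {k k' : Ω → κ}
    (hk : Measurable k) (hk' : Measurable[m] k') (hne : MeasurableSet {ω | k ω ≠ k' ω}) :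
    ∫ ω, |(μ[Y | m ⊔ mκ.comap k]) ω - (μ[Y | m]) ω| ∂μ
      ≤ 2 * μ.real {ω | k ω ≠ k' ω} := by
  set m' := m ⊔ mκ.comap k
  have hm' : m' ≤ mΩ := sup_le hm hk.comap_le
  set Z := μ[Y | m'] with hZ
  have hZI : Integrable Z μ := integrable_condExp
  have hZ01 : ∀ᵐ ω ∂μ, Z ω ∈ Icc (0 : ℝ) 1 := ae_condExp_mem_Icc hY h01 hm'
  have htower : μ[Z | m] =ᵐ[μ] μ[Y | m] := condExp_condExp_of_le le_sup_left hm'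
  have hZm : StronglyMeasurable[m'] Z := stronglyMeasurable_condExp
  obtain ⟨g, hg, hgZ⟩ := exists_eq_of_measurable_sup_comap (m := m) hZm.measurable
  let X : Ω → ℝ := fun ω => clamp (g (ω, k' ω))
  have hXm : Measurable[m] X := continuous_clamp.measurable.comp (hg k' hk')
  have hXI : Integrable X μ := integrable_of_ae_mem_Icc
    (hXm.mono hm le_rfl).aestronglyMeasurable (Filter.Eventually.of_forall fun ω => clamp_mem _)
  have hle : ∫ ω, |Z ω - X ω| ∂μ ≤ μ.real {ω | k ω ≠ k' ω} := by
    rw [← integral_indicator_one hne]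
    refine integral_mono_ae (hZI.sub hXI).abs ((integrable_const 1).indicator hne) ?_
    filter_upwards [hZ01] with ω hω
    by_cases h : k ω = k' ω
    · have : X ω = Z ω := by
        simp only [X]
        rw [← h]
        rw [← hgZ, clamp_of_mem hω]
      simp [this, h]
    · rw [indicator_of_mem (by exact h)]
      have := clamp_mem (g (ω, k' ω))
      simp only [Pi.one_apply, abs_le]
      exact ⟨by linarith [hω.1, this.2], by linarith [hω.2, this.1]⟩
  have h := integral_abs_sub_condExp_le hZI hXI hm hXm.stronglyMeasurable
  have h2 : ∫ ω, |Z ω - (μ[Z | m]) ω| ∂μ = ∫ ω, |Z ω - (μ[Y | m]) ω| ∂μ := by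
    refine integral_congr_ae ?_
    filter_upwards [htower] with ω hω
    rw [hω]
  rw [h2] at h
  linarith

theorem exists_abs_sub_le_add_mul {G : ℝ → ℝ} (hG : ContinuousOn G (Icc 0 1)) {e : ℝ} (he : 0 < e) :
    ∃ C, 0 ≤ C ∧ ∀ x ∈ Icc (0 : ℝ) 1, ∀ y ∈ Icc (0 : ℝ) 1, |G x - G y| ≤ e + C * |x - y| := by
  obtain ⟨B, hB⟩ := isCompact_Icc.exists_bound_of_continuousOn hG
  have huc := isCompact_Icc.uniformContinuousOn_of_continuous hG
  rw [Metric.uniformContinuousOn_iff] at huc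
  obtain ⟨t, ht, h⟩ := huc e he
  have hB0 : 0 ≤ B := (norm_nonneg _).trans (hB 0 ⟨le_rfl, zero_le_one⟩)
  refine ⟨2 * B / t, by positivity, fun x hx y hy => ?_⟩
  rcases lt_or_ge (|x - y|) t with hlt | hge
  · have h1 := h x hx y hy hlt
    rw [Real.dist_eq] at h1
    have : 0 ≤ 2 * B / t * |x - y| := by positivity
    linarith
  · have h1 := hB x hx
    have h2 := hB y hy
    rw [Real.norm_eq_abs] at h1 h2
    have h3 : |G x - G y| ≤ 2 * B := by
      have h5 := abs_le.1 h1
      have h6 := abs_le.1 h2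
      exact abs_le.2 ⟨by linarith, by linarith⟩
    have h4 : 2 * B ≤ 2 * B / t * |x - y| := by
      rw [div_mul_eq_mul_div, le_div_iff₀ ht]
      gcongr
    linarith

theorem abs_potential_sub_le {G : ℝ → ℝ} (hG : ContinuousOn G (Icc 0 1)) {e C : ℝ}
    (hC : ∀ x ∈ Icc (0 : ℝ) 1, ∀ y ∈ Icc (0 : ℝ) 1, |G x - G y| ≤ e + C * |x - y|)
    {Y : Ω → ℝ} (hY : Integrable Y μ) (h01 : ∀ᵐ ω ∂μ, Y ω ∈ Icc (0 : ℝ) 1)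
    (hm : m ≤ mΩ) (hm' : m' ≤ mΩ) :
    |potential G μ Y m - potential G μ Y m'|
      ≤ e + C * ∫ ω, |(μ[Y | m]) ω - (μ[Y | m']) ω| ∂μ := by
  have hI1 := integrable_comp_condExp hG hY h01 hm
  have hI2 := integrable_comp_condExp hG hY h01 hm'
  have hI3 : Integrable (fun ω => |(μ[Y | m]) ω - (μ[Y | m']) ω|) μ :=
    (integrable_condExp.sub integrable_condExp).abs
  unfold potential
  rw [← integral_sub hI1 hI2]
  refine abs_integral_le_integral_abs.trans ?_
  calc ∫ ω, |G ((μ[Y | m]) ω) - G ((μ[Y | m']) ω)| ∂μ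
      ≤ ∫ ω, (e + C * |(μ[Y | m]) ω - (μ[Y | m']) ω|) ∂μ := by
        refine integral_mono_ae (hI1.sub hI2).abs ((integrable_const e).add (hI3.const_mul C)) ?_
        filter_upwards [ae_condExp_mem_Icc hY h01 hm, ae_condExp_mem_Icc hY h01 hm'] with ω a b
        exact hC _ a _ b
    _ = e + C * ∫ ω, |(μ[Y | m]) ω - (μ[Y | m']) ω| ∂μ := by
        rw [integral_add (integrable_const e) (hI3.const_mul C), integral_const_mul]
        simp

/-- Conditioning the measure on an event of `m` does not change conditional expectations given
`m`. -/
theorem condExp_cond_ae_eq {Y : Ω → ℝ} (hY : Integrable Y μ) (hm : m ≤ mΩ)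
    {s : Set Ω} (hs : MeasurableSet[m] s) (hs0 : μ s ≠ 0) :
    (μ[|s])[Y | m] =ᵐ[μ[|s]] μ[Y | m] := by
  have : IsProbabilityMeasure (μ[|s]) := cond_isProbabilityMeasure hs0
  have hint : ∀ f : Ω → ℝ, Integrable f μ → Integrable f (μ[|s]) := fun f hf =>
    (hf.restrict).smul_measure (ENNReal.inv_ne_top.2 hs0)
  symm
  refine ae_eq_condExp_of_forall_setIntegral_eq hm (hint Y hY)
    (fun t _ _ => (hint _ integrable_condExp).integrableOn) ?_
    stronglyMeasurable_condExp.aestronglyMeasurable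
  intro t ht _
  have key : ∀ f : Ω → ℝ, ∫ ω in t, f ω ∂(μ[|s]) = (μ s)⁻¹.toReal * ∫ ω in t ∩ s, f ω ∂μ := by
    intro f
    rw [ProbabilityTheory.cond, Measure.restrict_smul, integral_smul_measure,
      Measure.restrict_restrict (hm _ ht), smul_eq_mul]
  rw [key, key, setIntegral_condExp hm hY (ht.inter hs)]

end Potential

/-! ### Approximation by finitely many events -/

open scoped symmDiff

section Approximation

variable {Ω : Type u} {m F mΩ : MeasurableSpace Ω} {μ : Measure Ω}

/-- The `σ`-algebra generated by a label whose set of values carries no structure. -/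
abbrev labelAlgebra {ι : Type*} (H : Ω → ι) : MeasurableSpace Ω := MeasurableSpace.comap H ⊤

theorem labelAlgebra_le_iff {ι : Type*} [Countable ι] {H : Ω → ι} :
    labelAlgebra H ≤ m ↔ ∀ i, MeasurableSet[m] (H ⁻¹' {i}) := by
  constructor
  · intro h i
    exact h _ ⟨{i}, trivial, rfl⟩
  · rintro h _ ⟨s, -, rfl⟩
    rw [← biUnion_preimage_singleton]
    exact MeasurableSet.biUnion (to_countable s) fun i _ => h i

theorem measurableSet_mem_eq {E : Set Ω} (hE : MeasurableSet[m] E) (p : Prop) :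
    MeasurableSet[m] {ω | (ω ∈ E) = p} := by
  by_cases hp : p
  · have : {ω | (ω ∈ E) = p} = E := by ext ω; simp [hp]
    rwa [this]
  · have : {ω | (ω ∈ E) = p} = Eᶜ := by ext ω; simp [hp]
    rw [this]
    exact hE.compl

theorem measurableSet_labelAlgebra_of_saturated {ι : Type*} {H : Ω → ι} {E : Set Ω}
    (hE : ∀ x y, H x = H y → (x ∈ E ↔ y ∈ E)) : MeasurableSet[labelAlgebra H] E := by
  refine ⟨H '' E, trivial, ?_⟩
  ext x
  constructor
  · rintro ⟨y, hy, hyx⟩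
    exact (hE y x hyx).1 hy
  · exact fun hx => ⟨x, hx, rfl⟩

theorem exists_mem_iff_of_measurableSet_sup_labelAlgebra {ι : Type*} {H : Ω → ι} {E : Set Ω}
    (hE : MeasurableSet[m ⊔ labelAlgebra H] E) :
    ∃ A : ι → Set Ω, (∀ i, MeasurableSet[m] (A i)) ∧ ∀ ω, ω ∈ E ↔ ω ∈ A (H ω) := by
  let mι : MeasurableSpace ι := ⊤
  have hZ : Measurable[m ⊔ mι.comap H] (E.indicator fun _ => (1 : ℝ)) :=
    Measurable.indicator measurable_const hE
  obtain ⟨g, hg, hgE⟩ := exists_eq_of_measurable_sup_comap (m := m) hZ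
  refine ⟨fun i => {ω | g (ω, i) = 1}, fun i => hg (fun _ => i) measurable_const
    (measurableSet_singleton 1), fun ω => ?_⟩
  rw [mem_ofPred_eq, ← hgE]
  by_cases h : ω ∈ E <;> simp [h]

/-- The events that are measurable with respect to `m` and finitely many events of `F` form an
algebra that generates `m ⊔ F`. -/
theorem exists_finset_measure_symmDiff_lt_aux [m0 : MeasurableSpace Ω] (ν : Measure Ω)
    [IsFiniteMeasure ν] (h : m0 = m ⊔ F) {E : Set Ω} (hE : MeasurableSet E) {η : ℝ} (hη : 0 < η) :
    ∃ E' ∈ {E | ∃ t : Finset (Set Ω), (∀ D ∈ t, MeasurableSet[F] D) ∧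
      MeasurableSet[m ⊔ MeasurableSpace.generateFrom t] E}, ν (E ∆ E') < ENNReal.ofReal η := by
  classical
  refine Measure.MeasureDense.approx (μ := ν) ?_ E hE (measure_ne_top _ _) η hη
  refine Measure.MeasureDense.of_generateFrom_isSetAlgebra_finite ν ⟨?_, ?_, ?_⟩ ?_
  · exact ⟨∅, by simp, @MeasurableSet.empty _ (_)⟩
  · rintro s ⟨t, ht, hs⟩
    exact ⟨t, ht, hs.compl⟩
  · rintro s s' ⟨t, ht, hs⟩ ⟨t', ht', hs'⟩
    refine ⟨t ∪ t', fun D hD => (Finset.mem_union.1 hD).elim (ht D) (ht' D), ?_⟩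
    refine MeasurableSet.union ?_ ?_
    · exact (sup_le_sup_left (MeasurableSpace.generateFrom_mono (by simp)) m) _ hs
    · exact (sup_le_sup_left (MeasurableSpace.generateFrom_mono (by simp)) m) _ hs'
  · apply le_antisymm
    · rw [h]
      refine sup_le ?_ ?_
      · intro s hs
        refine MeasurableSpace.measurableSet_generateFrom ⟨∅, by simp, ?_⟩
        exact (le_sup_left : m ≤ _) s hs
      · intro s hs
        refine MeasurableSpace.measurableSet_generateFrom ⟨{s}, by simpa using hs, ?_⟩
        exact (le_sup_right : _ ≤ m ⊔
          MeasurableSpace.generateFrom (({s} : Finset (Set Ω)) : Set (Set Ω))) s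
          (MeasurableSpace.measurableSet_generateFrom (by simp))
    · refine MeasurableSpace.generateFrom_le ?_
      rintro s ⟨t, ht, hs⟩
      rw [h]
      exact (sup_le_sup_left (MeasurableSpace.generateFrom_le ht) m) s hs

variable [IsProbabilityMeasure μ]

theorem exists_finset_measure_symmDiff_le (hm : m ≤ mΩ) (hF : F ≤ mΩ) {E : Set Ω}
    (hE : MeasurableSet[m ⊔ F] E) {η : ℝ} (hη : 0 < η) :
    ∃ t : Finset (Set Ω), (∀ D ∈ t, MeasurableSet[F] D) ∧ ∃ E',
      MeasurableSet[m ⊔ MeasurableSpace.generateFrom t] E' ∧ μ.real (E ∆ E') ≤ η := by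
  have hle : m ⊔ F ≤ mΩ := sup_le hm hF
  obtain ⟨E', ⟨t, ht, hE't⟩, hlt⟩ :=
    exists_finset_measure_symmDiff_lt_aux (m0 := m ⊔ F) (μ.trim hle) rfl hE hη
  refine ⟨t, ht, E', hE't, ?_⟩
  have hE' : MeasurableSet[m ⊔ F] E' :=
    (sup_le_sup_left (MeasurableSpace.generateFrom_le ht) m) _ hE't
  rw [trim_measurableSet_eq hle (@MeasurableSet.symmDiff _ (m ⊔ F) _ _ hE hE')] at hlt
  exact ENNReal.toReal_le_of_le_ofReal hη.le hlt.le

theorem exists_finset_integral_abs_sub_le (hm : m ≤ mΩ) (hF : F ≤ mΩ) {Z : Ω → ℝ}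
    (hZ : StronglyMeasurable[m ⊔ F] Z) (hZI : Integrable Z μ) {η : ℝ} (hη : 0 < η) :
    ∃ t : Finset (Set Ω), (∀ D ∈ t, MeasurableSet[F] D) ∧ ∃ X : Ω → ℝ,
      StronglyMeasurable[m ⊔ MeasurableSpace.generateFrom t] X ∧ Integrable X μ ∧
      ∫ ω, |Z ω - X ω| ∂μ ≤ η := by
  classical
  have hle : m ⊔ F ≤ mΩ := sup_le hm hF
  have hmono : ∀ t t' : Finset (Set Ω), t ⊆ t' → m ⊔ MeasurableSpace.generateFrom (t : Set (Set Ω))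
      ≤ m ⊔ MeasurableSpace.generateFrom (t' : Set (Set Ω)) := fun t t' h =>
    sup_le_sup_left (MeasurableSpace.generateFrom_mono (by exact_mod_cast h)) m
  let P : (Ω → ℝ) → Prop := fun f => ∃ t : Finset (Set Ω), (∀ D ∈ t, MeasurableSet[F] D) ∧
    StronglyMeasurable[m ⊔ MeasurableSpace.generateFrom t] f
  have hPm : ∀ f, P f → StronglyMeasurable[m ⊔ F] f := by
    rintro f ⟨t, ht, hf⟩
    exact hf.mono (sup_le_sup_left (MeasurableSpace.generateFrom_le ht) m)
  have hdense := @MemLp.induction_dense Ω ℝ (m ⊔ F) _ 1 (μ.trim hle) ENNReal.one_ne_top P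
    (by
      intro c s hs _ e he
      rcases eq_or_ne e ⊤ with rfl | hetop
      · exact ⟨0, le_top, ∅, by simp, stronglyMeasurable_zero⟩
      have hc : 0 < ‖c‖ + 1 := by positivity
      have hepos : 0 < e.toReal / (‖c‖ + 1) := div_pos (ENNReal.toReal_pos he hetop) hc
      obtain ⟨t, ht, E', hE', hlt⟩ :=
        exists_finset_measure_symmDiff_le (μ := μ) hm hF hs hepos
      have hE'm : MeasurableSet[m ⊔ F] E' :=
        (sup_le_sup_left (MeasurableSpace.generateFrom_le ht) m) _ hE'
      refine ⟨E'.indicator fun _ => c, ?_, t, ht, stronglyMeasurable_const.indicator hE'⟩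
      rw [eLpNorm_indicator_sub_indicator]
      refine (eLpNorm_indicator_const_le c 1).trans ?_
      rw [ENNReal.toReal_one, div_one, ENNReal.rpow_one,
        trim_measurableSet_eq hle (@MeasurableSet.symmDiff _ (m ⊔ F) _ _ hE'm hs), symmDiff_comm,
        ← ofReal_norm, ← ofReal_measureReal, ← ENNReal.ofReal_mul (norm_nonneg c)]
      refine ENNReal.ofReal_le_of_le_toReal ?_
      calc ‖c‖ * μ.real (s ∆ E') ≤ (‖c‖ + 1) * (e.toReal / (‖c‖ + 1)) := by
            gcongr
            linarith
        _ = e.toReal := mul_div_cancel₀ _ hc.ne')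
    (by
      rintro f g ⟨t, ht, hf⟩ ⟨t', ht', hg⟩
      refine ⟨t ∪ t', fun D hD => (Finset.mem_union.1 hD).elim (ht D) (ht' D), ?_⟩
      exact (hf.mono (hmono _ _ Finset.subset_union_left)).add
        (hg.mono (hmono _ _ Finset.subset_union_right)))
    (fun f hf => (hPm f hf).aestronglyMeasurable) Z
    (memLp_one_iff_integrable.2 (hZI.trim hle hZ)) (ENNReal.ofReal η)
    (by simpa using hη)
  obtain ⟨X, hX, hP⟩ := hdense
  have hXm := hPm X hP
  obtain ⟨t, ht, hXt⟩ := hP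
  rw [eLpNorm_trim hle (hZ.sub hXm), eLpNorm_one_eq_lintegral_enorm] at hX
  have hdiff : Integrable (Z - X) μ :=
    ⟨((hZ.sub hXm).mono hle).aestronglyMeasurable, hX.trans_lt ENNReal.ofReal_lt_top⟩
  have hXI : Integrable X μ := by
    have := hZI.sub hdiff
    rwa [sub_sub_cancel] at this
  refine ⟨t, ht, X, hXt, hXI, ?_⟩
  rw [← ofReal_integral_norm_eq_lintegral_enorm hdiff] at hX
  exact (ENNReal.ofReal_le_ofReal_iff hη.le).1 hX

/-- A conditional expectation given `m ⊔ F` is approximated in mean by the conditional expectations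
given `m` and any sufficiently fine finite label that is measurable with respect to `F`. -/
theorem exists_finset_condExp_approx (hm : m ≤ mΩ) (hF : F ≤ mΩ) {Y : Ω → ℝ} {η : ℝ} (hη : 0 < η) :
    ∃ t : Finset (Set Ω), (∀ D ∈ t, MeasurableSet[F] D) ∧
      ∀ {ι : Type u} (H : Ω → ι), labelAlgebra H ≤ F →
        (∀ D ∈ t, ∀ x y, H x = H y → (x ∈ D ↔ y ∈ D)) →
        ∫ ω, |(μ[Y | m ⊔ F]) ω - (μ[Y | m ⊔ labelAlgebra H]) ω| ∂μ ≤ η := by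
  have hle : m ⊔ F ≤ mΩ := sup_le hm hF
  obtain ⟨t, ht, X, hX, hXI, hle'⟩ := exists_finset_integral_abs_sub_le hm hF (μ := μ)
    (Z := μ[Y | m ⊔ F]) stronglyMeasurable_condExp integrable_condExp (half_pos hη)
  refine ⟨t, ht, fun H hH hsat => ?_⟩
  have hgen : MeasurableSpace.generateFrom (t : Set (Set Ω)) ≤ labelAlgebra H :=
    MeasurableSpace.generateFrom_le fun D hD => measurableSet_labelAlgebra_of_saturated (hsat D hD)
  have h1 := integral_abs_sub_condExp_le (integrable_condExp (f := Y) (m := m ⊔ F)) hXI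
    (sup_le hm (hH.trans hF)) (hX.mono (sup_le_sup_left hgen m))
  have htower : μ[μ[Y | m ⊔ F] | m ⊔ labelAlgebra H] =ᵐ[μ] μ[Y | m ⊔ labelAlgebra H] :=
    condExp_condExp_of_le (sup_le_sup_left hH m) hle
  have h2 : ∫ ω, |(μ[Y | m ⊔ F]) ω - (μ[μ[Y | m ⊔ F] | m ⊔ labelAlgebra H]) ω| ∂μ
      = ∫ ω, |(μ[Y | m ⊔ F]) ω - (μ[Y | m ⊔ labelAlgebra H]) ω| ∂μ := by
    refine integral_congr_ae ?_
    filter_upwards [htower] with ω hω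
    rw [hω]
  rw [h2] at h1
  linarith

/-- Two labels that agree up to a small probability give nearly the same conditional
expectations. -/
theorem integral_abs_condExp_sub_condExp_label_le {ι : Type*} [Countable ι] {H R : Ω → ι}
    (hm : m ≤ mΩ)
    (hH : labelAlgebra H ≤ mΩ) (hR : labelAlgebra R ≤ mΩ) {Y : Ω → ℝ} (hY : Integrable Y μ)
    (h01 : ∀ᵐ ω ∂μ, Y ω ∈ Icc (0 : ℝ) 1) :
    ∫ ω, |(μ[Y | m ⊔ labelAlgebra H]) ω - (μ[Y | m ⊔ labelAlgebra R]) ω| ∂μ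
      ≤ 4 * μ.real {ω | H ω ≠ R ω} := by
  let mι : MeasurableSpace ι := ⊤
  have hHm : Measurable[labelAlgebra H] H := comap_measurable H
  have hRm : Measurable[labelAlgebra R] R := comap_measurable R
  have hne : MeasurableSet {ω | H ω ≠ R ω} :=
    (measurableSet_eq_fun (hHm.mono hH le_rfl) (hRm.mono hR le_rfl)).compl
  have h1 := integral_abs_condExp_sub_condExp_sup_comap_le hY h01 (m := m ⊔ labelAlgebra R)
    (sup_le hm hR) (hHm.mono hH le_rfl) (hRm.mono le_sup_right le_rfl) hne
  have h2 := integral_abs_condExp_sub_condExp_sup_comap_le hY h01 (m := m ⊔ labelAlgebra H)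
    (sup_le hm hH) (hRm.mono hR le_rfl) (hHm.mono le_sup_right le_rfl)
    (by simpa only [ne_comm] using hne)
  have e : (m ⊔ labelAlgebra R) ⊔ mι.comap H = (m ⊔ labelAlgebra H) ⊔ mι.comap R :=
    sup_right_comm _ _ _
  rw [e] at h1
  have e2 : {ω | R ω ≠ H ω} = {ω | H ω ≠ R ω} := by
    ext ω; exact ne_comm
  rw [e2] at h2
  set Z := μ[Y | (m ⊔ labelAlgebra H) ⊔ mι.comap R]
  have hI1 : Integrable (fun ω => |Z ω - (μ[Y | m ⊔ labelAlgebra R]) ω|) μ :=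
    (integrable_condExp.sub integrable_condExp).abs
  have hI2 : Integrable (fun ω => |Z ω - (μ[Y | m ⊔ labelAlgebra H]) ω|) μ :=
    (integrable_condExp.sub integrable_condExp).abs
  calc ∫ ω, |(μ[Y | m ⊔ labelAlgebra H]) ω - (μ[Y | m ⊔ labelAlgebra R]) ω| ∂μ
      ≤ ∫ ω, (|Z ω - (μ[Y | m ⊔ labelAlgebra H]) ω|
          + |Z ω - (μ[Y | m ⊔ labelAlgebra R]) ω|) ∂μ := by
        refine integral_mono (integrable_condExp.sub integrable_condExp).abs (hI2.add hI1)
          fun ω => ?_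
        exact (abs_sub_le _ (Z ω) _).trans_eq (by rw [abs_sub_comm _ (Z ω)])
    _ ≤ 4 * μ.real {ω | H ω ≠ R ω} := by
        rw [integral_add hI2 hI1]
        linarith

end Approximation

/-! ### Rectangle partitions -/

section Rectangles

variable {Ω : Type u} {F F' mA mB mΩ : MeasurableSpace Ω} {μ : Measure Ω}

/-- All fibres of the label `R` are rectangles, that is, intersections of an event of `mA` with an
event of `mB`. -/
def IsRectangular (mA mB : MeasurableSpace Ω) {ι : Type*} (R : Ω → ι) : Prop :=
  ∀ i, ∃ s t, MeasurableSet[mA] s ∧ MeasurableSet[mB] t ∧ R ⁻¹' {i} = s ∩ t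

/-- The `σ`-algebra `F` is approximated by finite rectangle partitions: every finite family of
events of `F` is resolved by a finite label `H` that is measurable with respect to `F` and agrees
up to a small probability with a label whose fibres are rectangles.  It matters that `H` may be
finer than prescribed, since a finite partition in a transcript algebra is in general not close to a
rectangle partition, only some refinement of it is. -/
def RectangleApproximable (mA mB : MeasurableSpace Ω) {mΩ : MeasurableSpace Ω} (μ : Measure Ω)
    (F : MeasurableSpace Ω) : Prop :=
  ∀ 𝒮 : Finset (Set Ω), (∀ E ∈ 𝒮, MeasurableSet[F] E) → ∀ η : ℝ, 0 < η →
    ∃ (ι : Type u) (_ : Finite ι) (H R : Ω → ι), labelAlgebra H ≤ F ∧ IsRectangular mA mB R ∧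
      (∀ E ∈ 𝒮, ∀ x y, H x = H y → (x ∈ E ↔ y ∈ E)) ∧ μ.real {ω | H ω ≠ R ω} ≤ η

theorem IsRectangular.symm {ι : Type*} {R : Ω → ι} (h : IsRectangular mA mB R) :
    IsRectangular mB mA R := by
  intro i
  obtain ⟨s, t, hs, ht, e⟩ := h i
  exact ⟨t, s, ht, hs, by rw [e, inter_comm]⟩

theorem RectangleApproximable.symm (h : RectangleApproximable mA mB μ F) :
    RectangleApproximable mB mA μ F := by
  intro 𝒮 h𝒮 η hη
  obtain ⟨ι, hι, H, R, h1, h2, h3, h4⟩ := h 𝒮 h𝒮 η hη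
  exact ⟨ι, hι, H, R, h1, h2.symm, h3, h4⟩

theorem IsRectangular.labelAlgebra_le {ι : Type*} [Countable ι] {R : Ω → ι}
    (h : IsRectangular mA mB R) : labelAlgebra R ≤ mA ⊔ mB := by
  rw [labelAlgebra_le_iff]
  intro i
  obtain ⟨s, t, hs, ht, e⟩ := h i
  rw [e]
  exact MeasurableSet.inter ((le_sup_left : mA ≤ mA ⊔ mB) _ hs) ((le_sup_right : mB ≤ mA ⊔ mB) _ ht)

theorem rectangleApproximable_bot : RectangleApproximable mA mB μ ⊥ := by
  intro 𝒮 h𝒮 η hη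
  refine ⟨PUnit, inferInstance, fun _ => PUnit.unit, fun _ => PUnit.unit, ?_, ?_, ?_, ?_⟩
  · rw [labelAlgebra, MeasurableSpace.comap_const]
  · intro i
    exact ⟨univ, univ, MeasurableSet.univ, MeasurableSet.univ, by ext; simp⟩
  · intro E hE x y _
    rcases MeasurableSpace.measurableSet_bot_iff.1 (h𝒮 E hE) with rfl | rfl <;> simp
  · simpa using hη.le

/-- Learning more events of one party keeps a `σ`-algebra approximable by rectangle partitions: an
event of `mA ⊔ F` is, up to a small probability, cut out of each cell of a finite label of `F` by an
event of `mA`, and cutting rectangles by events of `mA` gives rectangles. -/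
theorem RectangleApproximable.of_le_sup_left [IsProbabilityMeasure μ] (hA : mA ≤ mΩ) (hFΩ : F ≤ mΩ)
    (hF : RectangleApproximable mA mB μ F) (hFF' : F ≤ F') (hF' : F' ≤ mA ⊔ F) :
    RectangleApproximable mA mB μ F' := by
  classical
  intro 𝒮 h𝒮 η hη
  have hη' : 0 < η / (2 * ((𝒮.card : ℝ) + 1)) := by positivity
  have happ : ∀ E : 𝒮, ∃ t : Finset (Set Ω), (∀ D ∈ t, MeasurableSet[F] D) ∧ ∃ E',
      MeasurableSet[mA ⊔ MeasurableSpace.generateFrom t] E' ∧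
        μ.real (E.1 ∆ E') ≤ η / (2 * ((𝒮.card : ℝ) + 1)) := fun E =>
    exists_finset_measure_symmDiff_le hA hFΩ (hF' _ (h𝒮 E.1 E.2)) hη'
  choose t ht E' hE' hμE' using happ
  obtain ⟨ι, hι, H, R, h1, h2, h3, h4⟩ := hF (Finset.univ.biUnion t)
    (fun D hD => by
      obtain ⟨E, -, hDE⟩ := Finset.mem_biUnion.1 hD
      exact ht E D hDE) (η / 2) (half_pos hη)
  have hA' : ∀ E : 𝒮, ∃ A : ι → Set Ω, (∀ i, MeasurableSet[mA] (A i)) ∧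
      ∀ ω, ω ∈ E' E ↔ ω ∈ A (H ω) := by
    intro E
    refine exists_mem_iff_of_measurableSet_sup_labelAlgebra (H := H) ?_
    refine (sup_le_sup_left (MeasurableSpace.generateFrom_le fun D hD => ?_) mA) _ (hE' E)
    exact measurableSet_labelAlgebra_of_saturated
      (h3 D (Finset.mem_biUnion.2 ⟨E, Finset.mem_univ _, hD⟩))
  choose A hAm hAE' using hA'
  refine ⟨ι × (𝒮 → Prop), inferInstance, fun ω => (H ω, fun E => ω ∈ E.1),
    fun ω => (R ω, fun E => ω ∈ A E (R ω)), ?_, ?_, ?_, ?_⟩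
  · rw [labelAlgebra_le_iff]
    rintro ⟨i, v⟩
    have e : (fun ω => ((H ω, fun E : 𝒮 => ω ∈ E.1) : ι × (𝒮 → Prop))) ⁻¹' {(i, v)}
        = H ⁻¹' {i} ∩ ⋂ E : 𝒮, {ω | (ω ∈ E.1) = v E} := by
      ext ω
      simp [Prod.ext_iff, funext_iff]
    rw [e]
    refine MeasurableSet.inter (hFF' _ (labelAlgebra_le_iff.1 h1 i))
      (MeasurableSet.iInter fun E => measurableSet_mem_eq (h𝒮 E.1 E.2) _)
  · rintro ⟨i, v⟩
    obtain ⟨s, t, hs, ht, hst⟩ := h2 i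
    refine ⟨s ∩ ⋂ E : 𝒮, {ω | (ω ∈ A E i) = v E}, t, hs.inter (MeasurableSet.iInter fun E =>
      measurableSet_mem_eq (hAm E i) _), ht, ?_⟩
    rw [inter_right_comm, ← hst]
    ext ω
    simp only [mem_preimage, mem_singleton_iff, Prod.ext_iff, funext_iff, mem_inter_iff,
      mem_iInter, mem_ofPred_eq]
    constructor
    · rintro ⟨rfl, h⟩; exact ⟨rfl, h⟩
    · rintro ⟨rfl, h⟩; exact ⟨rfl, h⟩
  · intro E hE x y hxy
    have := congrFun (congrArg Prod.snd hxy) ⟨E, hE⟩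
    exact iff_of_eq this
  · have hsub : {ω | ((H ω, fun E : 𝒮 => ω ∈ E.1) : ι × (𝒮 → Prop)) ≠
        (R ω, fun E => ω ∈ A E (R ω))} ⊆ {ω | H ω ≠ R ω} ∪ ⋃ E : 𝒮, E.1 ∆ E' E := by
      intro ω hω
      by_contra hn
      rw [mem_union, not_or, mem_iUnion, not_exists] at hn
      have hHR : H ω = R ω := not_not.1 hn.1
      refine hω (Prod.ext hHR (funext fun E => propext ?_))
      have h5 : ω ∈ E.1 ↔ ω ∈ E' E := by
        have := hn.2 E
        rw [mem_symmDiff] at this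
        tauto
      change ω ∈ E.1 ↔ ω ∈ A E (R ω)
      rw [h5, hAE' E, hHR]
    refine (measureReal_mono hsub).trans ((measureReal_union_le _ _).trans ?_)
    have h5 : μ.real (⋃ E : 𝒮, E.1 ∆ E' E) ≤ η / 2 := by
      refine (measureReal_iUnion_fintype_le _).trans
        ((Finset.sum_le_card_nsmul _ _ _ fun E _ => hμE' E).trans ?_)
      rw [Finset.card_univ, Fintype.card_coe, nsmul_eq_mul]
      have hc : (0 : ℝ) ≤ 𝒮.card := Nat.cast_nonneg _
      rw [← mul_div_assoc, div_le_div_iff₀ (by positivity) (by norm_num)]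
      nlinarith
    linarith

theorem RectangleApproximable.of_le_sup_right [IsProbabilityMeasure μ] (hB : mB ≤ mΩ) (hFΩ : F ≤ mΩ)
    (hF : RectangleApproximable mA mB μ F) (hFF' : F ≤ F') (hF' : F' ≤ mB ⊔ F) :
    RectangleApproximable mA mB μ F' :=
  (hF.symm.of_le_sup_left hB hFΩ hFF' hF').symm

/-- A `σ`-algebra that coincides with approximable ones on events of probability close to one is
approximable. -/
theorem RectangleApproximable.of_forall_trace [IsProbabilityMeasure μ]
    (h : ∀ η : ℝ, 0 < η → ∃ (F : MeasurableSpace Ω) (W : Set Ω), RectangleApproximable mA mB μ F ∧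
      MeasurableSet[F'] W ∧ μ.real Wᶜ ≤ η ∧ (∀ s, MeasurableSet[F] s → MeasurableSet[F'] (s ∩ W)) ∧
      ∀ s, MeasurableSet[F'] s → MeasurableSet[F] (s ∩ W)) :
    RectangleApproximable mA mB μ F' := by
  classical
  intro 𝒮 h𝒮 η hη
  obtain ⟨F, W, hF, hW, hμW, hto, hfrom⟩ := h (η / 2) (half_pos hη)
  obtain ⟨ι, hι, H, R, h1, h2, h3, h4⟩ := hF (𝒮.image fun E => E ∩ W)
    (fun D hD => by
      obtain ⟨E, hE, rfl⟩ := Finset.mem_image.1 hD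
      exact hfrom E (h𝒮 E hE)) (η / 2) (half_pos hη)
  refine ⟨ι ⊕ (𝒮 → Prop), inferInstance,
    fun ω => if ω ∈ W then Sum.inl (H ω) else Sum.inr fun E => ω ∈ E.1,
    fun ω => Sum.inl (R ω), ?_, ?_, ?_, ?_⟩
  · rw [labelAlgebra_le_iff]
    rintro (i | v)
    · have e : (fun ω => if ω ∈ W then (Sum.inl (H ω) : ι ⊕ (𝒮 → Prop)) else
          Sum.inr fun E => ω ∈ E.1) ⁻¹' {Sum.inl i} = H ⁻¹' {i} ∩ W := by
        ext ω
        by_cases hω : ω ∈ W <;> simp [hω]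
      rw [e]
      exact hto _ (labelAlgebra_le_iff.1 h1 i)
    · have e : (fun ω => if ω ∈ W then (Sum.inl (H ω) : ι ⊕ (𝒮 → Prop)) else
          Sum.inr fun E => ω ∈ E.1) ⁻¹' {Sum.inr v} = Wᶜ ∩ ⋂ E : 𝒮, {ω | (ω ∈ E.1) = v E} := by
        ext ω
        by_cases hω : ω ∈ W <;> simp [hω, funext_iff]
      rw [e]
      refine MeasurableSet.inter hW.compl
        (MeasurableSet.iInter fun E => measurableSet_mem_eq (h𝒮 E.1 E.2) _)
  · rintro (i | v)
    · obtain ⟨s, t, hs, ht, hst⟩ := h2 i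
      refine ⟨s, t, hs, ht, ?_⟩
      rw [← hst]
      ext ω
      simp
    · exact ⟨∅, ∅, @MeasurableSet.empty _ mA, @MeasurableSet.empty _ mB, by ext ω; simp⟩
  · intro E hE x y hxy
    by_cases hx : x ∈ W <;> by_cases hy : y ∈ W
    · simp only [hx, hy, if_true, Sum.inl.injEq] at hxy
      have := h3 (E ∩ W) (Finset.mem_image_of_mem _ hE) x y hxy
      simpa [hx, hy] using this
    · simp [hx, hy] at hxy
    · simp [hx, hy] at hxy
    · simp only [hx, hy, if_false, Sum.inr.injEq] at hxy
      exact iff_of_eq (congrFun hxy ⟨E, hE⟩)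
  · have hsub : {ω | (if ω ∈ W then (Sum.inl (H ω) : ι ⊕ (𝒮 → Prop)) else
        Sum.inr fun E => ω ∈ E.1) ≠ Sum.inl (R ω)} ⊆ {ω | H ω ≠ R ω} ∪ Wᶜ := by
      intro ω hω
      by_cases hωW : ω ∈ W
      · refine Or.inl fun hHR => hω ?_
        simp [hωW, hHR]
      · exact Or.inr hωW
    refine (measureReal_mono hsub).trans ((measureReal_union_le _ _).trans ?_)
    linarith

end Rectangles

/-! ### The substitutes inequality for approximable algebras -/

section Substitutes

variable {Ω : Type u} {m F mA mB mΩ : MeasurableSpace Ω} {μ : Measure Ω}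

theorem integrable_cond {s : Set Ω} (hs0 : μ s ≠ 0) {f : Ω → ℝ} (hf : Integrable f μ) :
    Integrable f (μ[|s]) :=
  hf.restrict.smul_measure (ENNReal.inv_ne_top.2 hs0)

theorem integral_eq_sum_setIntegral_label {ι : Type*} [Fintype ι] {R : Ω → ι}
    (hR : labelAlgebra R ≤ mΩ) {f : Ω → ℝ} (hf : Integrable f μ) :
    ∫ ω, f ω ∂μ = ∑ i, ∫ ω in R ⁻¹' {i}, f ω ∂μ := by
  rw [← setIntegral_univ]
  have : (univ : Set Ω) = ⋃ i ∈ (Finset.univ : Finset ι), R ⁻¹' {i} := by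
    ext ω; simp
  rw [this, integral_biUnion_finset]
  · exact fun i _ => labelAlgebra_le_iff.1 hR i
  · intro i _ j _ hij
    exact Disjoint.preimage _ (by simpa using hij)
  · exact fun i _ => hf.integrableOn

variable [IsProbabilityMeasure μ]

theorem setIntegral_eq_mul_integral_cond {s : Set Ω} (hs0 : μ s ≠ 0) (f : Ω → ℝ) :
    ∫ ω in s, f ω ∂μ = μ.real s * ∫ ω, f ω ∂(μ[|s]) := by
  have h : μ.real s ≠ 0 := (measureReal_ne_zero_iff (measure_ne_top μ s)).2 hs0
  rw [ProbabilityTheory.cond, integral_smul_measure, ENNReal.toReal_inv, smul_eq_mul,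
    ← mul_assoc, ← measureReal_def, mul_inv_cancel₀ h, one_mul]

/-- On a cell of a label, a conditional expectation given the label and `m` is the conditional
expectation given `m` for the measure conditioned on the cell. -/
theorem setIntegral_comp_condExp_label {G : ℝ → ℝ} {Y : Ω → ℝ} (hY : Integrable Y μ)
    (h01 : ∀ᵐ ω ∂μ, Y ω ∈ Icc (0 : ℝ) 1) {ι : Type*} [Countable ι] {R : Ω → ι} (hm : m ≤ mΩ)
    (hR : labelAlgebra R ≤ mΩ) {i : ι} (hi : μ (R ⁻¹' {i}) ≠ 0) :
    ∫ ω in R ⁻¹' {i}, G ((μ[Y | m ⊔ labelAlgebra R]) ω) ∂μ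
      = μ.real (R ⁻¹' {i}) * potential G (μ[|R ⁻¹' {i}]) Y m := by
  let mι : MeasurableSpace ι := ⊤
  have hcell : MeasurableSet[labelAlgebra R] (R ⁻¹' {i}) := labelAlgebra_le_iff.1 le_rfl i
  set ν := μ[|R ⁻¹' {i}] with hν
  have hνp : IsProbabilityMeasure ν := cond_isProbabilityMeasure hi
  have hY' : Integrable Y ν := integrable_cond hi hY
  have h01' : ∀ᵐ ω ∂ν, Y ω ∈ Icc (0 : ℝ) 1 := cond_absolutelyContinuous h01
  have h1 : ν[Y | m ⊔ labelAlgebra R] =ᵐ[ν] μ[Y | m ⊔ labelAlgebra R] :=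
    condExp_cond_ae_eq hY (sup_le hm hR) ((le_sup_right : labelAlgebra R ≤ m ⊔ _) _ hcell) hi
  have hmem : ∀ᵐ ω ∂ν, ω ∈ R ⁻¹' {i} := ae_cond_mem (hR _ hcell)
  have hRm : Measurable R := (comap_measurable R).mono hR le_rfl
  -- Conditionally on the cell, the label is constant.
  have h2 : ν[Y | m ⊔ labelAlgebra R] =ᵐ[ν] ν[Y | m] := by
    have h3 := integral_abs_condExp_sub_condExp_sup_comap_le (k := R) (k' := fun _ => i) hY' h01' hm
      hRm measurable_const (measurableSet_eq_fun hRm measurable_const).compl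
    have h4 : ν.real {ω | R ω ≠ i} = 0 := by
      rw [measureReal_eq_zero_iff]
      exact hmem
    rw [h4, mul_zero] at h3
    have h5 := (integral_eq_zero_iff_of_nonneg (μ := ν)
      (f := fun ω => |(ν[Y | m ⊔ mι.comap R]) ω - (ν[Y | m]) ω|) (fun ω => abs_nonneg _)
      (integrable_condExp.sub integrable_condExp).abs).1
      (le_antisymm h3 (integral_nonneg fun ω => abs_nonneg _))
    filter_upwards [h5] with ω hω
    exact sub_eq_zero.1 (abs_eq_zero.1 hω)
  rw [setIntegral_eq_mul_integral_cond hi]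
  congr 1
  refine integral_congr_ae ?_
  filter_upwards [h1, h2] with ω e1 e2
  rw [← e1, e2]

/-- The substitutes inequality on each rectangle gives the inequality for every finite rectangle
partition. -/
theorem potential_add_le_of_isRectangular {G : ℝ → ℝ} (hG : ContinuousOn G (Icc 0 1)) {Y : Ω → ℝ}
    (hY : Integrable Y μ) (h01 : ∀ᵐ ω ∂μ, Y ω ∈ Icc (0 : ℝ) 1) (hA : mA ≤ mΩ) (hB : mB ≤ mΩ)
    (hsub : ∀ s t, MeasurableSet[mA] s → MeasurableSet[mB] t → μ (s ∩ t) ≠ 0 →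
      potential G (μ[|s ∩ t]) Y (mA ⊔ mB) + potential G (μ[|s ∩ t]) Y ⊥
        ≤ potential G (μ[|s ∩ t]) Y mA + potential G (μ[|s ∩ t]) Y mB)
    {ι : Type*} [Finite ι] {R : Ω → ι} (hR : IsRectangular mA mB R) :
    potential G μ Y (mA ⊔ mB) + potential G μ Y (⊥ ⊔ labelAlgebra R)
      ≤ potential G μ Y (mA ⊔ labelAlgebra R) + potential G μ Y (mB ⊔ labelAlgebra R) := by
  have := Fintype.ofFinite ι
  have hRAB := hR.labelAlgebra_le
  have hRΩ : labelAlgebra R ≤ mΩ := hRAB.trans (sup_le hA hB)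
  have hsum : ∀ m ≤ mΩ, potential G μ Y (m ⊔ labelAlgebra R)
      = ∑ i, ∫ ω in R ⁻¹' {i}, G ((μ[Y | m ⊔ labelAlgebra R]) ω) ∂μ := fun m hm =>
    integral_eq_sum_setIntegral_label hRΩ
      (integrable_comp_condExp hG hY h01 (sup_le hm hRΩ))
  rw [← sup_eq_left.2 hRAB, hsum _ (sup_le hA hB), hsum _ bot_le, hsum _ hA, hsum _ hB,
    ← Finset.sum_add_distrib, ← Finset.sum_add_distrib]
  refine Finset.sum_le_sum fun i _ => ?_
  by_cases hi : μ (R ⁻¹' {i}) = 0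
  · simp [Measure.restrict_eq_zero.2 hi]
  rw [setIntegral_comp_condExp_label hY h01 (sup_le hA hB) hRΩ hi,
    setIntegral_comp_condExp_label hY h01 bot_le hRΩ hi,
    setIntegral_comp_condExp_label hY h01 hA hRΩ hi,
    setIntegral_comp_condExp_label hY h01 hB hRΩ hi, ← mul_add, ← mul_add]
  obtain ⟨s, t, hs, ht, e⟩ := hR i
  rw [e] at hi ⊢
  exact mul_le_mul_of_nonneg_left (hsub s t hs ht hi) measureReal_nonneg

/-- The substitutes inequality passes from rectangles to `σ`-algebras that are approximated by
finite rectangle partitions. -/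
theorem potential_add_le_of_rectangleApproximable {G : ℝ → ℝ} (hG : ContinuousOn G (Icc 0 1))
    {Y : Ω → ℝ} (hY : Integrable Y μ) (h01 : ∀ᵐ ω ∂μ, Y ω ∈ Icc (0 : ℝ) 1) (hA : mA ≤ mΩ)
    (hB : mB ≤ mΩ)
    (hsub : ∀ s t, MeasurableSet[mA] s → MeasurableSet[mB] t → μ (s ∩ t) ≠ 0 →
      potential G (μ[|s ∩ t]) Y (mA ⊔ mB) + potential G (μ[|s ∩ t]) Y ⊥
        ≤ potential G (μ[|s ∩ t]) Y mA + potential G (μ[|s ∩ t]) Y mB)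
    (hFΩ : F ≤ mΩ) (hF : RectangleApproximable mA mB μ F) :
    potential G μ Y (mA ⊔ mB) + potential G μ Y F
      ≤ potential G μ Y (mA ⊔ F) + potential G μ Y (mB ⊔ F) := by
  classical
  refine le_of_forall_pos_le_add fun e he => ?_
  obtain ⟨C, hC0, hC⟩ := exists_abs_sub_le_add_mul hG (e := e / 6) (by positivity)
  set η : ℝ := e / (30 * (C + 1)) with hη
  have hη0 : 0 < η := by positivity
  obtain ⟨t1, ht1, h1⟩ := exists_finset_condExp_approx hA hFΩ (Y := Y) (μ := μ) hη0
  obtain ⟨t2, ht2, h2⟩ := exists_finset_condExp_approx hB hFΩ (Y := Y) (μ := μ) hη0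
  obtain ⟨t3, ht3, h3⟩ := exists_finset_condExp_approx (m := ⊥) bot_le hFΩ (Y := Y) (μ := μ) hη0
  obtain ⟨ι, hι, H, R, hHF, hR, hsat, hHR⟩ := hF (t1 ∪ t2 ∪ t3) (fun D hD => by
    rcases Finset.mem_union.1 hD with hD | hD
    · exact (Finset.mem_union.1 hD).elim (ht1 D) (ht2 D)
    · exact ht3 D hD) η hη0
  have hRΩ : labelAlgebra R ≤ mΩ := hR.labelAlgebra_le.trans (sup_le hA hB)
  have hHΩ : labelAlgebra H ≤ mΩ := hHF.trans hFΩ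
  have hclose : ∀ m ≤ mΩ,
      ∫ ω, |(μ[Y | m ⊔ F]) ω - (μ[Y | m ⊔ labelAlgebra H]) ω| ∂μ ≤ η →
      |potential G μ Y (m ⊔ F) - potential G μ Y (m ⊔ labelAlgebra R)| ≤ e / 3 := by
    intro m hm h
    have h5 := integral_abs_condExp_sub_condExp_label_le hm hHΩ hRΩ hY h01
    have h6 : ∫ ω, |(μ[Y | m ⊔ F]) ω - (μ[Y | m ⊔ labelAlgebra R]) ω| ∂μ ≤ 5 * η := by
      have hI1 : Integrable (fun ω => |(μ[Y | m ⊔ F]) ω - (μ[Y | m ⊔ labelAlgebra H]) ω|) μ :=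
        (integrable_condExp.sub integrable_condExp).abs
      have hI2 : Integrable (fun ω => |(μ[Y | m ⊔ labelAlgebra H]) ω
          - (μ[Y | m ⊔ labelAlgebra R]) ω|) μ := (integrable_condExp.sub integrable_condExp).abs
      refine (integral_mono (integrable_condExp.sub integrable_condExp).abs (hI1.add hI2)
        fun ω => abs_sub_le _ ((μ[Y | m ⊔ labelAlgebra H]) ω) _).trans ?_
      rw [integral_add' hI1 hI2]
      linarith
    refine (abs_potential_sub_le hG hC hY h01 (sup_le hm hFΩ) (sup_le hm hRΩ)).trans ?_
    have h7 : C * ∫ ω, |(μ[Y | m ⊔ F]) ω - (μ[Y | m ⊔ labelAlgebra R]) ω| ∂μ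
        ≤ (C + 1) * (5 * η) := by
      have : 0 ≤ 5 * η := by positivity
      exact (mul_le_mul_of_nonneg_left h6 hC0).trans (by linarith)
    have h8 : (C + 1) * (5 * η) = e / 6 := by
      rw [hη]
      field_simp
      norm_num
    linarith
  have c1 := abs_le.1 (hclose mA hA (h1 H hHF fun D hD => hsat D (by simp [hD])))
  have c2 := abs_le.1 (hclose mB hB (h2 H hHF fun D hD => hsat D (by simp [hD])))
  have c3 := abs_le.1 (hclose ⊥ bot_le (h3 H hHF fun D hD => hsat D (by simp [hD])))
  have hfin := potential_add_le_of_isRectangular hG hY h01 hA hB hsub hR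
  simp only [bot_sup_eq] at c3 hfin
  linarith

end Substitutes

/-! ### The transcript algebra -/

section Transcript

theorem measurable_snoc {M : Type*} [MeasurableSpace M] {Ω : Type*} [MeasurableSpace Ω] {n : ℕ}
    {f : Ω → Fin n → M} {g : Ω → M} (hf : Measurable f) (hg : Measurable g) :
    Measurable fun ω => (Fin.snoc (α := fun _ => M) (f ω) (g ω) : Fin (n + 1) → M) := by
  rw [measurable_pi_iff]
  intro i
  induction i using Fin.lastCases with
  | last => simpa using hg
  | cast i =>
    simp only [Fin.snoc_castSucc]
    exact (measurable_pi_apply i).comp hf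

theorem measurableSet_sigma_iff {ι : Type*} {β : ι → Type*} [∀ i, MeasurableSpace (β i)]
    {s : Set (Sigma β)} : MeasurableSet s ↔ ∀ i, MeasurableSet (Sigma.mk i ⁻¹' s) := by
  change MeasurableSet[⨅ i, MeasurableSpace.map (Sigma.mk i) inferInstance] s ↔ _
  rw [MeasurableSpace.measurableSet_iInf]
  rfl

/-- The sets whose intersection with the event `W` is measurable. -/
abbrev traceAlgebra {Ω : Type*} (F : MeasurableSpace Ω) (W : Set Ω) (hW : MeasurableSet[F] W) :
    MeasurableSpace Ω where
  MeasurableSet' s := MeasurableSet[F] (s ∩ W)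
  measurableSet_empty := by simp
  measurableSet_compl s hs := by
    have e : sᶜ ∩ W = W \ (s ∩ W) := by ext ω; simp; tauto
    rw [e]
    exact hW.diff hs
  measurableSet_iUnion f hf := by
    rw [iUnion_inter]
    exact MeasurableSet.iUnion hf

variable {Ω : Type u} {S : Type v} {T : Type w} {M : Type x}
  [mΩ : MeasurableSpace Ω] [mS : MeasurableSpace S] [mT : MeasurableSpace T]
  [mM : MeasurableSpace M] (π : Protocol S T M) (I : InfoStructure Ω S T)

/-- The first `n` messages, disregarding the stopping rule. -/
abbrev messages (n : ℕ) (ω : Ω) : Fin n → M := π.transcript (I.sigA ω) (I.sigB ω) n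

/-- The event that the first `n` messages are all really sent: no shorter transcript is final. -/
def running (n : ℕ) : Set Ω := {ω | ∀ j < n, messages π I j ω ∉ π.halt j}

/-- The `σ`-algebra of the first `n` messages of the protocol, as far as they are really sent. -/
abbrev stoppedAlgebra : ℕ → MeasurableSpace Ω
  | 0 => ⊥
  | n + 1 => stoppedAlgebra n ⊔ MeasurableSpace.generateFrom
      {s | ∃ E, MeasurableSet E ∧ s = running π I (n + 1) ∩ messages π I (n + 1) ⁻¹' E}

theorem algA_le : I.algA ≤ mΩ := I.measurable_sigA.comap_le

theorem algB_le : I.algB ≤ mΩ := I.measurable_sigB.comap_le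

theorem algA_sup_algB_le : I.algA ⊔ I.algB ≤ mΩ := sup_le (algA_le I) (algB_le I)

theorem messages_prefix {k n : ℕ} (h : k ≤ n) (ω : Ω) :
    messages π I k ω = fun i => messages π I n ω (Fin.castLE h i) := by
  induction n, h using Nat.le_induction with
  | base => rfl
  | succ n hn ih =>
    rw [ih]
    funext i
    change messages π I n ω (Fin.castLE hn i) = Fin.snoc (α := fun _ => M) (messages π I n ω) _
      (Fin.castLE (hn.trans n.le_succ) i)
    have e : Fin.castLE (hn.trans n.le_succ) i = Fin.castSucc (Fin.castLE hn i) := rfl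
    rw [e, Fin.snoc_castSucc]

theorem measurable_messages (n : ℕ) : Measurable[I.algA ⊔ I.algB] (messages π I n) := by
  induction n with
  | zero =>
    have : Subsingleton (Fin 0 → M) := inferInstance
    exact @measurable_of_subsingleton_codomain _ _ (I.algA ⊔ I.algB) _ _ _
  | succ n ih =>
    have hA : Measurable[I.algA ⊔ I.algB] I.sigA :=
      (comap_measurable I.sigA).mono le_sup_left le_rfl
    have hB : Measurable[I.algA ⊔ I.algB] I.sigB :=
      (comap_measurable I.sigB).mono le_sup_right le_rfl
    refine @measurable_snoc M _ Ω (I.algA ⊔ I.algB) n _ _ ih ?_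
    cases π.aliceTurn n with
    | true => exact (π.measurable_aliceMsg n).comp (ih.prodMk hA)
    | false => exact (π.measurable_bobMsg n).comp (ih.prodMk hB)

theorem running_zero : running π I 0 = univ := by
  ext ω; simp [running]

theorem running_succ (n : ℕ) :
    running π I (n + 1) = running π I n ∩ messages π I n ⁻¹' (π.halt n)ᶜ := by
  ext ω
  simp only [running, mem_ofPred_eq, mem_inter_iff, mem_preimage, mem_compl_iff]
  constructor
  · exact fun h => ⟨fun j hj => h j (by omega), h n n.lt_succ_self⟩
  · rintro ⟨h1, h2⟩ j hj
    rcases Nat.lt_succ_iff_lt_or_eq.1 hj with h | rfl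
    · exact h1 j h
    · exact h2

theorem running_antitone : Antitone (running π I) :=
  fun _ _ h _ hω j hj => hω j (hj.trans_le h)

theorem measurableSet_running (n : ℕ) : MeasurableSet[I.algA ⊔ I.algB] (running π I n) := by
  induction n with
  | zero => rw [running_zero]; exact @MeasurableSet.univ _ (_)
  | succ n ih =>
    rw [running_succ]
    exact MeasurableSet.inter ih (measurable_messages π I n (π.measurableSet_halt n).compl)

theorem stoppedAlgebra_le (n : ℕ) : stoppedAlgebra π I n ≤ I.algA ⊔ I.algB := by
  induction n with
  | zero => exact bot_le
  | succ n ih =>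
    refine sup_le ih (MeasurableSpace.generateFrom_le ?_)
    rintro s ⟨E, hE, rfl⟩
    exact MeasurableSet.inter (measurableSet_running π I _) (measurable_messages π I _ hE)

theorem stoppedAlgebra_mono : Monotone (stoppedAlgebra π I) :=
  monotone_nat_of_le_succ fun _ => le_sup_left

theorem measurableSet_stoppedAlgebra (n : ℕ) {E : Set (Fin n → M)} (hE : MeasurableSet E) :
    MeasurableSet[stoppedAlgebra π I n] (running π I n ∩ messages π I n ⁻¹' E) := by
  cases n with
  | zero =>
    rw [running_zero, univ_inter]
    have : Subsingleton (Fin 0 → M) := inferInstance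
    rcases Subsingleton.set_cases (p := fun E => E = ∅ ∨ E = univ) (Or.inl rfl) (Or.inr rfl) E
      with rfl | rfl
    · exact @MeasurableSet.empty _ (_)
    · exact @MeasurableSet.univ _ (_)
  | succ n =>
    exact (le_sup_right : _ ≤ stoppedAlgebra π I (n + 1)) _
      (MeasurableSpace.measurableSet_generateFrom ⟨E, hE, rfl⟩)

/-- On the event that the protocol is still running, the joint events of the messages and the
sender's signal are known to the sender. -/
theorem measurableSet_running_inter_preimage_prod {U : Type*} [mU : MeasurableSpace U] {sig : Ω → U}
    (n : ℕ) {E : Set ((Fin n → M) × U)} (hE : MeasurableSet E) :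
    MeasurableSet[mU.comap sig ⊔ stoppedAlgebra π I n]
      (running π I n ∩ (fun ω => (messages π I n ω, sig ω)) ⁻¹' E) := by
  have hrun : MeasurableSet[mU.comap sig ⊔ stoppedAlgebra π I n] (running π I n) := by
    have := measurableSet_stoppedAlgebra π I n (E := univ) MeasurableSet.univ
    rw [preimage_univ, inter_univ] at this
    exact (le_sup_right : stoppedAlgebra π I n ≤ _) _ this
  have hle : MeasurableSpace.comap (fun ω => (messages π I n ω, sig ω)) Prod.instMeasurableSpace
      ≤ traceAlgebra (mU.comap sig ⊔ stoppedAlgebra π I n) (running π I n) hrun := by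
    rw [Prod.instMeasurableSpace, MeasurableSpace.prod, MeasurableSpace.comap_sup,
      MeasurableSpace.comap_comp, MeasurableSpace.comap_comp]
    refine sup_le ?_ ?_
    · rintro _ ⟨E, hE, rfl⟩
      change MeasurableSet[mU.comap sig ⊔ stoppedAlgebra π I n] (_ ∩ running π I n)
      rw [inter_comm]
      exact (le_sup_right : stoppedAlgebra π I n ≤ _) _ (measurableSet_stoppedAlgebra π I n hE)
    · rintro _ ⟨E, hE, rfl⟩
      exact @MeasurableSet.inter _ (mU.comap sig ⊔ stoppedAlgebra π I n) _ _
        ((le_sup_left : mU.comap sig ≤ mU.comap sig ⊔ stoppedAlgebra π I n) _ ⟨E, hE, rfl⟩) hrun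
  rw [inter_comm]
  exact hle _ ⟨E, hE, rfl⟩

theorem stoppedAlgebra_succ_le_of_sender {U : Type*} [mU : MeasurableSpace U] {sig : Ω → U} {n : ℕ}
    {f : (Fin n → M) → U → M} (hf : Measurable fun p : (Fin n → M) × U => f p.1 p.2)
    (h : ∀ ω, messages π I (n + 1) ω
      = Fin.snoc (α := fun _ => M) (messages π I n ω) (f (messages π I n ω) (sig ω))) :
    stoppedAlgebra π I (n + 1) ≤ mU.comap sig ⊔ stoppedAlgebra π I n := by
  refine sup_le le_sup_right (MeasurableSpace.generateFrom_le ?_)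
  rintro s ⟨E, hE, rfl⟩
  have e : running π I (n + 1) ∩ messages π I (n + 1) ⁻¹' E = running π I n ∩
      (fun ω => (messages π I n ω, sig ω)) ⁻¹' ({p | p.1 ∉ π.halt n} ∩
        {p | (Fin.snoc (α := fun _ => M) p.1 (f p.1 p.2) : Fin (n + 1) → M) ∈ E}) := by
    rw [running_succ]
    ext ω
    simp only [mem_inter_iff, mem_preimage, mem_compl_iff, mem_ofPred_eq, h]
    tauto
  rw [e]
  refine measurableSet_running_inter_preimage_prod π I n (MeasurableSet.inter ?_ ?_)
  · exact measurable_fst (π.measurableSet_halt n).compl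
  · exact measurable_snoc measurable_fst hf hE

/-- By induction on the number of messages: each message adds to the public information only what
its sender knew. -/
theorem rectangleApproximable_stoppedAlgebra (n : ℕ) :
    RectangleApproximable I.algA I.algB I.P (stoppedAlgebra π I n) := by
  have := I.isProb
  induction n with
  | zero => exact rectangleApproximable_bot
  | succ n ih =>
    have hle := (stoppedAlgebra_le π I n).trans (algA_sup_algB_le I)
    have hmono := stoppedAlgebra_mono π I n.le_succ
    cases ht : π.aliceTurn n with
    | true =>
      refine ih.of_le_sup_left (algA_le I) hle hmono
        (stoppedAlgebra_succ_le_of_sender π I (π.measurable_aliceMsg n) fun ω => ?_)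
      simp only [messages, Protocol.transcript, ht, if_true]
    | false =>
      refine ih.of_le_sup_right (algB_le I) hle hmono
        (stoppedAlgebra_succ_le_of_sender π I (π.measurable_bobMsg n) fun ω => ?_)
      simp [messages, Protocol.transcript, ht]

theorem endTime_eq_of_mem {j : ℕ} {ω : Ω} (h1 : ω ∈ running π I j)
    (h2 : messages π I j ω ∈ π.halt j) : π.endTime (I.sigA ω) (I.sigB ω) = j := by
  refine le_antisymm (Nat.sInf_le h2) ?_
  by_contra! hlt
  exact h1 _ hlt (Nat.sInf_mem (s := {n | π.transcript (I.sigA ω) (I.sigB ω) n ∈ π.halt n}) ⟨j, h2⟩)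

theorem mem_running_endTime (ω : Ω) : ω ∈ running π I (π.endTime (I.sigA ω) (I.sigB ω)) :=
  fun _ hj => Nat.notMem_of_lt_sInf hj

theorem messages_endTime_mem {ω : Ω} (h : π.TerminatesOn (I.sigA ω) (I.sigB ω)) :
    messages π I (π.endTime (I.sigA ω) (I.sigB ω)) ω
      ∈ π.halt (π.endTime (I.sigA ω) (I.sigB ω)) :=
  Nat.sInf_mem (s := {n | π.transcript (I.sigA ω) (I.sigB ω) n ∈ π.halt n}) h

/-- The final transcript is determined by both signals.  On pairs of signals on which the protocol
does not terminate, the final transcript is empty by convention. -/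
theorem algTranscript_le : π.algTranscript I ≤ I.algA ⊔ I.algB := by
  rintro _ ⟨E, hE, rfl⟩
  have hE' := measurableSet_sigma_iff.1 hE
  have e : (fun ω => π.finalTranscript (I.sigA ω) (I.sigB ω)) ⁻¹' E
      = (⋃ j, running π I j ∩ messages π I j ⁻¹'
          (π.halt j ∩ @Sigma.mk ℕ (fun n => Fin n → M) j ⁻¹' E))
        ∪ ((⋂ j, running π I j) ∩ messages π I 0 ⁻¹'
          (@Sigma.mk ℕ (fun n => Fin n → M) 0 ⁻¹' E)) := by
    ext ω
    by_cases h : π.TerminatesOn (I.sigA ω) (I.sigB ω)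
    · have h2 : ω ∉ ⋂ j, running π I j := by
        intro hn
        obtain ⟨j, hj⟩ := h
        exact mem_iInter.1 hn (j + 1) j j.lt_succ_self hj
      simp only [mem_union, mem_inter_iff, h2, false_and, or_false, mem_iUnion, mem_preimage]
      constructor
      · intro hω
        exact ⟨_, mem_running_endTime π I ω, messages_endTime_mem π I h, hω⟩
      · rintro ⟨j, h3, h4, h5⟩
        have := endTime_eq_of_mem π I h3 h4
        subst this
        exact h5
    · have h0 : π.endTime (I.sigA ω) (I.sigB ω) = 0 := by
        have : {n | π.transcript (I.sigA ω) (I.sigB ω) n ∈ π.halt n} = ∅ := by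
          ext n
          exact iff_of_false (fun hn => h ⟨n, hn⟩) (by simp)
        rw [Protocol.endTime, this, Nat.sInf_empty]
      have h1 : ω ∈ ⋂ j, running π I j := mem_iInter.2 fun j i _ hi => h ⟨i, hi⟩
      have h2 : π.finalTranscript (I.sigA ω) (I.sigB ω) = ⟨0, messages π I 0 ω⟩ := by
        rw [Protocol.finalTranscript, h0]
      simp only [mem_union, mem_inter_iff, h1, true_and, mem_iUnion, mem_preimage, h2]
      constructor
      · exact Or.inr
      · rintro (⟨j, -, h4, -⟩ | h5)
        · exact absurd ⟨j, h4⟩ h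
        · exact h5
  rw [e]
  refine MeasurableSet.union (MeasurableSet.iUnion fun j => ?_) (MeasurableSet.inter
    (MeasurableSet.iInter fun j => measurableSet_running π I j)
    (measurable_messages π I 0 (hE' 0)))
  exact MeasurableSet.inter (measurableSet_running π I j)
    (measurable_messages π I j ((π.measurableSet_halt j).inter (hE' j)))

/-- The messages up to number `k` of a transcript that stops before time `n` can be read off from
the final transcript. -/
theorem measurableSet_algTranscript_inter {k n : ℕ} {E : Set (Fin k → M)}
    (hE : MeasurableSet E) :
    MeasurableSet[π.algTranscript I]
      ((running π I k ∩ messages π I k ⁻¹' E) ∩ (running π I n)ᶜ) := by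
  refine ⟨{y | y.1 < n ∧ y.2 ∈ π.halt y.1 ∧ ∃ h : k ≤ y.1, (fun i => y.2 (Fin.castLE h i)) ∈ E},
    ?_, ?_⟩
  · rw [measurableSet_sigma_iff]
    intro j
    by_cases hj : j < n ∧ k ≤ j
    · have e : Sigma.mk j ⁻¹' {y : Σ n : ℕ, (Fin n → M) | y.1 < n ∧ y.2 ∈ π.halt y.1 ∧
          ∃ h : k ≤ y.1, (fun i => y.2 (Fin.castLE h i)) ∈ E}
          = π.halt j ∩ (fun v : Fin j → M => fun i => v (Fin.castLE hj.2 i)) ⁻¹' E := by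
        ext v
        simp only [mem_preimage, mem_ofPred_eq, hj.1, true_and, mem_inter_iff]
        exact and_congr_right fun _ => ⟨fun ⟨_, h⟩ => h, fun h => ⟨hj.2, h⟩⟩
      rw [e]
      exact (π.measurableSet_halt j).inter ((measurable_pi_iff.2 fun i => measurable_pi_apply _ :
        Measurable fun v : Fin j → M => fun i => v (Fin.castLE hj.2 i)) hE)
    · have e : Sigma.mk j ⁻¹' {y : Σ n : ℕ, (Fin n → M) | y.1 < n ∧ y.2 ∈ π.halt y.1 ∧
          ∃ h : k ≤ y.1, (fun i => y.2 (Fin.castLE h i)) ∈ E} = ∅ := by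
        ext v
        simp only [mem_preimage, mem_ofPred_eq, mem_empty_iff_false, iff_false]
        rintro ⟨h1, -, h2, -⟩
        exact hj ⟨h1, h2⟩
      rw [e]
      exact MeasurableSet.empty
  · ext ω
    simp only [mem_preimage, mem_ofPred_eq, mem_inter_iff, mem_compl_iff]
    constructor
    · rintro ⟨h1, h2, h3, h4⟩
      refine ⟨⟨running_antitone π I h3 (mem_running_endTime π I ω), ?_⟩, fun h => h _ h1 h2⟩
      rw [messages_prefix π I h3]
      exact h4
    · rintro ⟨⟨h1, h2⟩, h3⟩
      simp only [running, mem_ofPred_eq, not_forall, not_not] at h3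
      obtain ⟨j, hj, hjh⟩ := h3
      have hterm : π.TerminatesOn (I.sigA ω) (I.sigB ω) := ⟨j, hjh⟩
      have hend := messages_endTime_mem π I hterm
      have hk : k ≤ π.endTime (I.sigA ω) (I.sigB ω) := by
        by_contra! hlt
        exact h1 _ hlt hend
      refine ⟨(Nat.sInf_le hjh).trans_lt hj, hend, hk, ?_⟩
      rw [messages_prefix π I hk] at h2
      exact h2

/-- The final transcript is approximable by rectangles, since with probability close to one the
protocol has stopped by some fixed time, and on that event the final transcript carries the same
information as the messages sent until then. -/
theorem rectangleApproximable_algTranscript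
    (hterm : ∀ᵐ ω ∂I.P, π.TerminatesOn (I.sigA ω) (I.sigB ω)) :
    RectangleApproximable I.algA I.algB I.P (π.algTranscript I) := by
  have := I.isProb
  refine RectangleApproximable.of_forall_trace fun η hη => ?_
  have hnull : I.P (⋂ n, running π I n) = 0 := by
    refine measure_mono_null (fun ω hω => ?_) hterm
    rintro ⟨j, hj⟩
    exact mem_iInter.1 hω (j + 1) j j.lt_succ_self hj
  have hlim := tendsto_measure_iInter_atTop (μ := I.P)
    (fun n => ((algA_sup_algB_le I) _ (measurableSet_running π I n)).nullMeasurableSet)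
    (running_antitone π I) ⟨0, measure_ne_top _ _⟩
  rw [hnull] at hlim
  obtain ⟨n, hn⟩ := (hlim.eventually (gt_mem_nhds (ENNReal.ofReal_pos.2 hη))).exists
  have hW : MeasurableSet[π.algTranscript I] (running π I n)ᶜ := by
    have := measurableSet_algTranscript_inter π I (E := univ) MeasurableSet.univ (k := 0) (n := n)
    rwa [running_zero, preimage_univ, inter_univ, univ_inter] at this
  refine ⟨stoppedAlgebra π I n, (running π I n)ᶜ, rectangleApproximable_stoppedAlgebra π I n, hW,
    ?_, ?_, ?_⟩
  · rw [compl_compl]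
    exact ENNReal.toReal_le_of_le_ofReal hη.le hn.le
  · have hle : ∀ k ≤ n, stoppedAlgebra π I k ≤ traceAlgebra (π.algTranscript I) _ hW := by
      intro k
      induction k with
      | zero => exact fun _ => bot_le
      | succ k ih =>
        intro hk
        refine sup_le (ih (by omega)) (MeasurableSpace.generateFrom_le ?_)
        rintro s ⟨E, hE, rfl⟩
        exact measurableSet_algTranscript_inter π I hE
    exact hle n le_rfl
  · rintro _ ⟨E, hE, rfl⟩
    have hE' := measurableSet_sigma_iff.1 hE
    have e : (fun ω => π.finalTranscript (I.sigA ω) (I.sigB ω)) ⁻¹' E ∩ (running π I n)ᶜ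
        = ⋃ j ∈ Iio n, running π I j ∩ messages π I j ⁻¹'
          (π.halt j ∩ @Sigma.mk ℕ (fun n => Fin n → M) j ⁻¹' E) := by
      ext ω
      simp only [mem_inter_iff, mem_preimage, mem_compl_iff, mem_iUnion, mem_Iio, exists_prop]
      constructor
      · rintro ⟨h1, h2⟩
        simp only [running, mem_ofPred_eq, not_forall, not_not] at h2
        obtain ⟨j, hj, hjh⟩ := h2
        exact ⟨_, (Nat.sInf_le hjh).trans_lt hj, mem_running_endTime π I ω,
          messages_endTime_mem π I ⟨j, hjh⟩, h1⟩
      · rintro ⟨j, hj, h3, h4, h5⟩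
        refine ⟨?_, fun h => h j hj h4⟩
        have := endTime_eq_of_mem π I h3 h4
        subst this
        exact h5
    rw [e]
    refine MeasurableSet.biUnion (to_countable _) fun j hj => ?_
    exact stoppedAlgebra_mono π I (le_of_lt hj) _
      (measurableSet_stoppedAlgebra π I j ((π.measurableSet_halt j).inter (hE' j)))

end Transcript

/-! ### Random partitions of the line into unit intervals -/

/-- Two points of the line are separated by the randomly shifted integers with probability at most
their distance. -/
theorem volume_floor_add_ne_le (u v : ℝ) :
    volume.restrict (Ioc (0 : ℝ) 1) {t | ⌊u + t⌋ ≠ ⌊v + t⌋} ≤ ENNReal.ofReal (min 1 |u - v|) := by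
  wlog huv : u ≤ v generalizing u v
  · have := this v u (le_of_not_ge huv)
    rw [abs_sub_comm]
    simpa only [ne_comm] using this
  have hmeas : MeasurableSet {t : ℝ | ⌊u + t⌋ ≠ ⌊v + t⌋} :=
    (measurableSet_eq_fun (Int.measurable_floor.comp (measurable_const_add u))
      (Int.measurable_floor.comp (measurable_const_add v))).compl
  have : IsProbabilityMeasure (volume.restrict (Ioc (0 : ℝ) 1)) := ⟨by simp⟩
  have hI : ∀ w : ℝ, Integrable (fun t => Int.fract (w + t)) (volume.restrict (Ioc (0 : ℝ) 1)) := by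
    intro w
    refine Integrable.of_bound
      (measurable_fract.comp (measurable_const_add w)).aestronglyMeasurable 1 ?_
    filter_upwards with t
    rw [Real.norm_eq_abs, abs_of_nonneg (Int.fract_nonneg _)]
    exact (Int.fract_lt_one _).le
  have hfract : ∀ w : ℝ, ∫ t in Ioc (0 : ℝ) 1, Int.fract (w + t)
      = ∫ t in (0 : ℝ)..1, Int.fract t := by
    intro w
    have h1 : Function.Periodic (fun t : ℝ => Int.fract t) 1 := fun t => Int.fract_add_one t
    have h2 := h1.intervalIntegral_add_eq w 0
    rw [← intervalIntegral.integral_of_le zero_le_one,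
      intervalIntegral.integral_comp_add_left (fun t => Int.fract t) w, add_zero, h2, zero_add]
  have hint : ∀ t : ℝ, ((⌊v + t⌋ : ℝ) - ⌊u + t⌋)
      = (v - u) - (Int.fract (v + t) - Int.fract (u + t)) := by
    intro t
    rw [Int.fract, Int.fract]
    ring
  have h1 : (volume.restrict (Ioc (0 : ℝ) 1)).real {t | ⌊u + t⌋ ≠ ⌊v + t⌋} ≤ v - u := by
    rw [← integral_indicator_one hmeas]
    calc ∫ t in Ioc (0 : ℝ) 1, ({t | ⌊u + t⌋ ≠ ⌊v + t⌋} : Set ℝ).indicator 1 t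
        ≤ ∫ t in Ioc (0 : ℝ) 1, ((v - u) - (Int.fract (v + t) - Int.fract (u + t))) := by
          refine integral_mono ((integrable_const 1).indicator hmeas)
            ((integrable_const _).sub ((hI v).sub (hI u))) fun t => ?_
          have hle : ⌊u + t⌋ ≤ ⌊v + t⌋ := Int.floor_le_floor (by linarith)
          simp only [← hint]
          by_cases ht : ⌊u + t⌋ = ⌊v + t⌋
          · simp [indicator, ht]
          · have h3 : ⌊u + t⌋ + 1 ≤ ⌊v + t⌋ := by omega
            have h4 : ((⌊u + t⌋ : ℝ) + 1) ≤ ⌊v + t⌋ := by exact_mod_cast h3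
            simp only [indicator, mem_ofPred_eq, ne_eq, ht, not_false_eq_true, if_true,
              Pi.one_apply]
            linarith
      _ = v - u := by
          have h5 : ∫ t in Ioc (0 : ℝ) 1, (Int.fract (v + t) - Int.fract (u + t)) = 0 := by
            rw [integral_sub (hI v) (hI u), hfract, hfract, sub_self]
          have h6 : Integrable (fun t => Int.fract (v + t) - Int.fract (u + t))
              (volume.restrict (Ioc (0 : ℝ) 1)) := (hI v).sub (hI u)
          rw [integral_sub (integrable_const _) h6, h5]
          simp
  rw [← ofReal_measureReal]
  refine ENNReal.ofReal_le_ofReal (le_min measureReal_le_one ?_)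
  rwa [abs_sub_comm, abs_of_nonneg (by linarith)]

variable {Ω : Type*} {m m' mA mB T mΩ : MeasurableSpace Ω} {μ : Measure Ω} [IsProbabilityMeasure μ]

/-- Some shift of the integers separates two random variables with probability at most their
expected truncated distance. -/
theorem exists_shift_measure_floor_ne_le {U V : Ω → ℝ} (hU : Measurable U) (hV : Measurable V) :
    ∃ t : ℝ, μ.real {ω | ⌊U ω + t⌋ ≠ ⌊V ω + t⌋} ≤ ∫ ω, min 1 |U ω - V ω| ∂μ := by
  have : IsProbabilityMeasure (volume.restrict (Ioc (0 : ℝ) 1)) := ⟨by simp⟩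
  set D : Set (ℝ × Ω) := {q | ⌊U q.2 + q.1⌋ ≠ ⌊V q.2 + q.1⌋} with hD
  have hDm : MeasurableSet D :=
    (measurableSet_eq_fun
      (Int.measurable_floor.comp ((hU.comp measurable_snd).add measurable_fst))
      (Int.measurable_floor.comp ((hV.comp measurable_snd).add measurable_fst))).compl
  have hint : Integrable (fun ω => min 1 |U ω - V ω|) μ := by
    refine Integrable.of_bound
      (measurable_const.min (hU.sub hV).norm).aestronglyMeasurable 1 ?_
    filter_upwards with ω
    rw [Real.norm_eq_abs, abs_of_nonneg (le_min zero_le_one (abs_nonneg _))]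
    exact min_le_left _ _
  obtain ⟨t, ht⟩ := exists_le_lintegral (μ := volume.restrict (Ioc (0 : ℝ) 1))
    (measurable_measure_prodMk_left (ν := μ) hDm).aemeasurable
  refine ⟨t, ENNReal.toReal_le_of_le_ofReal
    (integral_nonneg fun ω => le_min zero_le_one (abs_nonneg _)) (ht.trans ?_)⟩
  rw [← Measure.prod_apply hDm, Measure.prod_apply_symm hDm,
    ofReal_integral_eq_lintegral_ofReal hint
      (Filter.Eventually.of_forall fun ω => le_min zero_le_one (abs_nonneg _))]
  exact lintegral_mono fun ω => volume_floor_add_ne_le (U ω) (V ω)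

/-! ### Discretizing one of two agreeing expectations -/

/-- If the finer of two conditional expectations lies between bounds known to the coarser
`σ`-algebra, then the two potentials differ by at most twice the Jensen–Bregman divergence of these
bounds: between the bounds, `G` is close to its chord, which is affine. -/
theorem potential_sub_le_of_mem_hull {G : ℝ → ℝ} (hG : IsBregmanGenerator G) {Y l r : Ω → ℝ}
    (hY : Integrable Y μ) (h01 : ∀ᵐ ω ∂μ, Y ω ∈ Icc (0 : ℝ) 1) (hmm' : m ≤ m') (hm' : m' ≤ mΩ)
    (hl : Measurable[m] l) (hr : Measurable[m] r) (hl01 : ∀ ω, l ω ∈ Icc (0 : ℝ) 1)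
    (hr01 : ∀ ω, r ω ∈ Icc (0 : ℝ) 1) (hX : ∀ᵐ ω ∂μ, (μ[Y | m']) ω ∈ Icc (l ω) (r ω)) {η : ℝ}
    (hη : ∀ ω, jensenBregman G (l ω) (r ω) ≤ η) :
    potential G μ Y m' - potential G μ Y m ≤ 2 * η := by
  have hm : m ≤ mΩ := hmm'.trans hm'
  have hGm : ∀ {f : Ω → ℝ}, Measurable[m] f → (∀ ω, f ω ∈ Icc (0 : ℝ) 1) →
      Measurable[m] fun ω => G (f ω) := by
    intro f hf hf01
    have h := (continuous_comp_clamp hG.continuousOn).measurable.comp hf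
    have e : (fun ω => G (f ω)) = (fun x => G (clamp x)) ∘ f := by
      funext ω
      simp only [Function.comp_apply, clamp_of_mem (hf01 ω)]
    rwa [e]
  have hIl : Integrable l μ := integrable_of_ae_mem_Icc (hl.mono hm le_rfl).aestronglyMeasurable
    (Filter.Eventually.of_forall hl01)
  have hIr : Integrable r μ := integrable_of_ae_mem_Icc (hr.mono hm le_rfl).aestronglyMeasurable
    (Filter.Eventually.of_forall hr01)
  have hIGl : Integrable (fun ω => G (l ω)) μ := integrable_comp hG.continuousOn
    (hl.mono hm le_rfl).aestronglyMeasurable (Filter.Eventually.of_forall hl01)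
  set X := μ[Y | m'] with hXdef
  set s : Ω → ℝ := fun ω => (G (r ω) - G (l ω)) / (r ω - l ω) with hs
  have hsm : Measurable[m] s := ((hGm hr hr01).sub (hGm hl hl01)).div (hr.sub hl)
  have hIX : Integrable (X - l) μ := integrable_condExp.sub hIl
  obtain ⟨C, hC⟩ := isCompact_Icc.exists_bound_of_continuousOn hG.continuousOn
  have hIs : Integrable (s * (X - l)) μ := by
    refine Integrable.of_bound ((hsm.mono hm le_rfl).aestronglyMeasurable.mul
      hIX.aestronglyMeasurable) (2 * C) ?_
    filter_upwards [hX] with ω hω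
    have h1 : |G (r ω) - G (l ω)| ≤ 2 * C := by
      have h1 := abs_le.1 (hC _ (hl01 ω))
      have h2 := abs_le.1 (hC _ (hr01 ω))
      rw [abs_le]
      constructor <;> linarith
    rcases (hω.1.trans hω.2).eq_or_lt with h | h
    · simp only [Pi.mul_apply, hs, h, sub_self, div_zero, zero_mul, norm_zero]
      exact (abs_nonneg _).trans h1
    · have h2 : 0 < r ω - l ω := sub_pos.2 h
      simp only [Pi.mul_apply, Pi.sub_apply, hs, Real.norm_eq_abs]
      rw [div_mul_eq_mul_div, abs_div, abs_mul, abs_of_pos h2, div_le_iff₀ h2]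
      refine mul_le_mul h1 ?_ (abs_nonneg _) ((abs_nonneg _).trans h1)
      rw [abs_of_nonneg (by linarith [hω.1])]
      linarith [hω.2]
  have hl' : μ[l | m] = l := condExp_of_stronglyMeasurable hm hl.stronglyMeasurable hIl
  have hr' : μ[r | m] = r := condExp_of_stronglyMeasurable hm hr.stronglyMeasurable hIr
  have htower : μ[X | m] =ᵐ[μ] μ[Y | m] := condExp_condExp_of_le hmm' hm'
  have hZ : ∀ᵐ ω ∂μ, (μ[Y | m]) ω ∈ Icc (l ω) (r ω) := by
    have h1 : μ[l | m] ≤ᵐ[μ] μ[X | m] :=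
      condExp_mono hIl integrable_condExp (hX.mono fun ω h => h.1)
    have h2 : μ[X | m] ≤ᵐ[μ] μ[r | m] :=
      condExp_mono integrable_condExp hIr (hX.mono fun ω h => h.2)
    rw [hl'] at h1
    rw [hr'] at h2
    filter_upwards [h1, h2, htower] with ω a b c
    exact ⟨c ▸ a, c ▸ b⟩
  have hpull : μ[s * (X - l) | m] =ᵐ[μ] s * (μ[Y | m] - l) := by
    refine (condExp_mul_of_stronglyMeasurable_left hsm.stronglyMeasurable hIs hIX).trans ?_
    have h := condExp_sub (m := m) (integrable_condExp : Integrable X μ) hIl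
    filter_upwards [h, htower] with ω a b
    simp only [Pi.mul_apply, Pi.sub_apply] at a ⊢
    rw [a, b, hl']
  have hIs' : Integrable (s * (μ[Y | m] - l)) μ := integrable_condExp.congr hpull
  have h1 : potential G μ Y m' ≤ ∫ ω, (G (l ω) + (s * (X - l)) ω) ∂μ := by
    refine integral_mono_ae (integrable_comp_condExp hG.continuousOn hY h01 hm') (hIGl.add hIs) ?_
    filter_upwards [hX] with ω hω
    exact le_chord hG.convexOn (hl01 ω) (hr01 ω) hω
  have h2 : ∫ ω, (G (l ω) + (s * (X - l)) ω) ∂μ = ∫ ω, (G (l ω) + (s * (μ[Y | m] - l)) ω) ∂μ := by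
    rw [integral_add hIGl hIs, integral_add hIGl hIs', ← integral_condExp hm (f := s * (X - l)),
      integral_congr_ae hpull]
  have h3 : ∫ ω, (G (l ω) + (s * (μ[Y | m] - l)) ω) ∂μ - potential G μ Y m ≤ 2 * η := by
    have hIm := integrable_comp_condExp hG.continuousOn hY h01 hm
    have hIsum : Integrable (fun ω => G (l ω) + (s * (μ[Y | m] - l)) ω) μ := hIGl.add hIs'
    rw [potential, ← integral_sub hIsum hIm]
    calc ∫ ω, (G (l ω) + (s * (μ[Y | m] - l)) ω - G ((μ[Y | m]) ω)) ∂μ ≤ ∫ _, 2 * η ∂μ := by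
          refine integral_mono_ae (hIsum.sub hIm) (integrable_const _) ?_
          filter_upwards [hZ] with ω hω
          have h4 := chord_sub_le hG.convexOn (hl01 ω) (hr01 ω) hω
          exact h4.trans (by linarith [hη ω])
      _ = 2 * η := by simp
  linarith

/-- If `[0, 1]` is divided into pieces of small Jensen–Bregman diameter, then information that
determines the piece in which a finer conditional expectation lies has nearly the same potential as
the finer information. -/
theorem potential_sub_le_of_label {G : ℝ → ℝ} (hG : IsBregmanGenerator G) {Y : Ω → ℝ}
    (hY : Integrable Y μ) (h01 : ∀ᵐ ω ∂μ, Y ω ∈ Icc (0 : ℝ) 1) (hmm' : m ≤ m') (hm' : m' ≤ mΩ)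
    {κ : ℝ → ℤ} (hκ : Measurable[m] fun ω => κ (clamp ((μ[Y | m']) ω))) {η : ℝ} (hη0 : 0 ≤ η)
    (hη : ∀ x ∈ Icc (0 : ℝ) 1, ∀ y ∈ Icc (0 : ℝ) 1, κ x = κ y → jensenBregman G x y ≤ η) :
    potential G μ Y m' - potential G μ Y m ≤ 2 * η := by
  let C : ℤ → Set ℝ := fun j => {x | x ∈ Icc (0 : ℝ) 1 ∧ κ x = j}
  have hCsub : ∀ j, C j ⊆ Icc 0 1 := fun j x hx => hx.1
  have hbb : ∀ j, BddBelow (C j) := fun j => bddBelow_Icc.mono (hCsub j)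
  have hba : ∀ j, BddAbove (C j) := fun j => bddAbove_Icc.mono (hCsub j)
  have hcl : ∀ j, closure (C j) ⊆ Icc 0 1 := fun j => closure_minimal (hCsub j) isClosed_Icc
  have h0 : (0 : ℝ) ∈ Icc (0 : ℝ) 1 := ⟨le_rfl, zero_le_one⟩
  have hinf : ∀ j, sInf (C j) ∈ Icc (0 : ℝ) 1 := by
    intro j
    rcases (C j).eq_empty_or_nonempty with h | h
    · rwa [h, Real.sInf_empty]
    · exact hcl j (csInf_mem_closure h (hbb j))
  have hsup : ∀ j, sSup (C j) ∈ Icc (0 : ℝ) 1 := by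
    intro j
    rcases (C j).eq_empty_or_nonempty with h | h
    · rwa [h, Real.sSup_empty]
    · exact hcl j (csSup_mem_closure h (hba j))
  have hJ : ∀ j, jensenBregman G (sInf (C j)) (sSup (C j)) ≤ η := by
    intro j
    rcases (C j).eq_empty_or_nonempty with h | h
    · rwa [h, Real.sInf_empty, Real.sSup_empty, jensenBregman_self]
    have hcont : Continuous fun q : ℝ × ℝ => jensenBregman G (clamp q.1) (clamp q.2) :=
      (continuousOn_jensenBregman hG.continuousOn).comp_continuous
        (f := fun q : ℝ × ℝ => (clamp q.1, clamp q.2))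
        ((continuous_clamp.comp continuous_fst).prodMk (continuous_clamp.comp continuous_snd))
        fun q => ⟨clamp_mem _, clamp_mem _⟩
    have hsub : closure (C j ×ˢ C j) ⊆ {q | jensenBregman G (clamp q.1) (clamp q.2) ≤ η} := by
      refine closure_minimal ?_ (isClosed_le hcont continuous_const)
      rintro ⟨x, y⟩ ⟨hx, hy⟩
      simp only [mem_ofPred_eq, clamp_of_mem hx.1, clamp_of_mem hy.1]
      exact hη x hx.1 y hy.1 (hx.2.trans hy.2.symm)
    rw [closure_prod_eq] at hsub
    have := hsub (mk_mem_prod (csInf_mem_closure h (hbb j)) (csSup_mem_closure h (hba j)))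
    simpa only [mem_ofPred_eq, clamp_of_mem (hinf j), clamp_of_mem (hsup j)] using this
  refine potential_sub_le_of_mem_hull hG hY h01 hmm' hm'
    (l := fun ω => sInf (C (κ (clamp ((μ[Y | m']) ω)))))
    (r := fun ω => sSup (C (κ (clamp ((μ[Y | m']) ω)))))
    ((measurable_of_countable fun j => sInf (C j)).comp hκ)
    ((measurable_of_countable fun j => sSup (C j)).comp hκ)
    (fun ω => hinf _) (fun ω => hsup _) ?_ fun ω => hJ _
  filter_upwards [ae_condExp_mem_Icc hY h01 hm'] with ω hω
  have hmem : (μ[Y | m']) ω ∈ C (κ (clamp ((μ[Y | m']) ω))) := ⟨hω, by rw [clamp_of_mem hω]⟩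
  exact ⟨csInf_le (hbb _) hmem, le_csSup (hba _) hmem⟩

/-- A label which is almost known already raises the potential only a little. -/
theorem potential_sup_comap_sub_le {G : ℝ → ℝ} (hG : ContinuousOn G (Icc 0 1)) {Y : Ω → ℝ}
    (hY : Integrable Y μ) (h01 : ∀ᵐ ω ∂μ, Y ω ∈ Icc (0 : ℝ) 1) (hm : m ≤ mΩ) {k k' : Ω → ℤ}
    (hk : Measurable k) (hk' : Measurable[m] k') {z : ℝ} (hz : μ.real {ω | k ω ≠ k' ω} ≤ 4 * z) :
    potential G μ Y (m ⊔ MeasurableSpace.comap k ⊤) - potential G μ Y m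
      ≤ 9 * modulusEnvelope G z := by
  have hM : m ⊔ MeasurableSpace.comap k ⊤ ≤ mΩ := sup_le hm hk.comap_le
  have hne : MeasurableSet {ω | k ω ≠ k' ω} :=
    (measurableSet_eq_fun hk (hk'.mono hm le_rfl)).compl
  have hE := integral_abs_condExp_sub_condExp_sup_comap_le hY h01 hm hk hk' hne
  have hz0 : 0 ≤ z := by linarith [measureReal_nonneg (μ := μ) (s := {ω | k ω ≠ k' ω})]
  have henv := modulusEnvelope_nonneg hG z
  set b' := μ[Y | m ⊔ MeasurableSpace.comap k ⊤] with hb'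
  set b := μ[Y | m] with hb
  have hI : Integrable (fun ω => |b' ω - b ω|) μ := (integrable_condExp.sub integrable_condExp).abs
  have hE8 : ∫ ω, |b' ω - b ω| ∂μ ≤ 8 * z := by
    refine hE.trans ?_
    linarith
  have hb'01 : ∀ᵐ ω ∂μ, b' ω ∈ Icc (0 : ℝ) 1 := ae_condExp_mem_Icc hY h01 hM
  have hb01 : ∀ᵐ ω ∂μ, b ω ∈ Icc (0 : ℝ) 1 := ae_condExp_mem_Icc hY h01 hm
  rcases hz0.eq_or_lt with rfl | hzpos
  · have h0 : ∫ ω, |b' ω - b ω| ∂μ = 0 :=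
      le_antisymm (by linarith) (integral_nonneg fun ω => abs_nonneg _)
    have hae := (integral_eq_zero_iff_of_nonneg (fun ω => abs_nonneg _) hI).1 h0
    have : b' =ᵐ[μ] b := hae.mono fun ω hω => sub_eq_zero.1 (abs_eq_zero.1 hω)
    rw [potential_congr this, sub_self]
    positivity
  · set z₁ := min z 1 with hz₁
    have hz₁pos : 0 < z₁ := lt_min hzpos one_pos
    have hE1 : ∫ ω, |b' ω - b ω| ∂μ ≤ 1 := by
      calc ∫ ω, |b' ω - b ω| ∂μ ≤ ∫ _, (1 : ℝ) ∂μ := by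
            refine integral_mono_ae hI (integrable_const _) ?_
            filter_upwards [hb'01, hb01] with ω h1 h2
            rw [abs_le]
            constructor <;> linarith [h1.1, h1.2, h2.1, h2.2]
        _ = 1 := by simp
    have hE' : (∫ ω, |b' ω - b ω| ∂μ) / z₁ ≤ 8 := by
      rw [div_le_iff₀ hz₁pos, hz₁]
      rcases le_total z 1 with h | h
      · rwa [min_eq_left h]
      · rw [min_eq_right h]; linarith
    have hmod0 : 0 ≤ modulus G z₁ := modulus_nonneg hG hz₁pos.le
    rw [potential, potential, ← integral_sub (integrable_comp_condExp hG hY h01 hM)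
      (integrable_comp_condExp hG hY h01 hm)]
    calc ∫ ω, (G (b' ω) - G (b ω)) ∂μ
        ≤ ∫ ω, (1 + |b' ω - b ω| / z₁) * modulus G z₁ ∂μ := by
          refine integral_mono_ae ((integrable_comp_condExp hG hY h01 hM).sub
            (integrable_comp_condExp hG hY h01 hm))
            (((integrable_const _).add (hI.div_const _)).mul_const _) ?_
          filter_upwards [hb'01, hb01] with ω h1 h2
          exact sub_le_mul_modulus hG h1 h2 hz₁pos
      _ = (1 + (∫ ω, |b' ω - b ω| ∂μ) / z₁) * modulus G z₁ := by
          rw [integral_mul_const, integral_add (integrable_const _) (hI.div_const _),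
            integral_div]
          simp
      _ ≤ 9 * modulus G z₁ := by
          refine mul_le_mul_of_nonneg_right ?_ hmod0
          linarith
      _ ≤ 9 * modulusEnvelope G z := by
          linarith [modulus_le_modulusEnvelope hG hz0]

/-- The accuracy of Bob's expectation, in terms of potentials; `T` is the public information.  Let
`T'` be `T` together with a rounded version of Alice's expectation.  Given `T'`, Alice's expectation
is nearly determined, so that her signal adds little potential; by substitutability it adds no more
for Bob once he knows `T'`.  And since Bob's own expectation, rounded in the same way, rarely
differs from the rounded expectation of Alice, learning `T'` adds little potential for him as well.
-/
theorem potential_sub_le_of_agreement {G : ℝ → ℝ} (hG : IsBregmanGenerator G) {c : ℝ} (hc : 0 < c)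
    (hGc : ApproxTriangle G c) {Y : Ω → ℝ} (hY : Integrable Y μ)
    (h01 : ∀ᵐ ω ∂μ, Y ω ∈ Icc (0 : ℝ) 1) (hA : mA ≤ mΩ) (hB : mB ≤ mΩ) (hT : T ≤ mA ⊔ mB)
    (hsub : ∀ T' : MeasurableSpace Ω, T ≤ T' → T' ≤ mA ⊔ T →
      potential G μ Y (mA ⊔ mB) + potential G μ Y T'
        ≤ potential G μ Y (mA ⊔ T') + potential G μ Y (mB ⊔ T'))
    {ε : ℝ} (hε : ∫ ω, jensenBregman G ((μ[Y | mA ⊔ T]) ω) ((μ[Y | mB ⊔ T]) ω) ∂μ ≤ ε)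
    {β : ℝ} (hβ : 0 < β) :
    potential G μ Y (mA ⊔ mB) - potential G μ Y (mB ⊔ T) ≤ 8 / c ^ 2 * β
      + 16 * modulusEnvelope G ((ε / β) ^ (1 / (1 - Real.logb 2 c))) := by
  have hTΩ : T ≤ mΩ := hT.trans (sup_le hA hB)
  have hAT : mA ⊔ T ≤ mΩ := sup_le hA hTΩ
  have hBT : mB ⊔ T ≤ mΩ := sup_le hB hTΩ
  have henv := modulusEnvelope_nonneg hG.continuousOn ((ε / β) ^ (1 / (1 - Real.logb 2 c)))
  have hJnn := fun x y => jensenBregman_nonneg hG.convexOn (clamp_mem x) (clamp_mem y)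
  rcases lt_or_ge 1 c with hc1 | hc1
  · -- Here `G` is affine, and all conditional expectations have the same potential.
    have h0 : (0 : ℝ) ∈ Icc (0 : ℝ) 1 := ⟨le_rfl, zero_le_one⟩
    have h1 : (1 : ℝ) ∈ Icc (0 : ℝ) 1 := ⟨zero_le_one, le_rfl⟩
    have hJ0 : jensenBregman G 0 1 ≤ 0 := by
      have h := hGc 0 h0 1 h1 0 h0
      rw [jensenBregman_self, zero_add] at h
      nlinarith
    have h := potential_sub_le_of_mem_hull hG hY h01 (m := mB ⊔ T) (m' := mA ⊔ mB)
      (sup_le le_sup_right hT) (sup_le hA hB) (l := fun _ => 0) (r := fun _ => 1)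
      measurable_const measurable_const (fun _ => h0) (fun _ => h1)
      (ae_condExp_mem_Icc hY h01 (sup_le hA hB)) (η := 0) fun _ => hJ0
    have : 0 ≤ 8 / c ^ 2 * β := by positivity
    linarith
  set p := 1 / (1 - Real.logb 2 c) with hp
  have hlog : Real.logb 2 c ≤ 0 := Real.logb_nonpos (by norm_num) hc.le hc1
  have hp0 : 0 < p := by rw [hp]; apply one_div_pos.2; linarith
  have hp1 : p ≤ 1 := by rw [hp, div_le_one (by linarith)]; linarith
  set z := (ε / β) ^ p with hz
  have hβp : 0 < β ^ p := Real.rpow_pos_of_pos hβ p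
  -- The scale at which sets of diameter `8 r` for the power `p` of the Jensen–Bregman divergence
  -- have diameter `4 β / c ^ 2` for the divergence itself.
  set r := β ^ p / 2 with hr
  have hr0 : 0 < r := by positivity
  obtain ⟨F, hFm, hF1, hF2⟩ := exists_jensenBregman_coordinate hG hc hc1 hGc hr0
  set a : Ω → ℝ := fun ω => clamp ((μ[Y | mA ⊔ T]) ω) with ha
  set b : Ω → ℝ := fun ω => clamp ((μ[Y | mB ⊔ T]) ω) with hb
  have ham : Measurable[mA ⊔ T] a :=
    continuous_clamp.measurable.comp stronglyMeasurable_condExp.measurable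
  have hbm : Measurable[mB ⊔ T] b :=
    continuous_clamp.measurable.comp stronglyMeasurable_condExp.measurable
  have hamΩ : Measurable a := ham.mono hAT le_rfl
  have hbmΩ : Measurable b := hbm.mono hBT le_rfl
  have hcont : Continuous fun q : ℝ × ℝ => jensenBregman G (clamp q.1) (clamp q.2) :=
    (continuousOn_jensenBregman hG.continuousOn).comp_continuous
      (f := fun q : ℝ × ℝ => (clamp q.1, clamp q.2))
      ((continuous_clamp.comp continuous_fst).prodMk (continuous_clamp.comp continuous_snd))
      fun q => ⟨clamp_mem _, clamp_mem _⟩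
  have hJm : Measurable fun ω => jensenBregman G (a ω) (b ω) :=
    hcont.measurable.comp ((stronglyMeasurable_condExp.measurable.mono hAT le_rfl).prodMk
      (stronglyMeasurable_condExp.measurable.mono hBT le_rfl))
  obtain ⟨C, hC⟩ := (isCompact_Icc.prod isCompact_Icc).exists_bound_of_continuousOn
    (continuousOn_jensenBregman hG.continuousOn)
  have hJC : ∀ ω, jensenBregman G (a ω) (b ω) ≤ C := fun ω =>
    (le_abs_self _).trans (hC (a ω, b ω) ⟨clamp_mem _, clamp_mem _⟩)
  have hJI : Integrable (fun ω => jensenBregman G (a ω) (b ω)) μ := by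
    refine Integrable.of_bound hJm.aestronglyMeasurable C ?_
    filter_upwards with ω
    rw [Real.norm_eq_abs, abs_of_nonneg (hJnn _ _)]
    exact hJC ω
  have hJpI : Integrable (fun ω => jensenBregman G (a ω) (b ω) ^ p) μ := by
    refine Integrable.of_bound (hJm.pow_const p).aestronglyMeasurable (C ^ p) ?_
    filter_upwards with ω
    rw [Real.norm_eq_abs, abs_of_nonneg (Real.rpow_nonneg (hJnn _ _) _)]
    exact Real.rpow_le_rpow (hJnn _ _) (hJC ω) hp0.le
  have hJε : ∫ ω, jensenBregman G (a ω) (b ω) ∂μ ≤ ε := by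
    refine le_trans (le_of_eq (integral_congr_ae ?_)) hε
    filter_upwards [ae_condExp_mem_Icc hY h01 hAT, ae_condExp_mem_Icc hY h01 hBT] with ω h1 h2
    simp only [ha, hb, clamp_of_mem h1, clamp_of_mem h2]
  have hJ0 : 0 ≤ ∫ ω, jensenBregman G (a ω) (b ω) ∂μ := integral_nonneg fun ω => hJnn _ _
  have hε0 : 0 ≤ ε := hJ0.trans hJε
  have hJensen : ∫ ω, jensenBregman G (a ω) (b ω) ^ p ∂μ ≤ ε ^ p := by
    have h := (Real.concaveOn_rpow hp0.le hp1).le_map_integral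
      (Real.continuous_rpow_const hp0.le).continuousOn isClosed_Ici
      (Filter.Eventually.of_forall fun ω => hJnn _ _) hJI hJpI
    exact h.trans (Real.rpow_le_rpow hJ0 hJε hp0.le)
  have hmin : ∫ ω, min 1 |F (a ω) - F (b ω)| ∂μ ≤ 4 * z := by
    calc ∫ ω, min 1 |F (a ω) - F (b ω)| ∂μ
        ≤ ∫ ω, 2 * jensenBregman G (a ω) (b ω) ^ p / r ∂μ := by
          refine integral_mono_of_nonneg
            (Filter.Eventually.of_forall fun ω => le_min zero_le_one (abs_nonneg _))
            ((hJpI.const_mul 2).div_const r) (Filter.Eventually.of_forall fun ω => ?_)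
          exact hF1 _ (clamp_mem _) _ (clamp_mem _)
      _ = 2 * (∫ ω, jensenBregman G (a ω) (b ω) ^ p ∂μ) / r := by
          rw [integral_div, integral_const_mul]
      _ ≤ 2 * ε ^ p / r := by gcongr
      _ = 4 * z := by
          rw [hz, Real.div_rpow hε0 hβ.le, hr]
          field_simp
          ring
  obtain ⟨t, ht⟩ := exists_shift_measure_floor_ne_le (μ := μ) (hFm.comp hamΩ) (hFm.comp hbmΩ)
  have hflm : Measurable fun x => ⌊F x + t⌋ := Int.measurable_floor.comp (hFm.add_const t)
  set k : Ω → ℤ := fun ω => ⌊F (a ω) + t⌋ with hk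
  have hkm : Measurable[mA ⊔ T] k := hflm.comp ham
  have hkle : MeasurableSpace.comap k ⊤ ≤ mA ⊔ T := hkm.comap_le
  have hAT' : mA ⊔ (T ⊔ MeasurableSpace.comap k ⊤) = mA ⊔ T :=
    le_antisymm (sup_le le_sup_left (sup_le le_sup_right hkle)) (sup_le_sup_left le_sup_left _)
  have hmain := hsub (T ⊔ MeasurableSpace.comap k ⊤) le_sup_left (sup_le le_sup_right hkle)
  rw [hAT', ← sup_assoc] at hmain
  have hfirst : potential G μ Y (mA ⊔ T) - potential G μ Y (T ⊔ MeasurableSpace.comap k ⊤)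
      ≤ 2 * (4 * β / c ^ 2) := by
    refine potential_sub_le_of_label hG hY h01 (sup_le le_sup_right hkle) hAT
      (κ := fun x => ⌊F x + t⌋) ?_ (by positivity) ?_
    · exact (comap_measurable k).mono le_sup_right le_rfl
    · intro x hx y hy hxy
      have h1 : |F x - F y| < 1 := by
        have := Int.abs_sub_lt_one_of_floor_eq_floor hxy
        simpa using this
      have h2 := hF2 x hx y hy h1
      have hJxy := jensenBregman_nonneg hG.convexOn hx hy
      refine (Real.rpow_le_rpow_iff hJxy (by positivity) hp0).1 (h2.trans (le_of_eq ?_))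
      have e : 4 * β / c ^ 2 = 2 / c * (2 / c) * β := by field_simp; ring
      rw [e, Real.mul_rpow (by positivity) hβ.le, Real.mul_rpow (by positivity) (by positivity),
        two_div_rpow hc hc1, hr]
      ring
  have hsecond := potential_sup_comap_sub_le hG.continuousOn hY h01 hBT (hflm.comp hamΩ)
    (hflm.comp hbm) (ht.trans hmin)
  have e8 : 2 * (4 * β / c ^ 2) = 8 / c ^ 2 * β := by ring
  have hsecond' : potential G μ Y (mB ⊔ T ⊔ MeasurableSpace.comap k ⊤) - potential G μ Y (mB ⊔ T)
      ≤ 9 * modulusEnvelope G z := hsecond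
  linarith

/-! ### Rectangle substitutes and the accuracy of agreeing parties -/

/-- Conditioning on a further event known to `m` does not change conditional expectations
given `m`. -/
theorem condExp_cond_inter_ae_eq {Ω : Type*} {m mΩ : MeasurableSpace Ω} {μ : Measure Ω}
    [IsProbabilityMeasure μ] {Y : Ω → ℝ} (hY : Integrable Y μ) (hm : m ≤ mΩ) {s t : Set Ω}
    (hs : MeasurableSet s) (ht : MeasurableSet[m] t) (hst : μ (s ∩ t) ≠ 0) :
    (μ[|s])[Y | m] =ᵐ[μ[|s ∩ t]] (μ[|s ∩ t])[Y | m] := by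
  have hs0 : μ s ≠ 0 := fun h => hst (measure_mono_null inter_subset_left h)
  have := cond_isProbabilityMeasure hs0
  have ht0 : (μ[|s]) t ≠ 0 := by
    rw [cond_apply hs]
    exact mul_ne_zero (ENNReal.inv_ne_zero.2 (measure_ne_top μ s)) hst
  have h := condExp_cond_ae_eq (integrable_cond hs0 hY) hm ht ht0
  rw [cond_cond_eq_cond_inter hs (hm _ ht)] at h
  exact h.symm

theorem integral_bregman_of_ae_eq_condExp {Ω : Type*} {m mΩ : MeasurableSpace Ω} {μ : Measure Ω}
    [IsProbabilityMeasure μ] {G : ℝ → ℝ} (hG : IsBregmanGenerator G) {Y X : Ω → ℝ}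
    (hY : Integrable Y μ) (h01 : ∀ᵐ ω ∂μ, Y ω ∈ Icc (0 : ℝ) 1) (hm : m ≤ mΩ)
    (hX : X =ᵐ[μ] μ[Y | m]) :
    ∫ ω, bregman G (Y ω) (X ω) ∂μ = (∫ ω, G (Y ω) ∂μ) - potential G μ Y m := by
  rw [← (integrable_bregman_condExp hG hY h01 hm).2]
  refine integral_congr_ae ?_
  filter_upwards [hX] with ω hω
  rw [hω]

section Info

variable {Ω S T : Type*} {F F' mΩ : MeasurableSpace Ω} [MeasurableSpace S] [MeasurableSpace T]

theorem InfoStructure.integrable_Y (I : InfoStructure Ω S T) : Integrable I.Y I.P := by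
  have := I.isProb
  exact integrable_of_ae_mem_Icc I.measurable_Y.aestronglyMeasurable
    (Filter.Eventually.of_forall I.Y_mem)

/-- Rectangle substitutes in terms of potentials: in the expected divergences, the term `E G(Y)`
cancels. -/
theorem InfoStructure.RectangleSubstitutes.potential_add_le {I : InfoStructure Ω S T} {G : ℝ → ℝ}
    (hI : I.RectangleSubstitutes G) (hG : IsBregmanGenerator G) {s t : Set Ω}
    (hs : MeasurableSet[I.algA] s) (ht : MeasurableSet[I.algB] t) (hst : I.P (s ∩ t) ≠ 0) :
    potential G (I.P[|s ∩ t]) I.Y (I.algA ⊔ I.algB) + potential G (I.P[|s ∩ t]) I.Y ⊥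
      ≤ potential G (I.P[|s ∩ t]) I.Y I.algA + potential G (I.P[|s ∩ t]) I.Y I.algB := by
  have := I.isProb
  have hsm : MeasurableSet s := algA_le I _ hs
  have htm : MeasurableSet t := algB_le I _ ht
  have hboth := condExp_cond_ae_eq I.integrable_Y (algA_sup_algB_le I)
    (MeasurableSet.inter ((le_sup_left : I.algA ≤ I.algA ⊔ I.algB) _ hs)
      ((le_sup_right : I.algB ≤ I.algA ⊔ I.algB) _ ht)) hst
  have hb := condExp_cond_inter_ae_eq I.integrable_Y (algB_le I) hsm ht hst
  have ha := condExp_cond_inter_ae_eq I.integrable_Y (algA_le I) htm hs (by rwa [inter_comm])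
  rw [inter_comm t s] at ha
  have hν := cond_isProbabilityMeasure hst
  have hY := integrable_cond hst I.integrable_Y
  have h01 : ∀ᵐ ω ∂(I.P[|s ∩ t]), I.Y ω ∈ Icc (0 : ℝ) 1 := Filter.Eventually.of_forall I.Y_mem
  have e0 : (fun _ => ∫ ω, I.Y ω ∂(I.P[|s ∩ t])) =ᵐ[I.P[|s ∩ t]] (I.P[|s ∩ t])[I.Y | ⊥] := by
    rw [condExp_bot]
  obtain ⟨A, hA, rfl⟩ := hs
  obtain ⟨B, hB, rfl⟩ := ht
  have h := hI A hA B hB hst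
  have h1 := integral_bregman_of_ae_eq_condExp hG hY h01 (algB_le I) hb
  have h2 := integral_bregman_of_ae_eq_condExp hG hY h01 (algA_sup_algB_le I) hboth.symm
  have h3 := integral_bregman_of_ae_eq_condExp hG hY h01 bot_le e0
  have h4 := integral_bregman_of_ae_eq_condExp hG hY h01 (algA_le I) ha
  change (∫ ω, bregman G (I.Y ω) (((I.P[|I.sigA ⁻¹' A])[I.Y | I.algB]) ω)
      ∂(I.P[|I.sigA ⁻¹' A ∩ I.sigB ⁻¹' B]))
    - (∫ ω, bregman G (I.Y ω) ((I.P[I.Y | I.algA ⊔ I.algB]) ω)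
      ∂(I.P[|I.sigA ⁻¹' A ∩ I.sigB ⁻¹' B]))
    ≤ (∫ ω, bregman G (I.Y ω) (∫ ω, I.Y ω ∂(I.P[|I.sigA ⁻¹' A ∩ I.sigB ⁻¹' B]))
      ∂(I.P[|I.sigA ⁻¹' A ∩ I.sigB ⁻¹' B]))
    - (∫ ω, bregman G (I.Y ω) (((I.P[|I.sigB ⁻¹' B])[I.Y | I.algA]) ω)
      ∂(I.P[|I.sigA ⁻¹' A ∩ I.sigB ⁻¹' B])) at h
  linarith

/-- The substitutes inequality for public information that is approximable by rectangles. -/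
theorem InfoStructure.RectangleSubstitutes.potential_add_le_of_approximable
    {I : InfoStructure Ω S T} {G : ℝ → ℝ} (hI : I.RectangleSubstitutes G)
    (hG : IsBregmanGenerator G) (hF : RectangleApproximable I.algA I.algB I.P F) (hFΩ : F ≤ mΩ) :
    potential G I.P I.Y (I.algA ⊔ I.algB) + potential G I.P I.Y F
      ≤ potential G I.P I.Y (I.algA ⊔ F) + potential G I.P I.Y (I.algB ⊔ F) := by
  have := I.isProb
  exact potential_add_le_of_rectangleApproximable hG.continuousOn I.integrable_Y
    (Filter.Eventually.of_forall I.Y_mem) (algA_le I) (algB_le I)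
    (fun s t hs ht hst => hI.potential_add_le hG hs ht hst) hFΩ hF

/-- The substitutes inequality persists when Alice announces a part of her information. -/
theorem InfoStructure.RectangleSubstitutes.potential_add_le_of_le_algA_sup
    {I : InfoStructure Ω S T} {G : ℝ → ℝ} (hI : I.RectangleSubstitutes G)
    (hG : IsBregmanGenerator G) (hF : RectangleApproximable I.algA I.algB I.P F) (hFΩ : F ≤ mΩ)
    (h : F ≤ F') (h' : F' ≤ I.algA ⊔ F) :
    potential G I.P I.Y (I.algA ⊔ I.algB) + potential G I.P I.Y F'
      ≤ potential G I.P I.Y (I.algA ⊔ F') + potential G I.P I.Y (I.algB ⊔ F') := by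
  have := I.isProb
  exact hI.potential_add_le_of_approximable hG (hF.of_le_sup_left (algA_le I) hFΩ h h')
    (h'.trans (sup_le (algA_le I) hFΩ))

/-- The substitutes inequality persists when Bob announces a part of his information. -/
theorem InfoStructure.RectangleSubstitutes.potential_add_le_of_le_algB_sup
    {I : InfoStructure Ω S T} {G : ℝ → ℝ} (hI : I.RectangleSubstitutes G)
    (hG : IsBregmanGenerator G) (hF : RectangleApproximable I.algA I.algB I.P F) (hFΩ : F ≤ mΩ)
    (h : F ≤ F') (h' : F' ≤ I.algB ⊔ F) :
    potential G I.P I.Y (I.algB ⊔ I.algA) + potential G I.P I.Y F'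
      ≤ potential G I.P I.Y (I.algB ⊔ F') + potential G I.P I.Y (I.algA ⊔ F') := by
  have := I.isProb
  rw [sup_comm I.algB I.algA, add_comm (potential G I.P I.Y (I.algB ⊔ F'))]
  exact hI.potential_add_le_of_approximable hG (hF.of_le_sup_right (algB_le I) hFΩ h h')
    (h'.trans (sup_le (algB_le I) hFΩ))

end Info

end AgreementAccuracy

end

theorem theorem4p6 {Ω S T M : Type*}
    [MeasurableSpace Ω] [MeasurableSpace S] [MeasurableSpace T] [MeasurableSpace M]
    (G : ℝ → ℝ) (hG : AgreementAccuracy.IsBregmanGenerator G)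
    (c : ℝ) (hc : 0 < c) (hGc : AgreementAccuracy.ApproxTriangle G c)
    (I : AgreementAccuracy.InfoStructure Ω S T) (hI : I.RectangleSubstitutes G)
    (π : AgreementAccuracy.Protocol S T M) (ε : ℝ) (hπ : π.CausesAgreement I G ε)
    (β : ℝ) (hβ : 0 < β) :
    I.Accurate G (π.aliceExpectation I)
        (8 / c ^ 2 * β
          + 16 * AgreementAccuracy.modulusEnvelope G ((ε / β) ^ (1 / (1 - Real.logb 2 c)))) ∧
      I.Accurate G (π.bobExpectation I)
        (8 / c ^ 2 * β
          + 16 * AgreementAccuracy.modulusEnvelope G ((ε / β) ^ (1 / (1 - Real.logb 2 c)))) := by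
  have := I.isProb
  have hY := I.integrable_Y
  have h01 : ∀ᵐ ω ∂I.P, I.Y ω ∈ Icc (0 : ℝ) 1 := Filter.Eventually.of_forall I.Y_mem
  have hA := AgreementAccuracy.algA_le I
  have hB := AgreementAccuracy.algB_le I
  have hAB := AgreementAccuracy.algA_sup_algB_le I
  have hT := AgreementAccuracy.algTranscript_le π I
  have hTΩ := hT.trans hAB
  have happ := AgreementAccuracy.rectangleApproximable_algTranscript π I hπ.1
  constructor
  · have h := AgreementAccuracy.integrable_bregman_condExp_condExp hG hY h01
      (m := I.algA ⊔ π.algTranscript I) (sup_le le_sup_left hT) hAB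
    refine ⟨h.1, h.2.le.trans ?_⟩
    rw [sup_comm I.algA I.algB]
    refine AgreementAccuracy.potential_sub_le_of_agreement hG hc hGc hY h01 hB hA
      (hT.trans_eq (sup_comm _ _))
      (fun _ => hI.potential_add_le_of_le_algB_sup hG happ hTΩ) (le_trans (le_of_eq ?_) hπ.2) hβ
    exact integral_congr_ae (Filter.Eventually.of_forall fun ω =>
      AgreementAccuracy.jensenBregman_comm G _ _)
  · have h := AgreementAccuracy.integrable_bregman_condExp_condExp hG hY h01
      (m := I.algB ⊔ π.algTranscript I) (sup_le le_sup_right hT) hAB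
    refine ⟨h.1, h.2.le.trans ?_⟩
    exact AgreementAccuracy.potential_sub_le_of_agreement hG hc hGc hY h01 hA hB hT
      (fun _ => hI.potential_add_le_of_le_algA_sup hG happ hTΩ) hπ.2 hβ
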